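/- Setting. Let $r\ge 4$, $0<\varepsilon_0<\varepsilon_1$ and $\xi(s)=1+|s|^r$. Let $S$ be a closed connected Riemannian surface containing a neck isometric to the surface of revolution $(s,\xi(s)\cos\theta,\xi(s)\sin\theta)$, $|s|<\varepsilon_1$, and with negative curvature off the closed geodesic $\{s=0\}$ (the $C^4$ surface carries a metric of class $C^3$ or better). Let $g_t$ be the geodesic flow on $M=T^1S$. Over the neck, write $x\in M$ in Clairaut coordinates $(s,\theta,\psi)$, where $\psi$ is the angle with the circle $s=\text{const}$, so that $s'=\sin\psi/\sqrt{1+\xi'(s)^2}$ and $\theta'=\cos\psi/\xi(s)$, and let $c(x)=\xi(s)\cos\psi$. For $\chi>0$ let $$\Omega_\pm=\{x:\ |s|=\varepsilon_0,\ \mp s\sin\psi>0,\ ||c(x)|-1|<\chi\}$$ ($\Omega_+$ consists of vectors entering $\{|s|\le\varepsilon_0\}$, $\Omega_-$ of vectors leaving it), $\Omega_+^{=}=\{x\in\Omega_+: |c(x)|=1\}$, and $g_{[-\chi,\chi]}A=\bigcup_{|t|\le\chi}g_t(A)$. Let $\Sigma_0\subset M$ be a Poincaré section adapted to the neck, i.e.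 a compact set such that: (i) near each of its points, $\Sigma_0$ is contained in a $C^1$ surface transverse to the flow (e.g. $\Sigma_0$ is a finite disjoint union of compact pieces of transverse surfaces); (ii) for every $x\in\Omega_+\cup\Omega_-$ there is $|t|\le\chi$ with $g_tx\in\Sigma_0$; (iii) there is a compact $N_+\subset\Omega_+$, a neighbourhood of $\Omega_+^{=}$ in $\Omega_+$, such that orbits starting in $N_+$, until they reach $\Omega_-$, meet $\Sigma_0$ only in $g_{[-\chi,\chi]}(\Omega_+\cup\Omega_-)$. Let $f$ be the first return map of $g_t$ to $\Sigma_0$, and for $n_0\ge1$ let $$\Sigma_+=\{x\in\Sigma_0\cap g_{[-\chi,\chi]}\Omega_+:\ ||c(x)|-1|<n_0^{-2},\ f(x) \text{ is defined and lies in } g_{[-\chi,\chi]}\Omega_-\},\qquad \Sigma_-=f(\Sigma_+).$$ For $x\in\Sigma_+$ let $\Upsilon(x)$ be the time that the flow takes to pass from $x$ to $\Sigma_-$; this is the return time of $x$ to $\Sigma_0$. Let $\mathrm{Leb}$ be the Lebesgue (two-dimensional Hausdorff) measure on $\Sigma_+$ in Clairaut coordinates. Statement (Lemma 5.3). There is $\chi_0=\chi_0(r,\varepsilon_0,\varepsilon_1)>0$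 such that, for all $0<\chi<\chi_0$, all $S$ and all $\Sigma_0$ as above, and all sufficiently large $n_0$, $$\mathrm{Leb}\{x\in\Sigma_+:\Upsilon(x)>n\}\approx n^{-\frac{2r}{r-2}},$$ that is, there is $C>0$, independent of $n$, with $C^{-1}n^{-\frac{2r}{r-2}}\le \mathrm{Leb}\{x\in\Sigma_+:\Upsilon(x)>n\}\le C\,n^{-\frac{2r}{r-2}}$ for all sufficiently large integers $n$. Thus, with $a=\frac{r+2}{r-2}$, the return time to $\Sigma_0$ on $\Sigma_+$ has polynomial tails of order $n^{-(a+1)}$, in the same two-sided sense. -/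

import Mathlib

open Set Filter Topology MeasureTheory
open scoped Manifold ContDiff ENNReal

noncomputable section

namespace NeckFlow

/-- The Euclidean plane, model space of the surfaces. -/
abbrev E2 : Type := EuclideanSpace ℝ (Fin 2)

/-- The Euclidean space of triples of Clairaut coordinates `(s, θ, ψ)`. -/
abbrev E3 : Type := EuclideanSpace ℝ (Fin 3)

/-- The standard basis vectors of the plane. -/
def stdVec (i : Fin 2) : E2 := EuclideanSpace.single i 1

/-- A surface of class `C^4` is of class `C^1` (this gives the tangent bundle its topology). -/
instance isManifold_one_of_four (S : Type*) [TopologicalSpace S] [ChartedSpace E2 S]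
    [h : IsManifold (𝓡 2) 4 S] : IsManifold (𝓡 2) 1 S :=
  IsManifold.of_le (n := 4) (by norm_num)

/-! ### Riemannian surfaces: metric coefficients, curvature, geodesics -/

section Surface

variable {S : Type*} [TopologicalSpace S] [ChartedSpace E2 S] [IsManifold (𝓡 2) 4 S]

/-- Riemannian metrics of class `C^3` on a surface of class `C^4`. -/
abbrev Metric (S : Type*) [TopologicalSpace S] [ChartedSpace E2 S] [IsManifold (𝓡 2) 4 S] :=
  Bundle.ContMDiffRiemannianMetric (𝓡 2) 3 E2 (fun x : S => TangentSpace (𝓡 2) x)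

/-- The charts of the `C^4` structure of the surface. -/
def IsChart (e : OpenPartialHomeomorph S E2) : Prop :=
  e ∈ IsManifold.maximalAtlas (𝓡 2) 4 S

/-- The metric coefficient `g_ij` at the point `u` of the chart `e`. -/
def metricCoeff (g : Metric S) (e : OpenPartialHomeomorph S E2) (i j : Fin 2) (u : E2) : ℝ :=
  g.inner (e.symm u)
    (mfderiv (𝓡 2) (𝓡 2) e.symm u (stdVec i)) (mfderiv (𝓡 2) (𝓡 2) e.symm u (stdVec j))

/-- Partial derivative in the `i`-th coordinate. -/
def pd (i : Fin 2) (f : E2 → ℝ) (u : E2) : ℝ := fderiv ℝ f u (stdVec i)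

/-- The Gauss curvature at the point with coordinates `u` in the chart `e`, by Brioschi's formula
in terms of the first fundamental form `E = g_00`, `F = g_01`, `G = g_11`. -/
def gaussCurvature (g : Metric S) (e : OpenPartialHomeomorph S E2) (u : E2) : ℝ :=
  let E := metricCoeff g e 0 0
  let F := metricCoeff g e 0 1
  let G := metricCoeff g e 1 1
  (Matrix.det !![-(1 / 2) * pd 1 (pd 1 E) u + pd 0 (pd 1 F) u - (1 / 2) * pd 0 (pd 0 G) u,
        (1 / 2) * pd 0 E u, pd 0 F u - (1 / 2) * pd 1 E u;
      pd 1 F u - (1 / 2) * pd 0 G u, E u, F u;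
      (1 / 2) * pd 1 G u, F u, G u]
    - Matrix.det !![0, (1 / 2) * pd 1 E u, (1 / 2) * pd 0 G u;
      (1 / 2) * pd 1 E u, E u, F u;
      (1 / 2) * pd 0 G u, F u, G u]) / (E u * G u - F u ^ 2) ^ 2

/-- The curve `γ : ℝ → S` is a geodesic: it is differentiable and in every chart it satisfies the
geodesic equation, written as the Euler-Lagrange equation of the energy
`d/dt (∑ j, g_kj u_j') = (1/2) ∑ i j, ∂_k g_ij u_i' u_j'`. -/
def IsGeodesic (g : Metric S) (γ : ℝ → S) : Prop :=
  MDifferentiable 𝓘(ℝ, ℝ) (𝓡 2) γ ∧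
  ∀ e : OpenPartialHomeomorph S E2, IsChart e → ∀ t : ℝ, γ t ∈ e.source → ∀ k : Fin 2,
    HasDerivAt
      (fun τ : ℝ => ∑ j, metricCoeff g e k j (e (γ τ)) * deriv (fun σ : ℝ => e (γ σ)) τ j)
      ((1 / 2) * ∑ i, ∑ j, pd k (metricCoeff g e i j) (e (γ t)) *
        deriv (fun σ : ℝ => e (γ σ)) t i * deriv (fun σ : ℝ => e (γ σ)) t j) t

/-- The velocity vector `γ'(t)` as a point of the tangent bundle. -/
def velocity (γ : ℝ → S) (t : ℝ) : TangentBundle (𝓡 2) S :=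
  ⟨γ t, mfderiv 𝓘(ℝ, ℝ) (𝓡 2) γ t (1 : ℝ)⟩

/-- The unit tangent bundle `M = T¹S`. -/
abbrev UnitTangent (g : Metric S) : Type _ :=
  {v : TangentBundle (𝓡 2) S // g.inner v.proj v.snd v.snd = 1}

/-- `φ` is the geodesic flow on `T¹S`: `φ_t(x) = γ_x'(t)` for the geodesic `γ_x : ℝ → S` with
`γ_x'(0) = x`. -/
def IsGeodesicFlow (g : Metric S) (φ : Flow ℝ (UnitTangent g)) : Prop :=
  ∀ x : UnitTangent g, ∃ γ : ℝ → S, IsGeodesic g γ ∧ velocity γ 0 = x.1 ∧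
    ∀ t : ℝ, (φ t x).1 = velocity γ t

/-! ### The neck and the Clairaut coordinates -/

/-- The profile `ξ(s) = 1 + |s|^r`. -/
def profile (r s : ℝ) : ℝ := 1 + |s| ^ r

/-- `Φ(s, θ)`, `|s| < ε₁`, parametrizes a region of `(S, g)` that is isometric to the surface of
revolution `(s, ξ(s) cos θ, ξ(s) sin θ)`, `|s| < ε₁`: it is `2π`-periodic in `θ`, its restriction
to each strip of width `2π` is the inverse of a chart, and the metric is
`(1 + ξ'(s)²) ds² + ξ(s)² dθ²`. -/
structure IsNeck (g : Metric S) (r ε₁ : ℝ) (Φ : E2 → S) : Prop where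
  periodic : ∀ s θ : ℝ, |s| < ε₁ → Φ !₂[s, θ + 2 * Real.pi] = Φ !₂[s, θ]
  chart : ∀ θ₀ : ℝ, ∃ e : OpenPartialHomeomorph S E2, IsChart e ∧
    e.target = {p : E2 | |p 0| < ε₁ ∧ |p 1 - θ₀| < Real.pi} ∧ EqOn e.symm Φ e.target
  metric : ∀ p : E2, |p 0| < ε₁ → ∀ v w : E2,
    g.inner (Φ p) (mfderiv (𝓡 2) (𝓡 2) Φ p v) (mfderiv (𝓡 2) (𝓡 2) Φ p w) =
      (1 + deriv (profile r) (p 0) ^ 2) * (v 0 * w 0) + profile r (p 0) ^ 2 * (v 1 * w 1)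

/-- `(S, g)` is a surface with degenerate closed geodesic `θ ↦ Φ(0, θ)`: it has a neck with profile
`1 + |s|^r`, and its curvature is negative off the closed geodesic. -/
structure IsDegenerateSurface (g : Metric S) (r ε₁ : ℝ) (Φ : E2 → S) : Prop where
  neck : IsNeck g r ε₁ Φ
  curvature_neg : ∀ e : OpenPartialHomeomorph S E2, IsChart e → ∀ p ∈ e.source,
    (∀ θ : ℝ, p ≠ Φ !₂[0, θ]) → gaussCurvature g e (e p) < 0

/-- The tangent vector with Clairaut coordinates `p = (s, θ, ψ)`: the unit vector based at
`Φ(s, θ)` that makes the angle `ψ` with the circle `s = const`. -/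
def clairautVec (r : ℝ) (Φ : E2 → S) (p : E3) : TangentBundle (𝓡 2) S :=
  ⟨Φ !₂[p 0, p 1], mfderiv (𝓡 2) (𝓡 2) Φ !₂[p 0, p 1]
    (!₂[Real.sin (p 2) / √(1 + deriv (profile r) (p 0) ^ 2),
      Real.cos (p 2) / profile r (p 0)] : E2)⟩

/-- `p = (s, θ, ψ)` is a triple of Clairaut coordinates of `x ∈ T¹S` (the angles `θ`, `ψ` are
determined modulo `2π`). -/
def HasClairaut (g : Metric S) (r ε₁ : ℝ) (Φ : E2 → S) (x : UnitTangent g) (p : E3) : Prop :=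
  |p 0| < ε₁ ∧ x.1 = clairautVec r Φ p

/-- The Clairaut function `c(s, θ, ψ) = ξ(s) cos ψ`. -/
def clairaut (r : ℝ) (p : E3) : ℝ := profile r (p 0) * Real.cos (p 2)

/-- Lebesgue measure in Clairaut coordinates of a subset of a surface in `T¹S`: the
two-dimensional Hausdorff measure for the product metric on `(s, θ, ψ)`, the angles running over
one period. -/
def clairautLeb (g : Metric S) (r ε₁ : ℝ) (Φ : E2 → S) (A : Set (UnitTangent g)) : ℝ≥0∞ :=
  μH[2] {p : E3 | p 1 ∈ Ico 0 (2 * Real.pi) ∧ p 2 ∈ Ico 0 (2 * Real.pi) ∧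
    ∃ x ∈ A, HasClairaut g r ε₁ Φ x p}

/-! ### The transition section `Ω` -/

/-- `Ω₊`: vectors at `s = ±ε₀` that point into the neck, with Clairaut constant `χ`-close to
`±1`. -/
def OmegaPlus (g : Metric S) (r ε₁ : ℝ) (Φ : E2 → S) (ε₀ χ : ℝ) : Set (UnitTangent g) :=
  {x | ∃ p, HasClairaut g r ε₁ Φ x p ∧ |p 0| = ε₀ ∧ p 0 * Real.sin (p 2) < 0 ∧
    |(|clairaut r p| - 1)| < χ}

/-- `Ω₋`: vectors at `s = ±ε₀` that point out of the neck, with Clairaut constant `χ`-close to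
`±1`. -/
def OmegaMinus (g : Metric S) (r ε₁ : ℝ) (Φ : E2 → S) (ε₀ χ : ℝ) : Set (UnitTangent g) :=
  {x | ∃ p, HasClairaut g r ε₁ Φ x p ∧ |p 0| = ε₀ ∧ 0 < p 0 * Real.sin (p 2) ∧
    |(|clairaut r p| - 1)| < χ}

/-- The asymptotic vectors in `Ω₊`, those with `|c| = 1`. -/
def OmegaPlusAsymptotic (g : Metric S) (r ε₁ : ℝ) (Φ : E2 → S) (ε₀ χ : ℝ) :
    Set (UnitTangent g) :=
  {x | x ∈ OmegaPlus g r ε₁ Φ ε₀ χ ∧ ∃ p, HasClairaut g r ε₁ Φ x p ∧ |clairaut r p| = 1}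

/-- `g_{[-χ, χ]} A`. -/
def flowTube {g : Metric S} (φ : Flow ℝ (UnitTangent g)) (χ : ℝ) (A : Set (UnitTangent g)) :
    Set (UnitTangent g) :=
  {x | ∃ t ∈ Icc (-χ) χ, ∃ y ∈ A, x = φ t y}

/-! ### The Poincaré section, its return map and the transition time -/

/-- The Poincaré sections `Σ₀` under consideration: compact subsets of `T¹S` which
* are locally contained in a `C^1` surface transverse to the flow (finite disjoint unions of
  compact pieces of transverse surfaces are of this kind),
* meet each flow segment of time `[-χ, χ]` around a point of `Ω₊ ∪ Ω₋`, and
* for some compact neighbourhood `N₊` of the asymptotic vectors in `Ω₊`, are met by the orbits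
  that start in `N₊`, until these reach `Ω₋`, only within flow time `χ` of `Ω₊ ∪ Ω₋`. -/
structure IsNeckSection (g : Metric S) (r ε₁ : ℝ) (Φ : E2 → S) (φ : Flow ℝ (UnitTangent g))
    (ε₀ χ : ℝ) (Sec : Set (UnitTangent g)) : Prop where
  compact : IsCompact Sec
  transverse : ∀ x ∈ Sec, ∃ F : TangentBundle (𝓡 2) S → ℝ,
    ContMDiffAt (𝓡 2).tangent 𝓘(ℝ, ℝ) 1 F x.1 ∧
    (∀ᶠ y in 𝓝 x, y ∈ Sec → F y.1 = 0) ∧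
    deriv (fun t : ℝ => F (φ t x).1) 0 ≠ 0
  covers : ∀ x ∈ OmegaPlus g r ε₁ Φ ε₀ χ ∪ OmegaMinus g r ε₁ Φ ε₀ χ,
    ∃ t ∈ Icc (-χ) χ, φ t x ∈ Sec
  avoids : ∃ N : Set (UnitTangent g), IsCompact N ∧ N ⊆ OmegaPlus g r ε₁ Φ ε₀ χ ∧
    (∀ x ∈ OmegaPlusAsymptotic g r ε₁ Φ ε₀ χ, N ∈ 𝓝[OmegaPlus g r ε₁ Φ ε₀ χ] x) ∧
    ∀ x ∈ N, ∀ t : ℝ, 0 ≤ t → (∀ u ∈ Ioo 0 t, φ u x ∉ OmegaMinus g r ε₁ Φ ε₀ χ) →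
      φ t x ∈ Sec →
      φ t x ∈ flowTube φ χ (OmegaPlus g r ε₁ Φ ε₀ χ ∪ OmegaMinus g r ε₁ Φ ε₀ χ)

/-- The first positive time at which the orbit of `x` is in `A` (used only when there is one). -/
def hitTime {g : Metric S} (φ : Flow ℝ (UnitTangent g)) (A : Set (UnitTangent g))
    (x : UnitTangent g) : ℝ :=
  sInf {t : ℝ | 0 < t ∧ φ t x ∈ A}

/-- The first return map `f` of the flow to the section. -/
def returnMap {g : Metric S} (φ : Flow ℝ (UnitTangent g)) (Sec : Set (UnitTangent g))
    (x : UnitTangent g) : UnitTangent g :=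
  φ (hitTime φ Sec x) x

/-- `Σ₊`: the points of the section within flow time `χ` of `Ω₊`, with `||c| - 1| < 1 / n₀²`,
whose first return to the section exists and is within flow time `χ` of `Ω₋`. -/
def SigmaPlus (g : Metric S) (r ε₁ : ℝ) (Φ : E2 → S) (φ : Flow ℝ (UnitTangent g)) (ε₀ χ : ℝ)
    (Sec : Set (UnitTangent g)) (n₀ : ℕ) : Set (UnitTangent g) :=
  {x | x ∈ Sec ∧ x ∈ flowTube φ χ (OmegaPlus g r ε₁ Φ ε₀ χ) ∧
    (∃ p, HasClairaut g r ε₁ Φ x p ∧ |(|clairaut r p| - 1)| < 1 / (n₀ : ℝ) ^ 2) ∧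
    (∃ t : ℝ, 0 < t ∧ φ t x ∈ Sec) ∧
    returnMap φ Sec x ∈ flowTube φ χ (OmegaMinus g r ε₁ Φ ε₀ χ)}

/-- `Σ₋ = f(Σ₊)`. -/
def SigmaMinus (g : Metric S) (r ε₁ : ℝ) (Φ : E2 → S) (φ : Flow ℝ (UnitTangent g)) (ε₀ χ : ℝ)
    (Sec : Set (UnitTangent g)) (n₀ : ℕ) : Set (UnitTangent g) :=
  returnMap φ Sec '' SigmaPlus g r ε₁ Φ φ ε₀ χ Sec n₀

/-- The neck transition time `Υ`: the time taken to pass from `Σ₊` to `Σ₋`. -/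
def transitionTime (g : Metric S) (r ε₁ : ℝ) (Φ : E2 → S) (φ : Flow ℝ (UnitTangent g))
    (ε₀ χ : ℝ) (Sec : Set (UnitTangent g)) (n₀ : ℕ) (x : UnitTangent g) : ℝ :=
  hitTime φ (SigmaMinus g r ε₁ Φ φ ε₀ χ Sec n₀) x

end Surface

/-- `a(n) ≈ b(n)`: each is bounded by a constant multiple of the other for all large `n`. -/
def Comparable (a : ℕ → ℝ≥0∞) (b : ℕ → ℝ) : Prop :=
  ∃ C : ℝ, 0 < C ∧ ∀ᶠ n : ℕ in atTop,
    ENNReal.ofReal (C⁻¹ * b n) ≤ a n ∧ a n ≤ ENNReal.ofReal (C * b n)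

end NeckFlow

end

/-!
The proof reduces the statement to two independent facts about the neck, linked by the Clairaut
integral `c`. Write `δ = ||c| - 1|` and `v = sin ψ`.

**Crossing times.** Over the neck the geodesic flow lifts to Clairaut coordinates and becomes
`s' = v / √(1 + ξ'²)`, `v' = ξ' cos² ψ / (ξ √(1 + ξ'²))`, with `c = ξ cos ψ` constant
(`IsNeck.exists_lift`, `IsNeck.hasDerivAt_orbit`). An orbit that enters `|s| ≤ ε₀` with `δ ≠ 0`
leaves it after a time of order at most `δ^(-(1/2 - 1/r))`:

* If `|c| < 1`, then `v² ≳ δ + |s|^r`, so the orbit passes the waist and `s` moves with speed at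
  least `κ (δ^(1/r) + |s|)^(r/2)`.
* If `|c| > 1`, then `|s|^r ≳ δ + v²`, so the orbit bounces back and it is `v` that moves
  monotonically, with speed at least `κ (δ^(1/2) + |v|)^(2 - 2/r)`.

In both cases `x' ≥ κ (a + |x|)^p` with `p > 1`, which bounds the elapsed time by a multiple of
`a^(1 - p)` (`time_le_of_growth`), and `a^(1 - p)` is `δ^(-(1/2 - 1/r))`. For `|c| < 1` this is also
a lower bound, because `v² ≲ δ` where `|s| ≤ δ^(1/r)` (`le_transit_of_lt_one`). The return time to
the section differs from the crossing time by at most `2χ`, since the orbit meets the section within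
time `χ` of entrance and exit and, near the asymptotic vectors, nowhere in between
(`IsNeck.hitTime_le_of_mem`, `IsNeck.exists_last_hit`). As
`(1/2 - 1/r) * (2r/(r-2)) = 1`, return times larger than `n` correspond to `δ ≲ n^(-2r/(r-2))`.

**Measure of the section.** It remains to see that the part of the section with `||c| - 1| ≤ δ` has
measure of order `δ`.

* Upper bound: off the waist `dc ≠ 0`, and `dc` vanishes on the flow direction, to which the section
  is transverse. So `c` is one of two local coordinates of the surface that contains the section
  (`exists_local_measure_le`), and compactness gives `IsNeck.exists_section_measure_le`.
* Lower bound: every incoming vector at `s = ε₀` reaches the section within time `χ`. On such vectors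
  the pair of `c` and the cosine of the angle of entrance is constant along orbits
  (`IsNeck.entranceAngle_const`) and a Lipschitz function of the Clairaut coordinates. The part of
  the section in question is mapped by it onto a set that contains the rectangle
  `(1 - δ, 1) × [-1, 1]`, hence has measure at least of order `δ` (`exists_le_measure`). This
  argument needs no regularity or measurability of the section.
-/

set_option linter.unusedSectionVars false

noncomputable section

namespace NeckFlow

/-! ### The profile and the speed of its meridian -/

theorem one_le_profile (r s : ℝ) : 1 ≤ profile r s := by
  have := Real.rpow_nonneg (abs_nonneg s) r
  unfold profile; linarith

theorem profile_pos (r s : ℝ) : 0 < profile r s := lt_of_lt_of_le one_pos (one_le_profile r s)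

theorem hasDerivAt_profile {r : ℝ} (hr : 4 ≤ r) (s : ℝ) :
    HasDerivAt (profile r) (r * |s| ^ (r - 2) * s) s := by
  unfold profile
  exact (hasDerivAt_abs_rpow s (by linarith)).const_add 1

theorem deriv_profile {r : ℝ} (hr : 4 ≤ r) :
    deriv (profile r) = fun s => r * |s| ^ (r - 2) * s :=
  funext fun s => (hasDerivAt_profile hr s).deriv

theorem hasDerivAt_deriv_profile {r : ℝ} (hr : 4 ≤ r) (s : ℝ) :
    HasDerivAt (deriv (profile r)) (r * (r - 1) * |s| ^ (r - 2)) s := by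
  rw [deriv_profile hr]
  refine (((hasDerivAt_abs_rpow s (p := r - 2) (by linarith)).const_mul r).fun_mul
    (hasDerivAt_id' s)).congr_deriv ?_
  rcases eq_or_ne s 0 with rfl | hs
  · simp [Real.zero_rpow (show r - 2 ≠ 0 by linarith)]
  · have : |s| ^ (r - 2) = |s| ^ (r - 2 - 2) * s ^ 2 := by
      rw [← sq_abs, ← Real.rpow_natCast, ← Real.rpow_add (abs_pos.mpr hs)]; norm_num
    rw [this]; ring

theorem contDiff_deriv_profile {r : ℝ} (hr : 4 ≤ r) : ContDiff ℝ 1 (deriv (profile r)) := by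
  rw [contDiff_one_iff_deriv]
  refine ⟨fun s => (hasDerivAt_deriv_profile hr s).differentiableAt, ?_⟩
  rw [funext fun s => (hasDerivAt_deriv_profile hr s).deriv]
  exact continuous_const.mul (continuous_abs.rpow_const fun _ => Or.inr (by linarith))

theorem contDiff_profile {r : ℝ} (hr : 4 ≤ r) : ContDiff ℝ 1 (profile r) := by
  rw [contDiff_one_iff_deriv]
  exact ⟨fun s => (hasDerivAt_profile hr s).differentiableAt, (contDiff_deriv_profile hr).continuous⟩

/-- The speed `√(1 + ξ'(s)²)` of the meridian `s ↦ (s, ξ(s))`. -/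
def meridianSpeed (r s : ℝ) : ℝ := √(1 + deriv (profile r) s ^ 2)

theorem one_le_meridianSpeed (r s : ℝ) : 1 ≤ meridianSpeed r s := by
  unfold meridianSpeed
  rw [Real.one_le_sqrt]; nlinarith [sq_nonneg (deriv (profile r) s)]

theorem meridianSpeed_pos (r s : ℝ) : 0 < meridianSpeed r s :=
  lt_of_lt_of_le one_pos (one_le_meridianSpeed r s)

theorem meridianSpeed_sq (r s : ℝ) : meridianSpeed r s ^ 2 = 1 + deriv (profile r) s ^ 2 :=
  Real.sq_sqrt (by positivity)

theorem contDiff_meridianSpeed {r : ℝ} (hr : 4 ≤ r) : ContDiff ℝ 1 (meridianSpeed r) := by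
  unfold meridianSpeed
  refine ContDiff.sqrt (contDiff_const.add ((contDiff_deriv_profile hr).pow 2)) fun s => ?_
  positivity

theorem hasDerivAt_meridianSpeed {r : ℝ} (hr : 4 ≤ r) (s : ℝ) :
    HasDerivAt (meridianSpeed r)
      (deriv (profile r) s * (r * (r - 1) * |s| ^ (r - 2)) / meridianSpeed r s) s := by
  have h0 : (1 : ℝ) + deriv (profile r) s ^ 2 ≠ 0 := by positivity
  refine ((((hasDerivAt_deriv_profile hr s).fun_pow 2).const_add 1).sqrt h0).congr_deriv ?_
  unfold meridianSpeed
  have : √(1 + deriv (profile r) s ^ 2) ≠ 0 := by positivity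
  field_simp
  norm_num
  ring

/-! ### Charts of the neck and velocities of curves -/

section Surface

variable {S : Type*} [TopologicalSpace S] [ChartedSpace E2 S] [IsManifold (𝓡 2) 4 S]

theorem isChart_one {e : OpenPartialHomeomorph S E2} (he : IsChart e) :
    e ∈ IsManifold.maximalAtlas (𝓡 2) 1 S :=
  IsManifold.maximalAtlas_subset_of_le (by norm_num) he

/-- The strip `|s| < ε₁` of the coordinate plane. -/
def strip (ε₁ : ℝ) : Set E2 := {u | |u 0| < ε₁}

theorem isOpen_strip (ε₁ : ℝ) : IsOpen (strip ε₁) :=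
  isOpen_lt (by fun_prop) continuous_const

theorem IsNeck.exists_chart {g : Metric S} {r ε₁ : ℝ} {Φ : E2 → S} (hN : IsNeck g r ε₁ Φ) {u : E2}
    (hu : |u 0| < ε₁) : ∃ e : OpenPartialHomeomorph S E2, IsChart e ∧ u ∈ e.target ∧
      (∀ v ∈ e.target, |v 0| < ε₁) ∧ EqOn e.symm Φ e.target := by
  obtain ⟨e, he, ht, heq⟩ := hN.chart (u 1)
  refine ⟨e, he, ?_, ?_, heq⟩
  · rw [ht]; simp [hu, Real.pi_pos]
  · rw [ht]; exact fun v hv => hv.1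

theorem IsNeck.contMDiffAt {g : Metric S} {r ε₁ : ℝ} {Φ : E2 → S} (hN : IsNeck g r ε₁ Φ) {u : E2}
    (hu : |u 0| < ε₁) : ContMDiffAt (𝓡 2) (𝓡 2) 4 Φ u := by
  obtain ⟨e, he, hut, -, heq⟩ := hN.exists_chart hu
  refine (contMDiffAt_symm_of_mem_maximalAtlas he hut).congr_of_eventuallyEq ?_
  filter_upwards [e.open_target.mem_nhds hut] with v hv using (heq hv).symm

theorem IsNeck.mdifferentiableAt {g : Metric S} {r ε₁ : ℝ} {Φ : E2 → S} (hN : IsNeck g r ε₁ Φ)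
    {u : E2} (hu : |u 0| < ε₁) : MDifferentiableAt (𝓡 2) (𝓡 2) Φ u :=
  (hN.contMDiffAt hu).mdifferentiableAt (by norm_num)

theorem mk_eq_mk {p q : S} (h : p = q) {v w : E2} (hvw : v = w) :
    (⟨p, v⟩ : TangentBundle (𝓡 2) S) = ⟨q, w⟩ := by
  subst h hvw; rfl

/-- `mfderiv` as a map of the model space, so that derivatives at points whose images are only
propositionally equal can be compared. -/
def flatDeriv (f : E2 → S) (u : E2) : E2 →L[ℝ] E2 := mfderiv (𝓡 2) (𝓡 2) f u

theorem flatDeriv_congr {f h : E2 → S} {u : E2} (hfh : f =ᶠ[𝓝 u] h) :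
    flatDeriv f u = flatDeriv h u := hfh.mfderiv_eq

theorem metric_congr (g : Metric S) {p q : S} (h : p = q) (v w : E2) :
    (g.inner p : E2 →L[ℝ] E2 →L[ℝ] ℝ) v w = (g.inner q : E2 →L[ℝ] E2 →L[ℝ] ℝ) v w := by
  rw [h]

theorem IsNeck.metricCoeff_eq {g : Metric S} {r ε₁ : ℝ} {Φ : E2 → S} (hN : IsNeck g r ε₁ Φ)
    {e : OpenPartialHomeomorph S E2} (hlt : ∀ v ∈ e.target, |v 0| < ε₁)
    (heq : EqOn e.symm Φ e.target) {u : E2} (hu : u ∈ e.target) (i j : Fin 2) :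
    metricCoeff g e i j u = (1 + deriv (profile r) (u 0) ^ 2) * (stdVec i 0 * stdVec j 0) +
      profile r (u 0) ^ 2 * (stdVec i 1 * stdVec j 1) := by
  rw [← hN.metric u (hlt u hu)]
  have h1 : flatDeriv e.symm u = flatDeriv Φ u := flatDeriv_congr <| by
    filter_upwards [e.open_target.mem_nhds hu] with v hv using heq hv
  change (g.inner (e.symm u) : E2 →L[ℝ] E2 →L[ℝ] ℝ) (flatDeriv e.symm u (stdVec i))
    (flatDeriv e.symm u (stdVec j)) = (g.inner (Φ u) : E2 →L[ℝ] E2 →L[ℝ] ℝ)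
      (flatDeriv Φ u (stdVec i)) (flatDeriv Φ u (stdVec j))
  rw [h1]
  exact metric_congr g (heq hu) _ _

theorem velocity_congr {γ δ : ℝ → S} {t : ℝ} (h : γ =ᶠ[𝓝 t] δ) : velocity γ t = velocity δ t := by
  refine mk_eq_mk h.eq_of_nhds ?_
  have : (mfderiv 𝓘(ℝ, ℝ) (𝓡 2) γ t : ℝ →L[ℝ] E2) = mfderiv 𝓘(ℝ, ℝ) (𝓡 2) δ t := h.mfderiv_eq
  exact congrArg (fun L : ℝ →L[ℝ] E2 => L 1) this

theorem velocity_comp {f : E2 → S} {u : ℝ → E2} {u' : E2} {t : ℝ}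
    (hf : MDifferentiableAt (𝓡 2) (𝓡 2) f (u t)) (hu : HasDerivAt u u' t) :
    velocity (fun τ => f (u τ)) t = ⟨f (u t), flatDeriv f (u t) u'⟩ := by
  refine mk_eq_mk rfl ?_
  have hu2 : MDifferentiableAt 𝓘(ℝ, ℝ) (𝓡 2) u t := hu.differentiableAt.mdifferentiableAt
  have := mfderiv_comp t hf hu2
  have h3 : mfderiv 𝓘(ℝ, ℝ) (𝓡 2) (fun τ => f (u τ)) t (1 : ℝ) =
      flatDeriv f (u t) (mfderiv 𝓘(ℝ, ℝ) (𝓡 2) u t (1 : ℝ)) := by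
    change mfderiv 𝓘(ℝ, ℝ) (𝓡 2) (f ∘ u) t (1 : ℝ) = _
    rw [this]; rfl
  refine h3.trans ?_
  congr 1
  have h4 : mfderiv 𝓘(ℝ, ℝ) (𝓡 2) u t = fderiv ℝ u t := mfderiv_eq_fderiv
  rw [h4, hu.hasFDerivAt.fderiv]
  exact one_smul ℝ u'

/-- In a chart around its point, a geodesic has differentiable coordinates. -/
theorem IsGeodesic.differentiableAt_coord {g : Metric S} {γ : ℝ → S} (hγ : IsGeodesic g γ)
    {e : OpenPartialHomeomorph S E2} (he : IsChart e) {t : ℝ} (ht : γ t ∈ e.source) :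
    DifferentiableAt ℝ (fun τ => e (γ τ)) t := by
  rw [← mdifferentiableAt_iff_differentiableAt]
  exact (mdifferentiableAt_of_mem_maximalAtlas (isChart_one he) ht).comp t (hγ.1 t)

theorem IsGeodesic.continuous {g : Metric S} {γ : ℝ → S} (hγ : IsGeodesic g γ) : Continuous γ :=
  hγ.1.continuous

/-! ### The geodesic equation over the neck -/

theorem stdVec_apply (i j : Fin 2) : stdVec i j = if j = i then 1 else 0 := by
  simp [stdVec]

theorem hasFDerivAt_coord (i : Fin 2) (u : E2) :
    HasFDerivAt (fun v : E2 => v i) (EuclideanSpace.proj i : E2 →L[ℝ] ℝ) u :=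
  (EuclideanSpace.proj i : E2 →L[ℝ] ℝ).hasFDerivAt

/-- Partial derivatives of a function of the first coordinate. -/
theorem pd_of_fst {f : E2 → ℝ} {A : ℝ → ℝ} {A' : ℝ} {u : E2}
    (hf : f =ᶠ[𝓝 u] fun v => A (v 0)) (hA : HasDerivAt A A' (u 0)) (k : Fin 2) :
    pd k f u = A' * stdVec k 0 := by
  unfold pd
  rw [hf.fderiv_eq]
  have : HasFDerivAt (fun v : E2 => A (v 0)) (A' • (EuclideanSpace.proj 0 : E2 →L[ℝ] ℝ)) u :=
    hA.comp_hasFDerivAt u (hasFDerivAt_coord 0 u)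
  rw [this.fderiv]
  simp

theorem hasDerivAt_coord {u : ℝ → E2} {u' : E2} {t : ℝ} (hu : HasDerivAt u u' t) (i : Fin 2) :
    HasDerivAt (fun τ => u τ i) (u' i) t :=
  ((hasFDerivAt_coord i (u t)).comp_hasDerivAt t hu)

/-- The geodesic equation over the neck, as the evolution of the momenta `(1 + ξ'²) s'` and
`ξ² θ'`. The second is Clairaut's integral; it is conserved because the metric coefficients depend
on `s` only. -/
theorem IsNeck.hasDerivAt_momenta {g : Metric S} {r ε₁ : ℝ} {Φ : E2 → S} (hr : 4 ≤ r)
    (hN : IsNeck g r ε₁ Φ) {γ : ℝ → S} (hγ : IsGeodesic g γ)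
    {e : OpenPartialHomeomorph S E2} (he : IsChart e) (hlt : ∀ v ∈ e.target, |v 0| < ε₁)
    (heq : EqOn e.symm Φ e.target) {t : ℝ} (ht : γ t ∈ e.source) :
    HasDerivAt (fun τ => (1 + deriv (profile r) (e (γ τ) 0) ^ 2) * deriv (fun σ => e (γ σ)) τ 0)
      (deriv (profile r) (e (γ t) 0) * (r * (r - 1) * |e (γ t) 0| ^ (r - 2)) *
          deriv (fun σ => e (γ σ)) t 0 ^ 2 +
        profile r (e (γ t) 0) * deriv (profile r) (e (γ t) 0) *
          deriv (fun σ => e (γ σ)) t 1 ^ 2) t ∧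
    HasDerivAt (fun τ => profile r (e (γ τ) 0) ^ 2 * deriv (fun σ => e (γ σ)) τ 1) 0 t := by
  have hev : ∀ᶠ τ in 𝓝 t, γ τ ∈ e.source :=
    hγ.continuous.continuousAt.eventually (e.open_source.mem_nhds ht)
  have hut : e (γ t) ∈ e.target := e.map_source ht
  have hpd : ∀ k i j : Fin 2, pd k (metricCoeff g e i j) (e (γ t)) =
      (2 * deriv (profile r) (e (γ t) 0) * (r * (r - 1) * |e (γ t) 0| ^ (r - 2)) *
          (stdVec i 0 * stdVec j 0) +
        2 * profile r (e (γ t) 0) * deriv (profile r) (e (γ t) 0) *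
          (stdVec i 1 * stdVec j 1)) * stdVec k 0 := by
    intro k i j
    refine pd_of_fst (A := fun s => (1 + deriv (profile r) s ^ 2) * (stdVec i 0 * stdVec j 0) +
      profile r s ^ 2 * (stdVec i 1 * stdVec j 1)) ?_ ?_ k
    · filter_upwards [e.open_target.mem_nhds hut] with v hv
      exact hN.metricCoeff_eq hlt heq hv i j
    · have h1 := ((hasDerivAt_deriv_profile hr (e (γ t) 0)).fun_pow 2).const_add 1
      have h2 := (hasDerivAt_profile hr (e (γ t) 0)).fun_pow 2
      refine ((h1.mul_const _).add (h2.mul_const _)).congr_deriv ?_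
      rw [deriv_profile hr]
      norm_num
  have hEL := hγ.2 e he t ht
  constructor
  · refine ((hEL 0).congr_of_eventuallyEq ?_).congr_deriv ?_
    · filter_upwards [hev] with τ hτ
      simp only [Fin.sum_univ_two, hN.metricCoeff_eq hlt heq (e.map_source hτ), stdVec_apply]
      simp
    · simp only [Fin.sum_univ_two, hpd, stdVec_apply]
      simp
      ring
  · refine ((hEL 1).congr_of_eventuallyEq ?_).congr_deriv ?_
    · filter_upwards [hev] with τ hτ
      simp only [Fin.sum_univ_two, hN.metricCoeff_eq hlt heq (e.map_source hτ), stdVec_apply]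
      simp
    · simp only [Fin.sum_univ_two, hpd, stdVec_apply]
      simp

theorem IsNeck.inner_flatDeriv {g : Metric S} {r ε₁ : ℝ} {Φ : E2 → S} (hN : IsNeck g r ε₁ Φ)
    {u : E2} (hu : |u 0| < ε₁) (v : E2) :
    (g.inner (Φ u) : E2 →L[ℝ] E2 →L[ℝ] ℝ) (flatDeriv Φ u v) (flatDeriv Φ u v) =
      (meridianSpeed r (u 0) * v 0) ^ 2 + (profile r (u 0) * v 1) ^ 2 := by
  rw [mul_pow, meridianSpeed_sq]
  refine (hN.metric u hu v v).trans ?_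
  ring

theorem IsNeck.flatDeriv_injective {g : Metric S} {r ε₁ : ℝ} {Φ : E2 → S} (hN : IsNeck g r ε₁ Φ)
    {u : E2} (hu : |u 0| < ε₁) : Function.Injective (flatDeriv Φ u) := by
  rw [injective_iff_map_eq_zero]
  intro v hv
  have h := hN.inner_flatDeriv hu v
  rw [hv] at h
  have h' : 0 = (meridianSpeed r (u 0) * v 0) ^ 2 + (profile r (u 0) * v 1) ^ 2 :=
    ((g.inner (Φ u) : E2 →L[ℝ] E2 →L[ℝ] ℝ) 0).map_zero.symm.trans h
  have h0 := meridianSpeed_pos r (u 0)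
  have h1 := profile_pos r (u 0)
  obtain ⟨h2, h3⟩ := (add_eq_zero_iff_of_nonneg (sq_nonneg _) (sq_nonneg _)).1 h'.symm
  rw [sq_eq_zero_iff] at h2 h3
  ext i
  fin_cases i
  · simpa [h0.ne'] using h2
  · simpa [h1.ne'] using h3

theorem IsNeck.flatDeriv_surjective {g : Metric S} {r ε₁ : ℝ} {Φ : E2 → S} (hN : IsNeck g r ε₁ Φ)
    {u : E2} (hu : |u 0| < ε₁) : Function.Surjective (flatDeriv Φ u) :=
  (LinearMap.injective_iff_surjective (f := (flatDeriv Φ u : E2 →ₗ[ℝ] E2))).1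
    (hN.flatDeriv_injective hu)

theorem clairautVec_eq (r : ℝ) (Φ : E2 → S) (p : E3) : clairautVec r Φ p =
    ⟨Φ !₂[p 0, p 1], flatDeriv Φ !₂[p 0, p 1]
      !₂[Real.sin (p 2) / meridianSpeed r (p 0), Real.cos (p 2) / profile r (p 0)]⟩ := rfl

theorem IsNeck.inner_clairautVec {g : Metric S} {r ε₁ : ℝ} {Φ : E2 → S} (hN : IsNeck g r ε₁ Φ)
    {p : E3} (hp : |p 0| < ε₁) :
    g.inner (clairautVec r Φ p).proj (clairautVec r Φ p).snd (clairautVec r Φ p).snd = 1 := by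
  have h := hN.inner_flatDeriv (u := !₂[p 0, p 1]) (by simpa using hp)
    !₂[Real.sin (p 2) / meridianSpeed r (p 0), Real.cos (p 2) / profile r (p 0)]
  refine h.trans ?_
  have h0 := (meridianSpeed_pos r (p 0)).ne'
  have h1 := (profile_pos r (p 0)).ne'
  simp only [Matrix.cons_val_zero, Matrix.cons_val_one]
  rw [mul_div_cancel₀ _ h0, mul_div_cancel₀ _ h1, Real.sin_sq_add_cos_sq]

/-! ### Lifts of orbits to Clairaut coordinates -/

/-- The momentum equations, rewritten for the components `v = sin ψ` and `w = cos ψ` of a unit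
velocity in the orthonormal frame of meridians and parallels. -/
theorem hasDerivAt_frame {r : ℝ} (hr : 4 ≤ r) {s D₀ D₁ : ℝ → ℝ} {t : ℝ}
    (hs : HasDerivAt s (D₀ t) t)
    (hA : HasDerivAt (fun τ => (1 + deriv (profile r) (s τ) ^ 2) * D₀ τ)
      (deriv (profile r) (s t) * (r * (r - 1) * |s t| ^ (r - 2)) * D₀ t ^ 2 +
        profile r (s t) * deriv (profile r) (s t) * D₁ t ^ 2) t)
    (hB : HasDerivAt (fun τ => profile r (s τ) ^ 2 * D₁ τ) 0 t) :
    HasDerivAt (fun τ => meridianSpeed r (s τ) * D₀ τ)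
      (deriv (profile r) (s t) * (profile r (s t) * D₁ t) / (profile r (s t) * meridianSpeed r (s t))
        * (profile r (s t) * D₁ t)) t ∧
    HasDerivAt (fun τ => profile r (s τ) * D₁ τ)
      (-(deriv (profile r) (s t) * (profile r (s t) * D₁ t) /
        (profile r (s t) * meridianSpeed r (s t)) * (meridianSpeed r (s t) * D₀ t))) t := by
  have hρ : ∀ x, meridianSpeed r x ≠ 0 := fun x => (meridianSpeed_pos r x).ne'
  have hξ : ∀ x, profile r x ≠ 0 := fun x => (profile_pos r x).ne'
  have hρ' := (hasDerivAt_meridianSpeed hr (s t)).comp t hs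
  have hξ' := ((hasDerivAt_profile hr (s t)).comp t hs)
  rw [← congrFun (deriv_profile hr) (s t)] at hξ'
  constructor
  · have h := hA.fun_div hρ' (hρ _)
    refine (h.congr_of_eventuallyEq (Eventually.of_forall fun τ => ?_)).congr_deriv ?_
    · simp only [Function.comp_apply]
      rw [← meridianSpeed_sq]
      field_simp [hρ (s τ)]
    · simp only [Function.comp_apply]
      rw [← meridianSpeed_sq]
      field_simp [hρ (s t), hξ (s t)]
      ring
  · have h := hB.fun_div hξ' (hξ _)
    refine (h.congr_of_eventuallyEq (Eventually.of_forall fun τ => ?_)).congr_deriv ?_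
    · simp only [Function.comp_apply]
      field_simp [hξ (s τ)]
    · simp only [Function.comp_apply]
      field_simp [hρ (s t), hξ (s t)]
      ring

/-- The angular coordinate of a differentiable curve on the unit circle that starts at
`(cos ψ₀, sin ψ₀)` and moves with angular velocity `K`. -/
theorem exists_angle {v w K : ℝ → ℝ} {ψ₀ : ℝ} (hv0 : v 0 = Real.sin ψ₀) (hw0 : w 0 = Real.cos ψ₀)
    (hunit : ∀ᶠ t in 𝓝 0, v t ^ 2 + w t ^ 2 = 1)
    (hv : ∀ᶠ t in 𝓝 0, HasDerivAt v (K t * w t) t)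
    (hw : ∀ᶠ t in 𝓝 0, HasDerivAt w (-(K t * v t)) t) :
    ∃ ψ : ℝ → ℝ, ψ 0 = ψ₀ ∧ ∀ᶠ t in 𝓝 0, Real.sin (ψ t) = v t ∧ Real.cos (ψ t) = w t ∧
      HasDerivAt ψ (K t) t := by
  have hcs := Real.sin_sq_add_cos_sq ψ₀
  -- `Y = sin (ψ - ψ₀)` is small and `X = cos (ψ - ψ₀)` positive, so `ψ - ψ₀ = arcsin Y`
  refine ⟨fun t => ψ₀ + Real.arcsin (v t * Real.cos ψ₀ - w t * Real.sin ψ₀), ?_, ?_⟩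
  · simp only [hv0, hw0]
    rw [show Real.sin ψ₀ * Real.cos ψ₀ - Real.cos ψ₀ * Real.sin ψ₀ = 0 by ring]
    simp
  · have hX : ∀ᶠ t in 𝓝 0, 0 < w t * Real.cos ψ₀ + v t * Real.sin ψ₀ := by
      have hc : ContinuousAt (fun t => w t * Real.cos ψ₀ + v t * Real.sin ψ₀) 0 :=
        (hw.self_of_nhds.continuousAt.mul_const _).add (hv.self_of_nhds.continuousAt.mul_const _)
      refine hc.eventually (lt_mem_nhds ?_)
      simp only [hv0, hw0]; nlinarith
    filter_upwards [hX, hunit, hv, hw] with t hXt hut hvt hwt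
    set X := w t * Real.cos ψ₀ + v t * Real.sin ψ₀ with hXdef
    set Y := v t * Real.cos ψ₀ - w t * Real.sin ψ₀ with hYdef
    have hXY : X ^ 2 + Y ^ 2 = 1 := by
      rw [hXdef, hYdef]; linear_combination (Real.cos ψ₀ ^ 2 + Real.sin ψ₀ ^ 2) * hut + hcs
    have hY1 : -1 < Y := by nlinarith
    have hY2 : Y < 1 := by nlinarith
    have hsqrt : √(1 - Y ^ 2) = X := by
      rw [show 1 - Y ^ 2 = X ^ 2 by linarith, Real.sqrt_sq hXt.le]
    refine ⟨?_, ?_, ?_⟩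
    · rw [Real.sin_add, Real.sin_arcsin hY1.le hY2.le, Real.cos_arcsin, hsqrt, hXdef, hYdef]
      linear_combination v t * hcs
    · rw [Real.cos_add, Real.sin_arcsin hY1.le hY2.le, Real.cos_arcsin, hsqrt, hXdef, hYdef]
      linear_combination w t * hcs
    · have hYd : HasDerivAt (fun t => v t * Real.cos ψ₀ - w t * Real.sin ψ₀) (K t * X) t :=
        ((hvt.mul_const _).sub (hwt.mul_const _)).congr_deriv (by rw [hXdef]; ring)
      have := ((Real.hasDerivAt_arcsin hY1.ne' hY2.ne).comp t hYd).const_add ψ₀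
      refine this.congr_deriv ?_
      rw [hsqrt]
      field_simp

/-- Local lifts of orbits: over the neck, an orbit of the geodesic flow is, near time `0`, a curve
of Clairaut coordinates solving
`s' = sin ψ / √(1 + ξ'²)`, `θ' = cos ψ / ξ`, `ψ' = ξ' cos ψ / (ξ √(1 + ξ'²))`. -/
theorem IsNeck.exists_lift {g : Metric S} {r ε₁ : ℝ} {Φ : E2 → S} (hr : 4 ≤ r)
    (hN : IsNeck g r ε₁ Φ) {φ : Flow ℝ (UnitTangent g)} (hφ : IsGeodesicFlow g φ)
    {x : UnitTangent g} {p : E3} (hx : HasClairaut g r ε₁ Φ x p) :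
    ∃ P : ℝ → E3, P 0 = p ∧ ∀ᶠ t in 𝓝 0, HasClairaut g r ε₁ Φ (φ t x) (P t) ∧
      HasDerivAt (fun τ => P τ 0) (Real.sin (P t 2) / meridianSpeed r (P t 0)) t ∧
      HasDerivAt (fun τ => P τ 1) (Real.cos (P t 2) / profile r (P t 0)) t ∧
      HasDerivAt (fun τ => P τ 2) (deriv (profile r) (P t 0) * Real.cos (P t 2) /
        (profile r (P t 0) * meridianSpeed r (P t 0))) t := by
  obtain ⟨γ, hγ, hγ0, hγφ⟩ := hφ x
  obtain ⟨hp, hxp⟩ := hx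
  have hu0 : |(!₂[p 0, p 1] : E2) 0| < ε₁ := by simpa using hp
  obtain ⟨e, he, hut, hlt, heq⟩ := hN.exists_chart hu0
  have hbase : γ 0 = e.symm !₂[p 0, p 1] := by
    have : (velocity γ 0).proj = (clairautVec r Φ p).proj := by rw [hγ0, hxp]
    rw [heq hut]; exact this
  have h0s : γ 0 ∈ e.source := by rw [hbase]; exact e.map_target hut
  have hev : ∀ᶠ τ in 𝓝 0, γ τ ∈ e.source :=
    hγ.continuous.continuousAt.eventually (e.open_source.mem_nhds h0s)
  set u : ℝ → E2 := fun τ => e (γ τ) with hu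
  have hu00 : u 0 = !₂[p 0, p 1] := by rw [hu]; simp only [hbase]; exact e.right_inv hut
  have hd : ∀ t, γ t ∈ e.source → HasDerivAt u (deriv u t) t := fun t ht =>
    (hγ.differentiableAt_coord he ht).hasDerivAt
  have hvel : ∀ t, γ t ∈ e.source → velocity γ t = ⟨Φ (u t), flatDeriv Φ (u t) (deriv u t)⟩ := by
    intro t ht
    rw [← velocity_comp (hN.mdifferentiableAt (hlt _ (e.map_source ht))) (hd t ht)]
    refine velocity_congr ?_
    filter_upwards [hγ.continuous.continuousAt.eventually (e.open_source.mem_nhds ht)] with τ hτ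
    rw [hu, ← heq (e.map_source hτ), e.left_inv hτ]
  have hunit : ∀ t, γ t ∈ e.source →
      (meridianSpeed r (u t 0) * deriv u t 0) ^ 2 + (profile r (u t 0) * deriv u t 1) ^ 2 = 1 := by
    intro t ht
    rw [← hN.inner_flatDeriv (hlt _ (e.map_source ht))]
    have h1 := (φ t x).2
    rw [hγφ t, hvel t ht] at h1
    exact h1
  have hD0 : deriv u 0 = !₂[Real.sin (p 2) / meridianSpeed r (p 0),
      Real.cos (p 2) / profile r (p 0)] := by
    apply hN.flatDeriv_injective hu0
    have h1 := hvel 0 h0s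
    rw [hγ0, hxp, clairautVec_eq, hu00] at h1
    exact (eq_of_heq (Bundle.TotalSpace.mk.inj h1).2).symm
  have hfr : ∀ t, γ t ∈ e.source → _ := fun t ht =>
    hasDerivAt_frame hr (s := fun τ => u τ 0) (D₀ := fun τ => deriv u τ 0)
      (D₁ := fun τ => deriv u τ 1) (hasDerivAt_coord (hd t ht) 0)
      (hN.hasDerivAt_momenta hr hγ he hlt heq ht).1 (hN.hasDerivAt_momenta hr hγ he hlt heq ht).2
  have h00 : u 0 0 = p 0 := by simp [hu00]
  obtain ⟨ψ, hψ0, hψ⟩ := exists_angle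
    (v := fun τ => meridianSpeed r (u τ 0) * deriv u τ 0)
    (w := fun τ => profile r (u τ 0) * deriv u τ 1)
    (K := fun t => deriv (profile r) (u t 0) * (profile r (u t 0) * deriv u t 1) /
        (profile r (u t 0) * meridianSpeed r (u t 0))) (ψ₀ := p 2)
    (by simp only [h00, hD0]; simp [mul_div_cancel₀ _ (meridianSpeed_pos r (p 0)).ne'])
    (by simp only [h00, hD0]; simp [mul_div_cancel₀ _ (profile_pos r (p 0)).ne'])
    (hev.mono hunit) (hev.mono fun t ht => (hfr t ht).1) (hev.mono fun t ht => (hfr t ht).2)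
  refine ⟨fun t => !₂[u t 0, u t 1, ψ t], ?_, ?_⟩
  · ext i; fin_cases i <;> simp [hu00, hψ0]
  · filter_upwards [hev, hψ] with t ht hψt
    obtain ⟨hsin, hcos, hψd⟩ := hψt
    have hρ := (meridianSpeed_pos r (u t 0)).ne'
    have hξ := (profile_pos r (u t 0)).ne'
    have e0 : Real.sin (ψ t) / meridianSpeed r (u t 0) = deriv u t 0 := by
      rw [hsin]; field_simp
    have e1 : Real.cos (ψ t) / profile r (u t 0) = deriv u t 1 := by
      rw [hcos]; field_simp
    refine ⟨⟨hlt _ (e.map_source ht), ?_⟩, ?_, ?_, ?_⟩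
    · rw [hγφ t, hvel t ht, clairautVec_eq]
      have hut' : u t = !₂[u t 0, u t 1] := by ext i; fin_cases i <;> rfl
      refine mk_eq_mk (by simpa using congrArg Φ hut') ?_
      simp only [Matrix.cons_val, e0, e1]
      rw [← hut']
      congr 1
      ext i; fin_cases i <;> rfl
    · simp only [Matrix.cons_val]
      rw [e0]; exact hasDerivAt_coord (hd t ht) 0
    · simp only [Matrix.cons_val]
      rw [e1]; exact hasDerivAt_coord (hd t ht) 1
    · simp only [Matrix.cons_val]
      rw [hcos]; exact hψd

/-! ### Uniqueness and regularity of Clairaut coordinates -/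

/-- Makes `UnitTangent g` Hausdorff, so that the compact section is closed, as are the compact parts
of the neck. -/
instance t2Space_tangentBundle [T2Space S] : T2Space (TangentBundle (𝓡 2) S) := by
  refine ⟨fun a b hab => ?_⟩
  by_cases hp : a.proj = b.proj
  · let e := trivializationAt E2 (TangentSpace (𝓡 2) : S → Type _) a.proj
    have ha : a ∈ e.source := e.mem_source.2 (FiberBundle.mem_baseSet_trivializationAt' a.proj)
    have hb : b ∈ e.source :=
      e.mem_source.2 (hp ▸ FiberBundle.mem_baseSet_trivializationAt' a.proj)
    have hne : e a ≠ e b := fun h => hab (e.toOpenPartialHomeomorph.injOn ha hb h)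
    obtain ⟨U, V, hU, hV, haU, hbV, hUV⟩ := t2_separation hne
    refine ⟨_, _, e.toOpenPartialHomeomorph.isOpen_inter_preimage hU,
      e.toOpenPartialHomeomorph.isOpen_inter_preimage hV, ⟨ha, haU⟩, ⟨hb, hbV⟩, ?_⟩
    rw [Set.disjoint_left] at hUV ⊢
    exact fun z hz hz' => hUV hz.2 hz'.2
  · obtain ⟨U, V, hU, hV, haU, hbV, hUV⟩ := t2_separation hp
    have hc : Continuous (fun z : TangentBundle (𝓡 2) S => z.proj) :=
      FiberBundle.continuous_proj E2 _
    exact ⟨_, _, hU.preimage hc, hV.preimage hc, haU, hbV, hUV.preimage _⟩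

theorem IsNeck.periodic_int {g : Metric S} {r ε₁ : ℝ} {Φ : E2 → S} (hN : IsNeck g r ε₁ Φ)
    {s : ℝ} (hs : |s| < ε₁) (θ : ℝ) (k : ℤ) :
    Φ !₂[s, θ + k * (2 * Real.pi)] = Φ !₂[s, θ] := by
  have : Function.Periodic (fun θ => Φ !₂[s, θ]) (2 * Real.pi) := fun θ => hN.periodic s θ hs
  exact this.int_mul k θ

theorem IsNeck.flatDeriv_periodic {g : Metric S} {r ε₁ : ℝ} {Φ : E2 → S} (hN : IsNeck g r ε₁ Φ)
    {s : ℝ} (hs : |s| < ε₁) (θ : ℝ) (k : ℤ) :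
    flatDeriv Φ !₂[s, θ + k * (2 * Real.pi)] = flatDeriv Φ !₂[s, θ] := by
  set w : E2 := !₂[0, k * (2 * Real.pi)] with hw
  have hsum : ∀ v : E2, v + w = !₂[v 0, v 1 + k * (2 * Real.pi)] := by
    intro v; ext i; fin_cases i <;> simp [hw]
  have h1 : flatDeriv (fun v => Φ (v + w)) !₂[s, θ] = flatDeriv Φ !₂[s, θ] := by
    apply flatDeriv_congr
    filter_upwards [(isOpen_strip ε₁).mem_nhds (show !₂[s, θ] ∈ strip ε₁ by simpa [strip] using hs)]
      with v hv
    rw [hsum, hN.periodic_int hv]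
    congr 1; ext i; fin_cases i <;> rfl
  rw [← h1]
  have h2 : !₂[s, θ + k * (2 * Real.pi)] = (!₂[s, θ] : E2) + w := by rw [hsum]; simp
  rw [h2]
  have hd : MDifferentiableAt (𝓡 2) (𝓡 2) Φ (!₂[s, θ] + w) :=
    hN.mdifferentiableAt (by rw [hsum]; simpa using hs)
  have hf : HasFDerivAt (fun v : E2 => v + w) (ContinuousLinearMap.id ℝ E2) !₂[s, θ] :=
    (hasFDerivAt_id _).add_const w
  have h3 := mfderiv_comp (I := 𝓡 2) (I' := 𝓡 2) (I'' := 𝓡 2) (!₂[s, θ] : E2) hd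
    hf.differentiableAt.mdifferentiableAt
  have h4 : mfderiv (𝓡 2) (𝓡 2) (fun v : E2 => v + w) !₂[s, θ] = ContinuousLinearMap.id ℝ E2 := by
    rw [mfderiv_eq_fderiv]; exact hf.fderiv
  change flatDeriv Φ _ = (mfderiv (𝓡 2) (𝓡 2) (Φ ∘ fun v : E2 => v + w) !₂[s, θ] : E2 →L[ℝ] E2)
  rw [h3, h4]
  rfl

/-- The Clairaut coordinates of a vector are determined by it, up to multiples of `2π`. -/
theorem IsNeck.clairaut_unique {g : Metric S} {r ε₁ : ℝ} {Φ : E2 → S} (hN : IsNeck g r ε₁ Φ)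
    {x : UnitTangent g} {p q : E3} (hp : HasClairaut g r ε₁ Φ x p)
    (hq : HasClairaut g r ε₁ Φ x q) :
    p 0 = q 0 ∧ (∃ k : ℤ, p 1 = q 1 + k * (2 * Real.pi)) ∧ Real.sin (p 2) = Real.sin (q 2) ∧
      Real.cos (p 2) = Real.cos (q 2) := by
  have hpi := Real.pi_pos
  obtain ⟨hp0, hpx⟩ := hp
  obtain ⟨hq0, hqx⟩ := hq
  rw [hpx, clairautVec_eq, clairautVec_eq] at hqx
  obtain ⟨k, hk⟩ : ∃ k : ℤ, |q 1 + k * (2 * Real.pi) - p 1| ≤ Real.pi := by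
    refine ⟨-round ((q 1 - p 1) / (2 * Real.pi)), ?_⟩
    have h := abs_sub_round ((q 1 - p 1) / (2 * Real.pi))
    have h2 : q 1 + (-round ((q 1 - p 1) / (2 * Real.pi)) : ℤ) * (2 * Real.pi) - p 1 =
        ((q 1 - p 1) / (2 * Real.pi) - round ((q 1 - p 1) / (2 * Real.pi))) * (2 * Real.pi) := by
      push_cast; field_simp; ring
    rw [h2, abs_mul, abs_of_pos (by positivity : 0 < 2 * Real.pi)]
    nlinarith
  have hbase : Φ !₂[p 0, p 1] = Φ !₂[q 0, q 1 + k * (2 * Real.pi)] := by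
    rw [hN.periodic_int hq0]; exact congrArg Bundle.TotalSpace.proj hqx
  have huv : (!₂[p 0, p 1] : E2) = !₂[q 0, q 1 + k * (2 * Real.pi)] := by
    obtain ⟨e, -, ht, heq⟩ := hN.chart ((p 1 + (q 1 + k * (2 * Real.pi))) / 2)
    obtain ⟨hk1, hk2⟩ := abs_le.1 hk
    have h1 : !₂[p 0, p 1] ∈ e.target := by
      rw [ht]; refine ⟨by simpa using hp0, ?_⟩
      simp only [Matrix.cons_val]; rw [abs_lt]; constructor <;> linarith
    have h2 : !₂[q 0, q 1 + k * (2 * Real.pi)] ∈ e.target := by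
      rw [ht]; refine ⟨by simpa using hq0, ?_⟩
      simp only [Matrix.cons_val]; rw [abs_lt]; constructor <;> linarith
    refine e.symm.injOn h1 h2 ?_
    rw [heq h1, heq h2, hbase]
  have e0 : p 0 = q 0 := by simpa using congrArg (fun v : E2 => v 0) huv
  have e1 : p 1 = q 1 + k * (2 * Real.pi) := by simpa using congrArg (fun v : E2 => v 1) huv
  refine ⟨e0, ⟨k, e1⟩, ?_⟩
  rw [huv] at hqx
  have h5 : flatDeriv Φ !₂[q 0, q 1]
        !₂[Real.sin (p 2) / meridianSpeed r (p 0), Real.cos (p 2) / profile r (p 0)] =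
      flatDeriv Φ !₂[q 0, q 1]
        !₂[Real.sin (q 2) / meridianSpeed r (q 0), Real.cos (q 2) / profile r (q 0)] := by
    rw [hN.flatDeriv_periodic hq0, hN.periodic_int hq0] at hqx
    exact eq_of_heq (Bundle.TotalSpace.mk.inj hqx).2
  have h6 := hN.flatDeriv_injective (by simpa using hq0) h5
  have h7 := congrArg (fun v : E2 => v 0) h6
  have h8 := congrArg (fun v : E2 => v 1) h6
  simp only [Matrix.cons_val, e0] at h7 h8
  exact ⟨(div_left_inj' (meridianSpeed_pos r _).ne').1 h7, (div_left_inj' (profile_pos r _).ne').1 h8⟩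

/-- Changing the angles by multiples of `2π` gives other Clairaut coordinates of the vector. -/
theorem IsNeck.hasClairaut_shift {g : Metric S} {r ε₁ : ℝ} {Φ : E2 → S} (hN : IsNeck g r ε₁ Φ)
    {x : UnitTangent g} {p : E3} (hp : HasClairaut g r ε₁ Φ x p) (k l : ℤ) :
    HasClairaut g r ε₁ Φ x !₂[p 0, p 1 + k * (2 * Real.pi), p 2 + l * (2 * Real.pi)] := by
  refine ⟨by simpa using hp.1, ?_⟩
  rw [hp.2, clairautVec_eq, clairautVec_eq]
  simp only [Matrix.cons_val]
  refine mk_eq_mk (hN.periodic_int hp.1 _ _).symm ?_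
  rw [hN.flatDeriv_periodic hp.1, Real.sin_add_int_mul_two_pi, Real.cos_add_int_mul_two_pi]

/-- Every vector over the neck has Clairaut coordinates with angles in `[0, 2π)`. -/
theorem IsNeck.exists_normalized {g : Metric S} {r ε₁ : ℝ} {Φ : E2 → S} (hN : IsNeck g r ε₁ Φ)
    {x : UnitTangent g} {p : E3} (hp : HasClairaut g r ε₁ Φ x p) :
    ∃ q : E3, HasClairaut g r ε₁ Φ x q ∧ q 1 ∈ Ico 0 (2 * Real.pi) ∧
      q 2 ∈ Ico 0 (2 * Real.pi) ∧ q 0 = p 0 ∧ (∃ k : ℤ, q 1 = p 1 + k * (2 * Real.pi)) ∧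
      ∃ l : ℤ, q 2 = p 2 + l * (2 * Real.pi) := by
  have key : ∀ θ : ℝ, ∃ k : ℤ, θ + k * (2 * Real.pi) ∈ Ico 0 (2 * Real.pi) := by
    intro θ
    obtain ⟨k, hk, -⟩ := existsUnique_add_zsmul_mem_Ico Real.two_pi_pos θ 0
    exact ⟨k, by simpa using hk⟩
  obtain ⟨k, hk⟩ := key (p 1)
  obtain ⟨l, hl⟩ := key (p 2)
  exact ⟨_, hN.hasClairaut_shift hp k l, by simpa using hk, by simpa using hl, by simp,
    ⟨k, by simp⟩, ⟨l, by simp⟩⟩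

/-- All unit vectors based in the neck have Clairaut coordinates. -/
theorem IsNeck.exists_hasClairaut {g : Metric S} {r ε₁ : ℝ} {Φ : E2 → S} (hN : IsNeck g r ε₁ Φ)
    {x : UnitTangent g} {u : E2} (hu : |u 0| < ε₁) (hx : x.1.proj = Φ u) :
    ∃ ψ : ℝ, HasClairaut g r ε₁ Φ x !₂[u 0, u 1, ψ] := by
  obtain ⟨⟨q, v⟩, hv⟩ := x
  change q = Φ u at hx
  subst hx
  obtain ⟨z, hz⟩ := hN.flatDeriv_surjective hu v
  have hunit : (meridianSpeed r (u 0) * z 0) ^ 2 + (profile r (u 0) * z 1) ^ 2 = 1 := by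
    rw [← hN.inner_flatDeriv hu, hz]; exact hv
  obtain ⟨ψ, h1, h2⟩ : ∃ ψ, Real.sin ψ = meridianSpeed r (u 0) * z 0 ∧
      Real.cos ψ = profile r (u 0) * z 1 := by
    set c : ℂ := ⟨profile r (u 0) * z 1, meridianSpeed r (u 0) * z 0⟩ with hc
    have hn : ‖c‖ = 1 := by
      rw [Complex.norm_eq_sqrt_sq_add_sq, hc]; simp only; rw [add_comm, hunit, Real.sqrt_one]
    have hc0 : c ≠ 0 := by rw [← norm_ne_zero_iff, hn]; exact one_ne_zero
    exact ⟨c.arg, by rw [Complex.sin_arg, hn, div_one], by rw [Complex.cos_arg hc0, hn, div_one]⟩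
  refine ⟨ψ, by simpa using hu, ?_⟩
  have huu : u = !₂[u 0, u 1] := by ext i; fin_cases i <;> rfl
  rw [clairautVec_eq]
  simp only [Matrix.cons_val, h1, h2]
  refine mk_eq_mk (congrArg Φ huu) ?_
  rw [mul_div_cancel_left₀ _ (meridianSpeed_pos r _).ne', mul_div_cancel_left₀ _ (profile_pos r _).ne',
    ← huu, ← hz]
  congr 1
  ext i; fin_cases i <;> rfl

theorem IsNeck.contMDiffAt_clairautVec {g : Metric S} {r ε₁ : ℝ} {Φ : E2 → S} (hr : 4 ≤ r)
    (hN : IsNeck g r ε₁ Φ) {p : E3} (hp : |p 0| < ε₁) :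
    ContMDiffAt (𝓡 3) (𝓡 2).tangent 1 (clairautVec r Φ) p := by
  have hΦ : ContMDiffOn (𝓡 2) (𝓡 2) 2 Φ (strip ε₁) := fun u hu =>
    ((hN.contMDiffAt hu).of_le (by norm_num)).contMDiffWithinAt
  have hT := hΦ.contMDiffOn_tangentMapWithin (m := 1) (by norm_num) (isOpen_strip ε₁).uniqueMDiffOn
  set A : E3 → TangentBundle (𝓡 2) E2 := fun p => (tangentBundleModelSpaceHomeomorph (𝓡 2)).symm
    (!₂[p 0, p 1], !₂[Real.sin (p 2) / meridianSpeed r (p 0), Real.cos (p 2) / profile r (p 0)])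
    with hA
  have hcd : ContDiff ℝ 1 (fun p : E3 => ((!₂[p 0, p 1],
      !₂[Real.sin (p 2) / meridianSpeed r (p 0), Real.cos (p 2) / profile r (p 0)]) : E2 × E2)) := by
    have hc : ∀ i : Fin 3, ContDiff ℝ 1 (fun p : E3 => p i) := fun i =>
      (EuclideanSpace.proj i : E3 →L[ℝ] ℝ).contDiff
    refine ContDiff.prodMk ?_ ?_
    · rw [contDiff_euclidean]; intro i; fin_cases i
      · exact hc 0
      · exact hc 1
    · rw [contDiff_euclidean]; intro i; fin_cases i
      · exact (Real.contDiff_sin.comp (hc 2)).div ((contDiff_meridianSpeed hr).comp (hc 0))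
          fun p => (meridianSpeed_pos r _).ne'
      · exact (Real.contDiff_cos.comp (hc 2)).div ((contDiff_profile hr).comp (hc 0))
          fun p => (profile_pos r _).ne'
  have hAs : ContMDiff (𝓡 3) (𝓡 2).tangent 1 A := by
    refine (contMDiff_tangentBundleModelSpaceHomeomorph_symm (I := 𝓡 2) (n := 1)).comp ?_
    have h1 := (contMDiff_iff_contDiff.2 hcd.fst).prodMk (contMDiff_iff_contDiff.2 hcd.snd)
    rw [chartedSpaceSelf_prod] at h1
    exact h1
  have hset : IsOpen (Bundle.TotalSpace.proj ⁻¹' strip ε₁ : Set (TangentBundle (𝓡 2) E2)) :=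
    (isOpen_strip ε₁).preimage (FiberBundle.continuous_proj E2 _)
  have hAp : A p ∈ (Bundle.TotalSpace.proj ⁻¹' strip ε₁ : Set (TangentBundle (𝓡 2) E2)) := by
    change |p 0| < ε₁
    exact hp
  have hcomp := (hT.contMDiffAt (hset.mem_nhds hAp)).comp p hAs.contMDiffAt
  refine hcomp.congr_of_eventuallyEq ?_
  have hopen : IsOpen {q : E3 | |q 0| < ε₁} := isOpen_lt (by fun_prop) continuous_const
  filter_upwards [hopen.mem_nhds hp] with q hq
  rw [clairautVec_eq]
  refine mk_eq_mk rfl ?_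
  have hm : !₂[q 0, q 1] ∈ strip ε₁ := by simpa [strip] using hq
  have : mfderivWithin (𝓡 2) (𝓡 2) Φ (strip ε₁) !₂[q 0, q 1] = mfderiv (𝓡 2) (𝓡 2) Φ !₂[q 0, q 1] :=
    mfderivWithin_of_mem_nhds ((isOpen_strip ε₁).mem_nhds hm)
  exact congrArg (fun L : E2 →L[ℝ] E2 => L _) this.symm

end Surface

/-! ### Crossing times -/

/-- A solution of `x' ≥ κ (a + x)^p` with `p > 1` stays nonnegative only for a time `O(a^(1-p))`:
the function `-(a + x)^(1-p)` is bounded and grows at a definite rate. -/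
theorem time_le_of_growth_nonneg {x x' : ℝ → ℝ} {a κ p t₀ t₁ : ℝ} (ha : 0 < a) (hκ : 0 < κ)
    (hp : 1 < p) (ht : t₀ ≤ t₁) (hd : ∀ t ∈ Icc t₀ t₁, HasDerivAt x (x' t) t)
    (hx : ∀ t ∈ Icc t₀ t₁, 0 ≤ x t) (hg : ∀ t ∈ Icc t₀ t₁, κ * (a + x t) ^ p ≤ x' t) :
    t₁ - t₀ ≤ a ^ (1 - p) / (κ * (p - 1)) := by
  have hpos : ∀ t ∈ Icc t₀ t₁, 0 < a + x t := fun t h => by linarith [hx t h]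
  have hyd : ∀ t ∈ Icc t₀ t₁, HasDerivAt (fun t => -(a + x t) ^ (1 - p))
      (-(x' t * (1 - p) * (a + x t) ^ (1 - p - 1))) t := fun t h =>
    (((hd t h).const_add a).rpow_const (Or.inl (hpos t h).ne')).neg
  have hlow : κ * (p - 1) * (t₁ - t₀) ≤ -(a + x t₁) ^ (1 - p) - -(a + x t₀) ^ (1 - p) := by
    refine (convex_Icc t₀ t₁).mul_sub_le_image_sub_of_le_deriv
      (fun t h => (hyd t h).continuousAt.continuousWithinAt)
      (fun t h => (hyd t (interior_subset h)).differentiableAt.differentiableWithinAt) ?_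
      t₀ (left_mem_Icc.2 ht) t₁ (right_mem_Icc.2 ht) ht
    intro t h
    have h := interior_subset h
    rw [(hyd t h).deriv]
    have h1 : (a + x t) ^ (1 - p - 1) * (a + x t) ^ p = 1 := by
      rw [← Real.rpow_add (hpos t h)]; simp
    have h2 : 0 < (a + x t) ^ (1 - p - 1) := Real.rpow_pos_of_pos (hpos t h) _
    have h3 := mul_le_mul_of_nonneg_right (hg t h) h2.le
    have h4 : κ ≤ x' t * (a + x t) ^ (1 - p - 1) := by
      calc κ = κ * (a + x t) ^ p * (a + x t) ^ (1 - p - 1) := by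
            rw [mul_assoc, mul_comm ((a + x t) ^ p), h1, mul_one]
        _ ≤ _ := h3
    nlinarith
  have h5 : 0 < (a + x t₁) ^ (1 - p) := Real.rpow_pos_of_pos (hpos _ (right_mem_Icc.2 ht)) _
  have h6 : (a + x t₀) ^ (1 - p) ≤ a ^ (1 - p) :=
    Real.rpow_le_rpow_of_nonpos ha (by linarith [hx t₀ (left_mem_Icc.2 ht)]) (by linarith)
  rw [le_div_iff₀ (by nlinarith)]
  nlinarith

/-- The same bound, doubled, without a sign condition: `x` is increasing, so it is first negative,
where time reversal and `-x` reduce to the nonnegative case, and then nonnegative. -/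
theorem time_le_of_growth {x x' : ℝ → ℝ} {a κ p t₀ t₁ : ℝ} (ha : 0 < a) (hκ : 0 < κ)
    (hp : 1 < p) (ht : t₀ ≤ t₁) (hd : ∀ t ∈ Icc t₀ t₁, HasDerivAt x (x' t) t)
    (hg : ∀ t ∈ Icc t₀ t₁, κ * (a + |x t|) ^ p ≤ x' t) :
    t₁ - t₀ ≤ 2 * (a ^ (1 - p) / (κ * (p - 1))) := by
  have hmono : MonotoneOn x (Icc t₀ t₁) := by
    refine monotoneOn_of_deriv_nonneg (convex_Icc _ _)
      (fun t h => (hd t h).continuousAt.continuousWithinAt)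
      (fun t h => (hd t (interior_subset h)).differentiableAt.differentiableWithinAt) fun t h => ?_
    rw [(hd t (interior_subset h)).deriv]
    exact le_trans (by positivity) (hg t (interior_subset h))
  have hC : 0 ≤ a ^ (1 - p) / (κ * (p - 1)) :=
    div_nonneg (Real.rpow_nonneg ha.le _) (mul_nonneg hκ.le (by linarith))
  have right : ∀ m ∈ Icc t₀ t₁, 0 ≤ x m → t₁ - m ≤ a ^ (1 - p) / (κ * (p - 1)) := by
    intro m hm hxm
    have hsub : Icc m t₁ ⊆ Icc t₀ t₁ := Icc_subset_Icc_left hm.1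
    have hx : ∀ t ∈ Icc m t₁, 0 ≤ x t := fun t h => hxm.trans (hmono hm (hsub h) h.1)
    exact time_le_of_growth_nonneg ha hκ hp hm.2 (fun t h => hd t (hsub h)) hx fun t h => by
      simpa [abs_of_nonneg (hx t h)] using hg t (hsub h)
  have left : ∀ m ∈ Icc t₀ t₁, x m ≤ 0 → m - t₀ ≤ a ^ (1 - p) / (κ * (p - 1)) := by
    intro m hm hxm
    have hmem : ∀ t ∈ Icc (-m) (-t₀), -t ∈ Icc t₀ t₁ := fun t h =>
      ⟨by linarith [h.2], by linarith [h.1, hm.2]⟩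
    have hx : ∀ t ∈ Icc (-m) (-t₀), 0 ≤ -x (-t) := fun t h => by
      have := hmono (hmem t h) hm (by linarith [h.1]); linarith
    have h := time_le_of_growth_nonneg (x := fun t => -x (-t)) (x' := fun t => x' (-t)) ha hκ hp
      (neg_le_neg hm.1) (fun t h => ?_) hx fun t h => ?_
    · linarith
    · have := ((hd (-t) (hmem t h)).scomp t (hasDerivAt_neg t)).neg
      exact this.congr_deriv (by simp)
    · have := hg (-t) (hmem t h)
      rwa [abs_of_nonpos (by linarith [hx t h])] at this
  have ht0 := left_mem_Icc.2 ht
  have ht1 := right_mem_Icc.2 ht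
  rcases le_total 0 (x t₀) with h0 | h0
  · linarith [right t₀ ht0 h0]
  rcases le_total (x t₁) 0 with h1 | h1
  · linarith [left t₁ ht1 h1]
  obtain ⟨m, hm, hxm⟩ := intermediate_value_Icc ht
    (fun t h => (hd t h).continuousAt.continuousWithinAt) (show (0 : ℝ) ∈ Icc (x t₀) (x t₁) from ⟨h0, h1⟩)
  linarith [right m hm hxm.ge, left m hm hxm.le]

/-- The `(s, sin ψ)`-components of an orbit of Clairaut constant `c` that stays in `|s| ≤ ε₀`
during the time interval `[0, T]`. -/
structure IsNeckOrbit (r ε₀ c T : ℝ) (s v : ℝ → ℝ) : Prop where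
  deriv_s : ∀ t ∈ Icc 0 T, HasDerivAt s (v t / meridianSpeed r (s t)) t
  deriv_v : ∀ t ∈ Icc 0 T, HasDerivAt v
    (deriv (profile r) (s t) * (1 - v t ^ 2) / (profile r (s t) * meridianSpeed r (s t))) t
  clairaut : ∀ t ∈ Icc 0 T, profile r (s t) ^ 2 * (1 - v t ^ 2) = c ^ 2
  abs_le : ∀ t ∈ Icc 0 T, |s t| ≤ ε₀

/-- A continuous function without zeros on an interval has constant sign. -/
theorem sign_const {f : ℝ → ℝ} {a b : ℝ} (hf : ContinuousOn f (Icc a b))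
    (h0 : ∀ t ∈ Icc a b, f t ≠ 0) : (∀ t ∈ Icc a b, 0 < f t) ∨ ∀ t ∈ Icc a b, f t < 0 := by
  by_contra! h
  obtain ⟨⟨t, ht, hft⟩, u, hu, hfu⟩ := h
  obtain ⟨z, hz, hz0⟩ := (isPreconnected_Icc.intermediate_value ht hu hf) ⟨hft, hfu⟩
  exact h0 z hz hz0

theorem exists_bound_profile {r : ℝ} (hr : 4 ≤ r) (ε₀ : ℝ) :
    ∃ R : ℝ, 1 ≤ R ∧ ∀ s, |s| ≤ ε₀ → profile r s ≤ R ∧ meridianSpeed r s ≤ R := by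
  obtain ⟨A, hA⟩ := isCompact_Icc.exists_bound_of_continuousOn (s := Icc (-ε₀) ε₀)
    (contDiff_profile hr).continuous.continuousOn
  obtain ⟨B, hB⟩ := isCompact_Icc.exists_bound_of_continuousOn (s := Icc (-ε₀) ε₀)
    (contDiff_meridianSpeed hr).continuous.continuousOn
  refine ⟨max 1 (max A B), le_max_left _ _, fun s hs => ?_⟩
  have h1 := (le_abs_self _).trans (hA s (abs_le.1 hs))
  have h2 := (le_abs_self _).trans (hB s (abs_le.1 hs))
  exact ⟨h1.trans (by simp), h2.trans (by simp)⟩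

theorem add_rpow_le {a b r : ℝ} (ha : 0 ≤ a) (hb : 0 ≤ b) (hr : 0 ≤ r) :
    (a + b) ^ r ≤ 2 ^ r * (a ^ r + b ^ r) := by
  have h1 : 0 ≤ a ^ r := Real.rpow_nonneg ha r
  have h2 : 0 ≤ b ^ r := Real.rpow_nonneg hb r
  rcases le_total a b with h | h
  · calc (a + b) ^ r ≤ (2 * b) ^ r := Real.rpow_le_rpow (by linarith) (by linarith) hr
      _ = 2 ^ r * b ^ r := Real.mul_rpow (by norm_num) hb
      _ ≤ _ := by gcongr; linarith
  · calc (a + b) ^ r ≤ (2 * a) ^ r := Real.rpow_le_rpow (by linarith) (by linarith) hr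
      _ = 2 ^ r * a ^ r := Real.mul_rpow (by norm_num) ha
      _ ≤ _ := by gcongr; linarith

/-- Orbits with `|c| < 1` do not turn back: `s` moves with speed at least
`κ ((1 - |c|)^(1/r) + |s|)^(r/2)`. -/
theorem exists_transit_le_of_lt_one {r : ℝ} (hr : 4 ≤ r) (ε₀ : ℝ) : ∃ C : ℝ, 0 < C ∧
    ∀ c T s v, IsNeckOrbit r ε₀ c T s v → 0 ≤ T → |c| < 1 →
      T ≤ C * (1 - |c|) ^ (-(1 / 2 - 1 / r)) := by
  obtain ⟨R, hR, hRb⟩ := exists_bound_profile hr ε₀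
  -- one factor `R` bounds the meridian speed, the root comes from `v² ≥ (δ^(1/r) + |s|)^r / (2^r R)`
  set κ : ℝ := 1 / (R * √(2 ^ r * R)) with hκdef
  have h2r : (0 : ℝ) < 2 ^ r := by positivity
  have hκ : 0 < κ := by positivity
  refine ⟨2 / (κ * (r / 2 - 1)), div_pos two_pos (mul_pos hκ (by linarith)), ?_⟩
  intro c T s v h hT hc
  set δ := 1 - |c| with hδ
  have hδ0 : 0 < δ := by linarith
  have hv2 : ∀ t ∈ Icc 0 T, (δ + |s t| ^ r) / R ≤ v t ^ 2 := by
    intro t ht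
    obtain ⟨h1, -⟩ := hRb _ (h.abs_le t ht)
    have h2 := one_le_profile r (s t)
    have h3 : profile r (s t) = 1 + |s t| ^ r := rfl
    have h4 := h.clairaut t ht
    have h5 : 0 ≤ |s t| ^ r := Real.rpow_nonneg (abs_nonneg _) _
    rw [← sq_abs c] at h4
    have h6 : (profile r (s t) - |c|) * profile r (s t) ≤ profile r (s t) ^ 2 * v t ^ 2 := by
      nlinarith [abs_nonneg c]
    have h7 : profile r (s t) - |c| ≤ profile r (s t) * v t ^ 2 := by
      have : (profile r (s t) - |c|) * profile r (s t) ≤ (profile r (s t) * v t ^ 2) * profile r (s t) := by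
        linarith
      exact le_of_mul_le_mul_right this (by linarith)
    rw [div_le_iff₀ (by linarith)]
    have : profile r (s t) * v t ^ 2 ≤ v t ^ 2 * R := by nlinarith [sq_nonneg (v t)]
    linarith
  have hrate : ∀ t ∈ Icc 0 T, κ * (δ ^ (1 / r) + |s t|) ^ (r / 2) ≤ |v t| / meridianSpeed r (s t) := by
    intro t ht
    have ha : 0 ≤ δ ^ (1 / r) := Real.rpow_nonneg hδ0.le _
    have h1 : (δ ^ (1 / r) + |s t|) ^ r ≤ 2 ^ r * (δ + |s t| ^ r) := by
      have := add_rpow_le ha (abs_nonneg (s t)) (show 0 ≤ r by linarith)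
      rwa [← Real.rpow_mul hδ0.le, one_div_mul_cancel (by linarith), Real.rpow_one] at this
    have h2 : (δ ^ (1 / r) + |s t|) ^ r / (2 ^ r * R) ≤ v t ^ 2 := by
      refine le_trans ?_ (hv2 t ht)
      rw [div_le_div_iff₀ (by positivity) (by linarith)]
      nlinarith
    have h3 : √((δ ^ (1 / r) + |s t|) ^ r / (2 ^ r * R)) ≤ |v t| := by
      exact Real.sqrt_le_iff.2 ⟨abs_nonneg _, by rwa [sq_abs]⟩
    have h4 : √((δ ^ (1 / r) + |s t|) ^ r / (2 ^ r * R)) =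
        (δ ^ (1 / r) + |s t|) ^ (r / 2) / √(2 ^ r * R) := by
      rw [Real.sqrt_div (by positivity), Real.sqrt_eq_rpow, ← Real.rpow_mul (by positivity)]
      congr 2; ring
    rw [h4] at h3
    obtain ⟨-, h5⟩ := hRb _ (h.abs_le t ht)
    calc κ * (δ ^ (1 / r) + |s t|) ^ (r / 2)
        = ((δ ^ (1 / r) + |s t|) ^ (r / 2) / √(2 ^ r * R)) / R := by
          rw [hκdef]; field_simp
      _ ≤ |v t| / R := by gcongr
      _ ≤ _ := by gcongr; exact meridianSpeed_pos r (s t)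
  have hexp : (δ ^ (1 / r)) ^ (1 - r / 2) = δ ^ (-(1 / 2 - 1 / r)) := by
    rw [← Real.rpow_mul hδ0.le]; congr 1; field_simp; ring
  have hvne : ∀ t ∈ Icc 0 T, v t ≠ 0 := by
    intro t ht h0
    have h1 := hv2 t ht
    have h5 : 0 ≤ |s t| ^ r := Real.rpow_nonneg (abs_nonneg _) _
    have : 0 < (δ + |s t| ^ r) / R := by positivity
    rw [h0] at h1; simp at h1; linarith
  have ha := Real.rpow_pos_of_pos hδ0 (1 / r)
  have main : T ≤ 2 * ((δ ^ (1 / r)) ^ (1 - r / 2) / (κ * (r / 2 - 1))) := by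
    rcases sign_const (fun t ht => (h.deriv_v t ht).continuousAt.continuousWithinAt) hvne with hv | hv
    · have := time_le_of_growth ha hκ (show 1 < r / 2 by linarith) hT h.deriv_s fun t ht => by
        have := hrate t ht
        rwa [abs_of_pos (hv t ht)] at this
      linarith
    · have := time_le_of_growth (x := fun t => - s t) ha hκ (show 1 < r / 2 by linarith) hT
        (fun t ht => (h.deriv_s t ht).neg) fun t ht => by
          have := hrate t ht
          rw [abs_of_neg (hv t ht)] at this
          rwa [abs_neg, ← neg_div]
      linarith
  rw [hexp] at main
  refine main.trans (le_of_eq ?_)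
  ring

/-- Orbits with `|c| > 1` turn back: `sin ψ` moves with speed at least
`κ ((|c| - 1)^(1/2) + |sin ψ|)^(2 - 2/r)`. -/
theorem exists_transit_le_of_one_lt {r : ℝ} (hr : 4 ≤ r) (ε₀ : ℝ) : ∃ C : ℝ, 0 < C ∧
    ∀ c T s v, IsNeckOrbit r ε₀ c T s v → 0 ≤ T → 1 < |c| →
      T ≤ C * (|c| - 1) ^ (-(1 / 2 - 1 / r)) := by
  obtain ⟨R, hR, hRb⟩ := exists_bound_profile hr ε₀
  set q : ℝ := (r - 1) / r with hq
  have hq0 : 0 < q := div_pos (by linarith) (by linarith)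
  set κ : ℝ := 1 / (R ^ 4 * 6 ^ q) with hκdef
  have hκ : 0 < κ := by positivity
  have hqr : q = 1 - 1 / r := by rw [hq]; field_simp
  have hp1 : 1 < 2 * q := by
    have : 1 / r ≤ 1 / 4 := one_div_le_one_div_of_le (by norm_num) hr
    linarith
  refine ⟨2 / (κ * (2 * q - 1)), div_pos two_pos (mul_pos hκ (by linarith)), ?_⟩
  intro c T s v h hT hc
  set δ := |c| - 1 with hδ
  have hδ0 : 0 < δ := by linarith
  have hv1 : ∀ t ∈ Icc 0 T, v t ^ 2 < 1 := by
    intro t ht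
    by_contra! h1
    have h4 := h.clairaut t ht
    rw [← sq_abs c] at h4
    nlinarith [sq_nonneg (profile r (s t))]
  have hsr : ∀ t ∈ Icc 0 T, (√δ + |v t|) ^ 2 / 6 ≤ |s t| ^ r := by
    intro t ht
    have h4 := h.clairaut t ht
    rw [← sq_abs c] at h4
    have h1 := hv1 t ht
    have h2 := one_le_profile r (s t)
    have h3 : profile r (s t) = 1 + |s t| ^ r := rfl
    -- `|c| = ξ √(1 - v²)` and `1 / √(1 - v²) ≥ 1 + v² / 3`
    have h5 : |c| * (1 + v t ^ 2 / 3) ≤ profile r (s t) := by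
      refine abs_le_of_sq_le_sq' ?_ (by linarith) |>.2
      have h6 := sq_nonneg (v t)
      have h7 : (1 + v t ^ 2 / 3) ^ 2 * (1 - v t ^ 2) ≤ 1 := by
        set w := v t ^ 2
        nlinarith [mul_nonneg h6 h6, mul_nonneg (mul_nonneg h6 h6) h6]
      rw [mul_pow, ← h4]
      nlinarith [sq_nonneg (profile r (s t))]
    have h6 : √δ ^ 2 = δ := Real.sq_sqrt hδ0.le
    have h7 : |v t| ^ 2 = v t ^ 2 := sq_abs _
    nlinarith [sq_nonneg (√δ - |v t|), sq_nonneg (v t)]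
  have hsne : ∀ t ∈ Icc 0 T, s t ≠ 0 := by
    intro t ht h0
    have h1 := hsr t ht
    rw [h0, abs_zero, Real.zero_rpow (by linarith)] at h1
    have : 0 < (√δ + |v t|) ^ 2 / 6 := by
      have := Real.sqrt_pos.2 hδ0
      positivity
    linarith
  -- the power of `R` absorbs `1 - v² ≥ R⁻²` and the denominator `ξ √(1 + ξ'²) ≤ R²`
  have hrate : ∀ t ∈ Icc 0 T, κ * (√δ + |v t|) ^ (2 * q) ≤ |s t| ^ (r - 1) * (1 - v t ^ 2) /
      (profile r (s t) * meridianSpeed r (s t)) := by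
    intro t ht
    have hs0 := abs_pos.2 (hsne t ht)
    obtain ⟨h1, h2⟩ := hRb _ (h.abs_le t ht)
    have h3 := profile_pos r (s t)
    have h4 := meridianSpeed_pos r (s t)
    have h5 : |s t| ^ (r - 1) = (|s t| ^ r) ^ q := by
      rw [← Real.rpow_mul hs0.le]; congr 1; rw [hq]; field_simp
    have h6 : (√δ + |v t|) ^ (2 * q) / 6 ^ q ≤ |s t| ^ (r - 1) := by
      rw [h5, Real.rpow_mul (by positivity), ← Real.div_rpow (by positivity) (by norm_num)]
      refine Real.rpow_le_rpow (by positivity) ?_ hq0.le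
      simpa using hsr t ht
    have h7 : 1 / R ^ 2 ≤ 1 - v t ^ 2 := by
      rw [div_le_iff₀ (by positivity)]
      have h8 := h.clairaut t ht
      rw [← sq_abs c] at h8
      have h9 : profile r (s t) ^ 2 ≤ R ^ 2 := by gcongr
      nlinarith [hv1 t ht]
    calc κ * (√δ + |v t|) ^ (2 * q)
        = (√δ + |v t|) ^ (2 * q) / 6 ^ q * (1 / R ^ 2) / (R * R) := by
          rw [hκdef]; field_simp
      _ ≤ |s t| ^ (r - 1) * (1 - v t ^ 2) / (profile r (s t) * meridianSpeed r (s t)) := by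
          gcongr
          exact mul_nonneg (by positivity) (by linarith [hv1 t ht])
  have hder : ∀ t, deriv (profile r) (s t) = r * |s t| ^ (r - 2) * s t := fun t => by
    rw [deriv_profile hr]
  have hder' : ∀ t ∈ Icc 0 T, |s t| ^ (r - 1) ≤ r * |s t| ^ (r - 2) * |s t| := by
    intro t ht
    have hs0 := abs_pos.2 (hsne t ht)
    have : |s t| ^ (r - 1) = |s t| ^ (r - 2) * |s t| := by
      rw [← Real.rpow_add_one hs0.ne']; congr 1; ring
    rw [mul_assoc, ← this]
    nlinarith [Real.rpow_nonneg hs0.le (r - 1)]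
  have hrate' : ∀ t ∈ Icc 0 T, κ * (√δ + |v t|) ^ (2 * q) ≤ r * |s t| ^ (r - 2) * |s t| *
      (1 - v t ^ 2) / (profile r (s t) * meridianSpeed r (s t)) := by
    intro t ht
    refine (hrate t ht).trans ?_
    have h3 := profile_pos r (s t)
    have h4 := meridianSpeed_pos r (s t)
    have := hv1 t ht
    have := hder' t ht
    gcongr
  have hexp : √δ ^ (1 - 2 * q) = δ ^ (-(1 / 2 - 1 / r)) := by
    rw [Real.sqrt_eq_rpow, ← Real.rpow_mul hδ0.le]; congr 1; rw [hqr]; ring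
  have ha := Real.sqrt_pos.2 hδ0
  have main : T ≤ 2 * (√δ ^ (1 - 2 * q) / (κ * (2 * q - 1))) := by
    rcases sign_const (fun t ht => (h.deriv_s t ht).continuousAt.continuousWithinAt) hsne with hs | hs
    · have := time_le_of_growth ha hκ hp1 hT h.deriv_v fun t ht => by
        have := hrate' t ht
        rw [hder]
        rwa [abs_of_pos (hs t ht)] at this ⊢
      linarith
    · have := time_le_of_growth (x := fun t => - v t) ha hκ hp1 hT
        (fun t ht => (h.deriv_v t ht).neg) fun t ht => by
          have := hrate' t ht
          rw [abs_neg, hder]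
          refine this.trans (le_of_eq ?_)
          rw [abs_of_neg (hs t ht)]; ring
      linarith
  rw [hexp] at main
  refine main.trans (le_of_eq ?_)
  ring

/-- A lower bound for the crossing time: the time that an orbit with `|c| < 1` spends in `|s| ≤ (1 - |c|)^(1/r)`, where its speed is
at most `2 (1 - |c|)^(1/2)`. -/
theorem le_transit_of_lt_one {r ε₀ c T : ℝ} {s v : ℝ → ℝ} (hr : 4 ≤ r)
    (h : IsNeckOrbit r ε₀ c T s v) (hT : 0 < T) (hc : |c| < 1) (hδ : (1 - |c|) ^ (1 / r) ≤ ε₀)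
    (hs0 : s 0 = ε₀) (hv0 : v 0 < 0) (hsT : |s T| = ε₀) :
    (1 - |c|) ^ (-(1 / 2 - 1 / r)) ≤ T := by
  set δ := 1 - |c| with hδdef
  have hδ0 : 0 < δ := by linarith
  set a := δ ^ (1 / r) with ha
  have ha0 : 0 < a := Real.rpow_pos_of_pos hδ0 _
  have har : a ^ r = δ := by
    rw [ha, ← Real.rpow_mul hδ0.le, one_div_mul_cancel (by linarith), Real.rpow_one]
  have h0T : (0 : ℝ) ∈ Icc 0 T := left_mem_Icc.2 hT.le
  have hTT : T ∈ Icc 0 T := right_mem_Icc.2 hT.le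
  have hclair : ∀ t ∈ Icc 0 T, profile r (s t) ^ 2 * v t ^ 2 =
      (profile r (s t) - |c|) * (profile r (s t) + |c|) := by
    intro t ht
    have h4 := h.clairaut t ht
    rw [← sq_abs c] at h4
    linarith
  have hvne : ∀ t ∈ Icc 0 T, v t ≠ 0 := by
    intro t ht h0
    have h4 := hclair t ht
    have h5 := one_le_profile r (s t)
    rw [h0] at h4
    nlinarith [abs_nonneg c]
  have hv : ∀ t ∈ Icc 0 T, v t < 0 := by
    rcases sign_const (fun t ht => (h.deriv_v t ht).continuousAt.continuousWithinAt) hvne with hv | hv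
    · linarith [hv 0 h0T]
    · exact hv
  have hcont : ContinuousOn s (Icc 0 T) := fun t ht =>
    (h.deriv_s t ht).continuousAt.continuousWithinAt
  have hanti : StrictAntiOn s (Icc 0 T) := by
    refine strictAntiOn_of_deriv_neg (convex_Icc _ _) hcont fun t ht => ?_
    have ht := interior_subset ht
    rw [(h.deriv_s t ht).deriv]
    exact div_neg_of_neg_of_pos (hv t ht) (meridianSpeed_pos r _)
  have hsT' : s T = -ε₀ := by
    rcases abs_choice (s T) with h1 | h1
    · have := hanti h0T hTT hT
      linarith
    · linarith
  obtain ⟨t₁, ht₁, hst₁⟩ := intermediate_value_Icc' hT.le hcont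
    (show a ∈ Icc (s T) (s 0) from ⟨by linarith, by linarith⟩)
  obtain ⟨t₂, ht₂, hst₂⟩ := intermediate_value_Icc' hT.le hcont
    (show -a ∈ Icc (s T) (s 0) from ⟨by linarith, by linarith⟩)
  have h12 : t₁ < t₂ := by
    rw [← hanti.lt_iff_gt ht₂ ht₁]; linarith
  have hsub : Icc t₁ t₂ ⊆ Icc 0 T := Icc_subset_Icc ht₁.1 ht₂.2
  have hspeed : ∀ t ∈ Icc t₁ t₂, ‖v t / meridianSpeed r (s t)‖ ≤ 2 * √δ := by
    intro t ht
    have ht' := hsub ht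
    have h1 : s t ≤ a := hst₁ ▸ hanti.antitoneOn ht₁ ht' ht.1
    have h2 : -a ≤ s t := hst₂ ▸ hanti.antitoneOn ht' ht₂ ht.2
    have h3 : |s t| ^ r ≤ δ := by
      rw [← har]; exact Real.rpow_le_rpow (abs_nonneg _) (abs_le.2 ⟨h2, h1⟩) (by linarith)
    have h4 := hclair t ht'
    have h5 := one_le_profile r (s t)
    have h6 : profile r (s t) = 1 + |s t| ^ r := rfl
    have h7 : v t ^ 2 ≤ (2 * √δ) ^ 2 := by
      rw [mul_pow, Real.sq_sqrt hδ0.le]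
      have h8 : profile r (s t) * v t ^ 2 ≤ (profile r (s t) - |c|) * 2 := by
        have : (profile r (s t) * v t ^ 2) * profile r (s t) ≤
            ((profile r (s t) - |c|) * 2) * profile r (s t) := by nlinarith
        exact le_of_mul_le_mul_right this (by linarith)
      nlinarith [sq_nonneg (v t)]
    rw [Real.norm_eq_abs, abs_div, abs_of_pos (meridianSpeed_pos r _)]
    refine (div_le_self (abs_nonneg _) (one_le_meridianSpeed r _)).trans ?_
    exact abs_le_of_sq_le_sq h7 (by positivity)
  have hmvt := (convex_Icc t₁ t₂).norm_image_sub_le_of_norm_hasDerivWithin_le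
    (fun t ht => (h.deriv_s t (hsub ht)).hasDerivWithinAt) hspeed
    (left_mem_Icc.2 h12.le) (right_mem_Icc.2 h12.le)
  rw [hst₁, hst₂, Real.norm_eq_abs, Real.norm_eq_abs, abs_of_pos (sub_pos.2 h12),
    show -a - a = -(2 * a) by ring, abs_neg, abs_of_pos (by positivity)] at hmvt
  have hsq := Real.sqrt_pos.2 hδ0
  have hTge : a ≤ √δ * T := by nlinarith [ht₁.1, ht₂.2]
  have hexp : δ ^ (-(1 / 2 - 1 / r)) = a / √δ := by
    rw [ha, Real.sqrt_eq_rpow, ← Real.rpow_sub hδ0]; congr 1; ring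
  rw [hexp, div_le_iff₀ hsq]
  linarith

/-! ### Clairaut coordinates as functions on the unit tangent bundle -/

section Surface

variable {S : Type*} [TopologicalSpace S] [ChartedSpace E2 S] [IsManifold (𝓡 2) 4 S]

/-- The vectors based in the part `|s| < b` of the neck. -/
def NeckLt {g : Metric S} (r ε₁ : ℝ) (Φ : E2 → S) (b : ℝ) : Set (UnitTangent g) :=
  {x | ∃ p, HasClairaut g r ε₁ Φ x p ∧ |p 0| < b}

/-- The vectors based in the part `|s| ≤ b` of the neck. -/
def NeckLe {g : Metric S} (r ε₁ : ℝ) (Φ : E2 → S) (b : ℝ) : Set (UnitTangent g) :=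
  {x | ∃ p, HasClairaut g r ε₁ Φ x p ∧ |p 0| ≤ b}

/-- The vectors based in the neck. -/
def OverNeck {g : Metric S} (r ε₁ : ℝ) (Φ : E2 → S) (x : UnitTangent g) : Prop :=
  ∃ p, HasClairaut g r ε₁ Φ x p

/-- A choice of Clairaut coordinates, with value `0` off the neck. Only the functions of it that do
not depend on the choice are used: the first coordinate and the sine and cosine of the others. -/
def clairautCoord {g : Metric S} (r ε₁ : ℝ) (Φ : E2 → S) (x : UnitTangent g) : E3 :=
  open Classical in if h : ∃ p, HasClairaut g r ε₁ Φ x p then h.choose else 0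

/-- The coordinate `s` of a vector over the neck. -/
def neckS {g : Metric S} (r ε₁ : ℝ) (Φ : E2 → S) (x : UnitTangent g) : ℝ :=
  clairautCoord r ε₁ Φ x 0

/-- `sin ψ` for a vector over the neck. -/
def neckSin {g : Metric S} (r ε₁ : ℝ) (Φ : E2 → S) (x : UnitTangent g) : ℝ :=
  Real.sin (clairautCoord r ε₁ Φ x 2)

/-- `cos ψ` for a vector over the neck. -/
def neckCos {g : Metric S} (r ε₁ : ℝ) (Φ : E2 → S) (x : UnitTangent g) : ℝ :=
  Real.cos (clairautCoord r ε₁ Φ x 2)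

/-- `(cos θ, sin θ)`, as a complex number, for a vector over the neck. -/
def neckAngle {g : Metric S} (r ε₁ : ℝ) (Φ : E2 → S) (x : UnitTangent g) : ℂ :=
  Complex.exp (clairautCoord r ε₁ Φ x 1 * Complex.I)

/-- The Clairaut constant of a vector over the neck. -/
def neckC {g : Metric S} (r ε₁ : ℝ) (Φ : E2 → S) (x : UnitTangent g) : ℝ :=
  profile r (neckS r ε₁ Φ x) * neckCos r ε₁ Φ x

variable {g : Metric S} {r ε₁ : ℝ} {Φ : E2 → S}

theorem hasClairaut_clairautCoord {x : UnitTangent g} (hx : OverNeck r ε₁ Φ x) :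
    HasClairaut g r ε₁ Φ x (clairautCoord r ε₁ Φ x) := by
  have h : ∃ p, HasClairaut g r ε₁ Φ x p := hx
  unfold clairautCoord
  rw [dif_pos h]
  exact h.choose_spec

theorem IsNeck.neckS_eq (hN : IsNeck g r ε₁ Φ) {x : UnitTangent g} {p : E3}
    (h : HasClairaut g r ε₁ Φ x p) : neckS r ε₁ Φ x = p 0 :=
  (hN.clairaut_unique (hasClairaut_clairautCoord ⟨p, h⟩) h).1

theorem IsNeck.neckSin_eq (hN : IsNeck g r ε₁ Φ) {x : UnitTangent g} {p : E3}
    (h : HasClairaut g r ε₁ Φ x p) : neckSin r ε₁ Φ x = Real.sin (p 2) :=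
  (hN.clairaut_unique (hasClairaut_clairautCoord ⟨p, h⟩) h).2.2.1

theorem IsNeck.neckCos_eq (hN : IsNeck g r ε₁ Φ) {x : UnitTangent g} {p : E3}
    (h : HasClairaut g r ε₁ Φ x p) : neckCos r ε₁ Φ x = Real.cos (p 2) :=
  (hN.clairaut_unique (hasClairaut_clairautCoord ⟨p, h⟩) h).2.2.2

theorem IsNeck.neckAngle_eq (hN : IsNeck g r ε₁ Φ) {x : UnitTangent g} {p : E3}
    (h : HasClairaut g r ε₁ Φ x p) : neckAngle r ε₁ Φ x = Complex.exp (p 1 * Complex.I) := by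
  obtain ⟨k, hk⟩ := (hN.clairaut_unique (hasClairaut_clairautCoord ⟨p, h⟩) h).2.1
  unfold neckAngle
  rw [hk, Complex.exp_eq_exp_iff_exists_int]
  exact ⟨k, by push_cast; ring⟩

theorem IsNeck.neckC_eq (hN : IsNeck g r ε₁ Φ) {x : UnitTangent g} {p : E3}
    (h : HasClairaut g r ε₁ Φ x p) : neckC r ε₁ Φ x = clairaut r p := by
  unfold neckC clairaut; rw [hN.neckS_eq h, hN.neckCos_eq h]

theorem neckSin_sq_add_neckCos_sq (x : UnitTangent g) :
    neckSin r ε₁ Φ x ^ 2 + neckCos r ε₁ Φ x ^ 2 = 1 := Real.sin_sq_add_cos_sq _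

theorem neckC_sq (x : UnitTangent g) : profile r (neckS r ε₁ Φ x) ^ 2 *
    (1 - neckSin r ε₁ Φ x ^ 2) = neckC r ε₁ Φ x ^ 2 := by
  have := neckSin_sq_add_neckCos_sq (r := r) (ε₁ := ε₁) (Φ := Φ) x
  unfold neckC
  rw [mul_pow]
  linear_combination (profile r (neckS r ε₁ Φ x) ^ 2) * -this

theorem continuous_base : Continuous (fun x : UnitTangent g => x.1.proj) :=
  (FiberBundle.continuous_proj E2 _).comp continuous_subtype_val

theorem IsNeck.mem_neck_iff (hN : IsNeck g r ε₁ Φ) {x : UnitTangent g} (Q : ℝ → Prop) :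
    (∃ p, HasClairaut g r ε₁ Φ x p ∧ Q (p 0)) ↔
      x.1.proj ∈ Φ '' {u | |u 0| < ε₁ ∧ Q (u 0)} := by
  constructor
  · rintro ⟨p, hp, hQ⟩
    refine ⟨!₂[p 0, p 1], by simpa using ⟨hp.1, hQ⟩, ?_⟩
    rw [hp.2]; rfl
  · rintro ⟨u, ⟨hu, hQ⟩, hx⟩
    obtain ⟨ψ, hψ⟩ := hN.exists_hasClairaut hu hx.symm
    exact ⟨_, hψ, by simpa using hQ⟩

theorem IsNeck.isOpen_image (hN : IsNeck g r ε₁ Φ) {U : Set E2} (hU : IsOpen U)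
    (hsub : ∀ u ∈ U, |u 0| < ε₁) : IsOpen (Φ '' U) := by
  rw [isOpen_iff_mem_nhds]
  rintro _ ⟨u, hu, rfl⟩
  obtain ⟨e, -, hut, -, heq⟩ := hN.exists_chart (hsub u hu)
  have h1 : IsOpen (e.symm '' (e.target ∩ U)) :=
    e.symm.isOpen_image_of_subset_source (e.open_target.inter hU) inter_subset_left
  refine mem_of_superset (h1.mem_nhds ⟨u, ⟨hut, hu⟩, heq hut⟩) ?_
  rintro _ ⟨v, ⟨hv, hvU⟩, rfl⟩
  exact ⟨v, hvU, (heq hv).symm⟩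

theorem IsNeck.isOpen_neckLt (hN : IsNeck g r ε₁ Φ) (b : ℝ) :
    IsOpen (NeckLt r ε₁ Φ b : Set (UnitTangent g)) := by
  have h : (NeckLt r ε₁ Φ b : Set (UnitTangent g)) =
      (fun x => x.1.proj) ⁻¹' (Φ '' {u | |u 0| < ε₁ ∧ |u 0| < b}) := by
    ext x; exact hN.mem_neck_iff (fun s => |s| < b)
  rw [h]
  refine (hN.isOpen_image ?_ fun u hu => hu.1).preimage continuous_base
  exact (isOpen_strip ε₁).inter (isOpen_strip b)

theorem IsNeck.isClosed_neckLe [T2Space S] (hN : IsNeck g r ε₁ Φ) {b : ℝ} (hb : b < ε₁) :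
    IsClosed (NeckLe r ε₁ Φ b : Set (UnitTangent g)) := by
  set K : Set E2 := {u | |u 0| ≤ b ∧ u 1 ∈ Icc 0 (2 * Real.pi)} with hK
  have h : (NeckLe r ε₁ Φ b : Set (UnitTangent g)) = (fun x => x.1.proj) ⁻¹' (Φ '' K) := by
    ext x
    constructor
    · rintro ⟨p, hp, hpb⟩
      obtain ⟨q, hq, hq1, -, hq0, -⟩ := hN.exists_normalized hp
      refine ⟨!₂[q 0, q 1], ⟨by simpa [hq0] using hpb, by simpa using ⟨hq1.1, hq1.2.le⟩⟩, ?_⟩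
      change Φ _ = x.1.proj
      rw [hq.2]; rfl
    · rintro ⟨u, hu, hx⟩
      exact (hN.mem_neck_iff (fun s => |s| ≤ b)).2 ⟨u, ⟨hu.1.trans_lt hb, hu.1⟩, hx⟩
  rw [h]
  refine IsClosed.preimage continuous_base (IsCompact.isClosed (IsCompact.image_of_continuousOn ?_ ?_))
  · have : K = (EuclideanSpace.equiv (Fin 2) ℝ) ⁻¹' (Set.univ.pi fun i =>
        if i = 0 then Icc (-b) b else Icc 0 (2 * Real.pi)) := by
      ext u; simp [hK, Set.mem_pi, Fin.forall_fin_two, abs_le]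
    rw [this]
    refine (EuclideanSpace.equiv (Fin 2) ℝ).toHomeomorph.isCompact_preimage.2
      (isCompact_univ_pi fun i => ?_)
    split_ifs <;> exact isCompact_Icc
  · exact fun u hu => (hN.contMDiffAt (hu.1.trans_lt hb)).continuousAt.continuousWithinAt

theorem IsNeck.overNeck_iff (_hN : IsNeck g r ε₁ Φ) {x : UnitTangent g} :
    OverNeck r ε₁ Φ x ↔ x ∈ NeckLt r ε₁ Φ ε₁ :=
  ⟨fun ⟨p, hp⟩ => ⟨p, hp, hp.1⟩, fun ⟨p, hp, _⟩ => ⟨p, hp⟩⟩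

theorem IsNeck.mem_neckLt (hN : IsNeck g r ε₁ Φ) {x : UnitTangent g} {b : ℝ} :
    x ∈ NeckLt r ε₁ Φ b ↔ OverNeck r ε₁ Φ x ∧ |neckS r ε₁ Φ x| < b :=
  ⟨fun ⟨p, hp, hb⟩ => ⟨⟨p, hp⟩, by rwa [hN.neckS_eq hp]⟩,
    fun ⟨⟨p, hp⟩, hb⟩ => ⟨p, hp, by rwa [hN.neckS_eq hp] at hb⟩⟩

theorem IsNeck.mem_neckLe (hN : IsNeck g r ε₁ Φ) {x : UnitTangent g} {b : ℝ} :
    x ∈ NeckLe r ε₁ Φ b ↔ OverNeck r ε₁ Φ x ∧ |neckS r ε₁ Φ x| ≤ b :=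
  ⟨fun ⟨p, hp, hb⟩ => ⟨⟨p, hp⟩, by rwa [hN.neckS_eq hp]⟩,
    fun ⟨⟨p, hp⟩, hb⟩ => ⟨p, hp, by rwa [hN.neckS_eq hp] at hb⟩⟩

variable {φ : Flow ℝ (UnitTangent g)}

theorem flow_shift (φ : Flow ℝ (UnitTangent g)) (x : UnitTangent g) (t τ : ℝ) :
    φ (τ - t) (φ t x) = φ τ x := by
  rw [← φ.map_add]; congr 1; ring

theorem continuous_orbit (φ : Flow ℝ (UnitTangent g)) (x : UnitTangent g) :
    Continuous fun t => φ t x := φ.continuous continuous_id continuous_const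

/-- The equations of motion in the neck, for quantities that are well defined without a choice of
lifts of the angles. -/
theorem IsNeck.hasDerivAt_orbit (hr : 4 ≤ r) (hN : IsNeck g r ε₁ Φ) (hφ : IsGeodesicFlow g φ)
    {x : UnitTangent g} {t : ℝ} (hx : OverNeck r ε₁ Φ (φ t x)) :
    HasDerivAt (fun τ => neckS r ε₁ Φ (φ τ x)) (neckSin r ε₁ Φ (φ t x) /
      meridianSpeed r (neckS r ε₁ Φ (φ t x))) t ∧
    HasDerivAt (fun τ => neckSin r ε₁ Φ (φ τ x)) (deriv (profile r) (neckS r ε₁ Φ (φ t x)) *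
      (1 - neckSin r ε₁ Φ (φ t x) ^ 2) / (profile r (neckS r ε₁ Φ (φ t x)) *
        meridianSpeed r (neckS r ε₁ Φ (φ t x)))) t ∧
    HasDerivAt (fun τ => neckC r ε₁ Φ (φ τ x)) 0 t ∧
    HasDerivAt (fun τ => neckAngle r ε₁ Φ (φ τ x)) (neckAngle r ε₁ Φ (φ t x) *
      ((neckCos r ε₁ Φ (φ t x) / profile r (neckS r ε₁ Φ (φ t x)) : ℝ) * Complex.I)) t := by
  obtain ⟨p, hp⟩ := hx
  obtain ⟨P, hP0, hP⟩ := hN.exists_lift hr hφ hp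
  have h0 := hP.self_of_nhds
  have hflow : φ 0 (φ t x) = φ t x := φ.map_zero_apply _
  have shift : ∀ {E : Type} [NormedAddCommGroup E] [NormedSpace ℝ E] (f : UnitTangent g → E) (F : E3 → E) (f' : E),
      (∀ y q, HasClairaut g r ε₁ Φ y q → f y = F q) → HasDerivAt (fun h => F (P h)) f' 0 →
      HasDerivAt (fun τ => f (φ τ x)) f' t := by
    intro E _ _ f F f' hfF hF
    have h1 : HasDerivAt (fun h => f (φ h (φ t x))) f' (t - t) := by
      rw [sub_self]
      exact hF.congr_of_eventuallyEq (hP.mono fun h hh => hfF _ _ hh.1)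
    have h2 := h1.comp_sub_const t t
    simpa only [flow_shift] using h2
  obtain ⟨hcl, hs, hθ, hψ⟩ := h0
  rw [hflow] at hcl
  rw [hN.neckS_eq hcl, hN.neckSin_eq hcl, hN.neckCos_eq hcl, hN.neckAngle_eq hcl]
  have hρ := (meridianSpeed_pos r (P 0 0)).ne'
  have hξ := (profile_pos r (P 0 0)).ne'
  refine ⟨?_, ?_, ?_, ?_⟩
  · exact shift _ (fun q => q 0) _ (fun y q h => hN.neckS_eq h) hs
  · refine shift _ (fun q => Real.sin (q 2)) _ (fun y q h => hN.neckSin_eq h) ?_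
    refine hψ.sin.congr_deriv ?_
    rw [← Real.cos_sq']; ring
  · refine shift _ (clairaut r) _ (fun y q h => hN.neckC_eq h) ?_
    have h1 := ((hasDerivAt_profile hr (P 0 0)).comp (0 : ℝ) hs).mul hψ.cos
    refine h1.congr_deriv ?_
    rw [deriv_profile hr]
    simp only [Function.comp_apply]
    field_simp
    ring
  · refine shift _ (fun q => Complex.exp (q 1 * Complex.I)) _ (fun y q h => hN.neckAngle_eq h) ?_
    exact (hθ.ofReal_comp.mul_const Complex.I).cexp

end Surface

/-! ### Orbits entering and leaving the neck -/

section Surface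

variable {S : Type*} [TopologicalSpace S] [ChartedSpace E2 S] [IsManifold (𝓡 2) 4 S]
variable {g : Metric S} {r ε₁ : ℝ} {Φ : E2 → S} {φ : Flow ℝ (UnitTangent g)}

theorem abs_neckSin_div_le (x y : UnitTangent g) :
    |neckSin r ε₁ Φ x / meridianSpeed r (neckS r ε₁ Φ y)| ≤ 1 := by
  rw [abs_div, abs_of_pos (meridianSpeed_pos r _)]
  exact (div_le_self (abs_nonneg _) (one_le_meridianSpeed r _)).trans (Real.abs_sin_le_one _)

/-- An orbit, followed forward (`κ = 1`) or backward (`κ = -1`), moves in the `s`-direction with at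
most unit speed, hence it stays over the neck for some time. -/
theorem IsNeck.persistence_aux [T2Space S] (hr : 4 ≤ r) (hN : IsNeck g r ε₁ Φ)
    (hφ : IsGeodesicFlow g φ) {x : UnitTangent g} (hx : OverNeck r ε₁ Φ x) {κ T : ℝ}
    (hκ : |κ| = 1) (hT : |neckS r ε₁ Φ x| + T < ε₁) {u : ℝ} (hu : u ∈ Icc 0 T) :
    OverNeck r ε₁ Φ (φ (κ * u) x) ∧ |neckS r ε₁ Φ (φ (κ * u) x) - neckS r ε₁ Φ x| ≤ u := by
  have hcont : Continuous fun u => φ (κ * u) x :=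
    (continuous_orbit φ x).comp (continuous_const.mul continuous_id)
  have hflow0 : φ (κ * 0) x = x := by rw [mul_zero]; exact φ.map_zero_apply x
  have bound : ∀ v, 0 ≤ v → (∀ w ∈ Icc 0 v, OverNeck r ε₁ Φ (φ (κ * w) x)) →
      |neckS r ε₁ Φ (φ (κ * v) x) - neckS r ε₁ Φ x| ≤ v := by
    intro v hv h
    have hd : ∀ w ∈ Icc 0 v, HasDerivWithinAt (fun w => neckS r ε₁ Φ (φ (κ * w) x))
        (neckSin r ε₁ Φ (φ (κ * w) x) / meridianSpeed r (neckS r ε₁ Φ (φ (κ * w) x)) * κ)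
        (Icc 0 v) w := by
      intro w hw
      have h1 := (hN.hasDerivAt_orbit hr hφ (h w hw)).1
      have h2 : HasDerivAt (fun w : ℝ => κ * w) κ w := by
        simpa using (hasDerivAt_id w).const_mul κ
      exact (h1.comp w h2).hasDerivWithinAt
    have := (convex_Icc 0 v).norm_image_sub_le_of_norm_hasDerivWithin_le hd (C := 1)
      (fun w hw => by
        rw [norm_mul, Real.norm_eq_abs, Real.norm_eq_abs, hκ, mul_one]
        exact abs_neckSin_div_le _ _)
      (left_mem_Icc.2 hv) (right_mem_Icc.2 hv)
    simpa [φ.map_zero_apply, abs_of_nonneg hv] using this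
  -- at the first time `m` at which the orbit is not over the neck, it would be a limit of vectors in a
  -- closed part of the neck
  have all : ∀ w ∈ Icc 0 T, OverNeck r ε₁ Φ (φ (κ * w) x) := by
    by_contra! hbad
    obtain ⟨w, hw, hwb⟩ := hbad
    set B : Set ℝ := Icc 0 T ∩ (fun u => φ (κ * u) x) ⁻¹' (NeckLt r ε₁ Φ ε₁)ᶜ with hB
    have hBc : IsCompact B := isCompact_Icc.inter_right
      ((hN.isOpen_neckLt ε₁).isClosed_compl.preimage hcont)
    obtain ⟨m, ⟨hm, hmb⟩, hmin⟩ := hBc.exists_isLeast ⟨w, hw, fun h => hwb (hN.overNeck_iff.2 h)⟩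
    have hgood : ∀ v ∈ Icc 0 T, v < m → OverNeck r ε₁ Φ (φ (κ * v) x) := by
      intro v hv hvm
      by_contra hc
      exact absurd (hmin ⟨hv, fun h => hc (hN.overNeck_iff.2 h)⟩) (not_le.2 hvm)
    have hm0 : 0 < m := by
      rcases hm.1.eq_or_lt with h0 | h0
      · exfalso; apply hmb
        rw [← hN.overNeck_iff, ← h0]; simpa only [hflow0] using hx
      · exact h0
    have hcl : φ (κ * m) x ∈ NeckLe r ε₁ Φ (|neckS r ε₁ Φ x| + T) := by
      have hlim : Tendsto (fun v => φ (κ * v) x) (𝓝[<] m) (𝓝 (φ (κ * m) x)) :=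
        (hcont.tendsto m).mono_left nhdsWithin_le_nhds
      refine (hN.isClosed_neckLe hT).mem_of_tendsto hlim ?_
      filter_upwards [Ioo_mem_nhdsLT hm0] with v hv
      have hv' : v ∈ Icc 0 T := ⟨hv.1.le, hv.2.le.trans hm.2⟩
      refine hN.mem_neckLe.2 ⟨hgood v hv' hv.2, ?_⟩
      have h1 := bound v hv.1.le fun w hw => hgood w ⟨hw.1, hw.2.trans hv'.2⟩ (hw.2.trans_lt hv.2)
      have h2 := abs_sub_abs_le_abs_sub (neckS r ε₁ Φ (φ (κ * v) x)) (neckS r ε₁ Φ x)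
      linarith [hv'.2]
    exact hmb (hN.overNeck_iff.1 (hN.mem_neckLe.1 hcl).1)
  exact ⟨all u hu, bound u hu.1 fun w hw => all w ⟨hw.1, hw.2.trans hu.2⟩⟩

theorem IsNeck.persistence [T2Space S] (hr : 4 ≤ r) (hN : IsNeck g r ε₁ Φ)
    (hφ : IsGeodesicFlow g φ) {x : UnitTangent g} (hx : OverNeck r ε₁ Φ x) {t : ℝ}
    (ht : |neckS r ε₁ Φ x| + |t| < ε₁) :
    OverNeck r ε₁ Φ (φ t x) ∧ |neckS r ε₁ Φ (φ t x) - neckS r ε₁ Φ x| ≤ |t| := by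
  rcases le_total 0 t with h | h
  · have := hN.persistence_aux hr hφ hx (κ := 1) (by simp) ht (right_mem_Icc.2 (abs_nonneg t))
    rwa [show 1 * |t| = t by rw [abs_of_nonneg h, one_mul]] at this
  · have := hN.persistence_aux hr hφ hx (κ := -1) (by simp) ht (right_mem_Icc.2 (abs_nonneg t))
    rwa [show -1 * |t| = t by rw [abs_of_nonpos h]; ring] at this

/-- The Clairaut constant is constant on orbit segments over the neck. -/
theorem IsNeck.neckC_const (hr : 4 ≤ r) (hN : IsNeck g r ε₁ Φ) (hφ : IsGeodesicFlow g φ)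
    {x : UnitTangent g} {a b : ℝ} (h : ∀ t ∈ Icc a b, OverNeck r ε₁ Φ (φ t x)) {t u : ℝ}
    (ht : t ∈ Icc a b) (hu : u ∈ Icc a b) :
    neckC r ε₁ Φ (φ t x) = neckC r ε₁ Φ (φ u x) := by
  have := (convex_Icc a b).norm_image_sub_le_of_norm_hasDerivWithin_le (C := 0)
    (fun w hw => (hN.hasDerivAt_orbit hr hφ (h w hw)).2.2.1.hasDerivWithinAt) (by simp) hu ht
  rw [zero_mul, norm_le_zero_iff, sub_eq_zero] at this
  exact this

theorem IsNeck.isNeckOrbit (hr : 4 ≤ r) (hN : IsNeck g r ε₁ Φ) (hφ : IsGeodesicFlow g φ)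
    {x : UnitTangent g} {ε₀ T : ℝ} (hT : 0 ≤ T) (h : ∀ t ∈ Icc 0 T, φ t x ∈ NeckLe r ε₁ Φ ε₀) :
    IsNeckOrbit r ε₀ (neckC r ε₁ Φ x) T (fun t => neckS r ε₁ Φ (φ t x))
      (fun t => neckSin r ε₁ Φ (φ t x)) where
  deriv_s t ht := (hN.hasDerivAt_orbit hr hφ (hN.mem_neckLe.1 (h t ht)).1).1
  deriv_v t ht := (hN.hasDerivAt_orbit hr hφ (hN.mem_neckLe.1 (h t ht)).1).2.1
  clairaut t ht := by
    rw [neckC_sq, hN.neckC_const hr hφ (fun t ht => (hN.mem_neckLe.1 (h t ht)).1) ht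
      (left_mem_Icc.2 hT), φ.map_zero_apply]
  abs_le t ht := (hN.mem_neckLe.1 (h t ht)).2

theorem IsNeck.mem_omegaPlus (hN : IsNeck g r ε₁ Φ) {x : UnitTangent g} {ε₀ χ : ℝ} :
    x ∈ OmegaPlus g r ε₁ Φ ε₀ χ ↔ OverNeck r ε₁ Φ x ∧ |neckS r ε₁ Φ x| = ε₀ ∧
      neckS r ε₁ Φ x * neckSin r ε₁ Φ x < 0 ∧ |(|neckC r ε₁ Φ x| - 1)| < χ := by
  constructor
  · rintro ⟨p, hp, h1, h2, h3⟩
    rw [hN.neckS_eq hp, hN.neckSin_eq hp, hN.neckC_eq hp]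
    exact ⟨⟨p, hp⟩, h1, h2, h3⟩
  · rintro ⟨⟨p, hp⟩, h⟩
    rw [hN.neckS_eq hp, hN.neckSin_eq hp, hN.neckC_eq hp] at h
    exact ⟨p, hp, h⟩

theorem IsNeck.mem_omegaMinus (hN : IsNeck g r ε₁ Φ) {x : UnitTangent g} {ε₀ χ : ℝ} :
    x ∈ OmegaMinus g r ε₁ Φ ε₀ χ ↔ OverNeck r ε₁ Φ x ∧ |neckS r ε₁ Φ x| = ε₀ ∧
      0 < neckS r ε₁ Φ x * neckSin r ε₁ Φ x ∧ |(|neckC r ε₁ Φ x| - 1)| < χ := by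
  constructor
  · rintro ⟨p, hp, h1, h2, h3⟩
    rw [hN.neckS_eq hp, hN.neckSin_eq hp, hN.neckC_eq hp]
    exact ⟨⟨p, hp⟩, h1, h2, h3⟩
  · rintro ⟨⟨p, hp⟩, h⟩
    rw [hN.neckS_eq hp, hN.neckSin_eq hp, hN.neckC_eq hp] at h
    exact ⟨p, hp, h⟩

/-- The smallness conditions on `χ`: within flow time `4χ` of `|s| = ε₀` the orbits stay in
`ε₀/2 ≤ |s| < ε₁`, where vectors with `||c| - 1| < χ` are transverse to the parallels. -/
structure SmallScale (r ε₀ ε₁ χ : ℝ) : Prop where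
  four_le : 4 ≤ r
  chi_pos : 0 < χ
  chi_le_half : χ ≤ 1 / 2
  chi_le : 8 * χ ≤ ε₀
  chi_le' : ε₀ + 8 * χ ≤ ε₁
  le_profile : 1 + χ ≤ profile r (ε₀ / 2)

variable {ε₀ χ : ℝ}

theorem profile_mono (hr : 4 ≤ r) {a b : ℝ} (h : |a| ≤ |b|) : profile r a ≤ profile r b := by
  unfold profile
  have := Real.rpow_le_rpow (abs_nonneg a) h (show 0 ≤ r by linarith)
  linarith

theorem SmallScale.neckSin_ne_zero (hχ : SmallScale r ε₀ ε₁ χ) {x : UnitTangent g}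
    (hs : ε₀ / 2 ≤ |neckS r ε₁ Φ x|) (hc : |neckC r ε₁ Φ x| < 1 + χ) :
    neckSin r ε₁ Φ x ≠ 0 := by
  intro h0
  have h1 := neckC_sq (r := r) (ε₁ := ε₁) (Φ := Φ) x
  rw [h0] at h1
  have h2 : profile r (ε₀ / 2) ≤ profile r (neckS r ε₁ Φ x) := by
    refine profile_mono hχ.four_le ?_
    rwa [abs_of_pos (by linarith [hχ.chi_pos, hχ.chi_le] : 0 < ε₀ / 2)]
  have h3 := hχ.le_profile
  have h4 : |neckC r ε₁ Φ x| = profile r (neckS r ε₁ Φ x) := by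
    rw [← abs_of_pos (profile_pos r (neckS r ε₁ Φ x)), ← sq_eq_sq_iff_abs_eq_abs, ← h1]; ring
  linarith

/-- Vectors at `|s| = ε₀` with Clairaut constant close to `±1` keep the signs of `s` and `sin ψ`
during the time interval `[-4χ, 4χ]`. -/
theorem IsNeck.near_omega [T2Space S] (hN : IsNeck g r ε₁ Φ)
    (hφ : IsGeodesicFlow g φ) (hχ : SmallScale r ε₀ ε₁ χ) {y : UnitTangent g}
    (hy : OverNeck r ε₁ Φ y) (hys : |neckS r ε₁ Φ y| = ε₀) (hyc : |(|neckC r ε₁ Φ y| - 1)| < χ)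
    {t : ℝ} (ht : t ∈ Icc (-(4 * χ)) (4 * χ)) :
    OverNeck r ε₁ Φ (φ t y) ∧ |neckS r ε₁ Φ (φ t y) - neckS r ε₁ Φ y| ≤ |t| ∧
      0 < neckS r ε₁ Φ (φ t y) * neckS r ε₁ Φ y ∧
      0 < neckSin r ε₁ Φ (φ t y) * neckSin r ε₁ Φ y ∧
      neckC r ε₁ Φ (φ t y) = neckC r ε₁ Φ y := by
  have hχ0 := hχ.chi_pos
  have hε0 : 0 < ε₀ := by linarith [hχ.chi_le]
  have h00 : (0 : ℝ) ∈ Icc (-(4 * χ)) (4 * χ) := ⟨by linarith, by linarith⟩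
  have hf0 : φ 0 y = y := φ.map_zero_apply y
  have hpers : ∀ u ∈ Icc (-(4 * χ)) (4 * χ), OverNeck r ε₁ Φ (φ u y) ∧
      |neckS r ε₁ Φ (φ u y) - neckS r ε₁ Φ y| ≤ |u| := by
    intro u hu
    refine hN.persistence hχ.four_le hφ hy ?_
    have := abs_le.2 hu
    rw [hys]; linarith [hχ.chi_le']
  have hc : ∀ u ∈ Icc (-(4 * χ)) (4 * χ), neckC r ε₁ Φ (φ u y) = neckC r ε₁ Φ y := by
    intro u hu
    rw [hN.neckC_const hχ.four_le hφ (fun u hu => (hpers u hu).1) hu h00, hf0]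
  have habs : ∀ u ∈ Icc (-(4 * χ)) (4 * χ), ε₀ / 2 ≤ |neckS r ε₁ Φ (φ u y)| := by
    intro u hu
    have h1 := (hpers u hu).2
    have h2 := abs_sub_abs_le_abs_sub (neckS r ε₁ Φ y) (neckS r ε₁ Φ (φ u y))
    rw [abs_sub_comm] at h2
    linarith [abs_le.2 hu, hχ.chi_le]
  have hne : ∀ u ∈ Icc (-(4 * χ)) (4 * χ), neckSin r ε₁ Φ (φ u y) ≠ 0 := by
    intro u hu
    refine hχ.neckSin_ne_zero (habs u hu) ?_
    rw [hc u hu]; linarith [(abs_lt.1 hyc).2]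
  have hs : 0 < neckS r ε₁ Φ (φ t y) * neckS r ε₁ Φ y := by
    rcases sign_const (f := fun u => neckS r ε₁ Φ (φ u y)) (fun u hu =>
      (hN.hasDerivAt_orbit hχ.four_le hφ (hpers u hu).1).1.continuousAt.continuousWithinAt)
      (fun u hu h => by have := habs u hu; rw [h, abs_zero] at this; linarith) with h | h
    · have := h 0 h00
      rw [hf0] at this; exact mul_pos (h t ht) this
    · have := h 0 h00
      rw [hf0] at this; exact mul_pos_of_neg_of_neg (h t ht) this
  have hv : 0 < neckSin r ε₁ Φ (φ t y) * neckSin r ε₁ Φ y := by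
    rcases sign_const (f := fun u => neckSin r ε₁ Φ (φ u y)) (fun u hu =>
      (hN.hasDerivAt_orbit hχ.four_le hφ (hpers u hu).1).2.1.continuousAt.continuousWithinAt)
      hne with h | h
    · have := h 0 h00
      rw [hf0] at this; exact mul_pos (h t ht) this
    · have := h 0 h00
      rw [hf0] at this; exact mul_pos_of_neg_of_neg (h t ht) this
  exact ⟨(hpers t ht).1, (hpers t ht).2, hs, hv, hc t ht⟩

/-- Around time `0`, the orbit of a vector in `Ω₊` crosses `|s| = ε₀` once, inward. -/
theorem IsNeck.near_omegaPlus [T2Space S] (hN : IsNeck g r ε₁ Φ)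
    (hφ : IsGeodesicFlow g φ) (hχ : SmallScale r ε₀ ε₁ χ) {y : UnitTangent g}
    (hy : y ∈ OmegaPlus g r ε₁ Φ ε₀ χ) {t : ℝ} (ht : t ∈ Icc (-(4 * χ)) (4 * χ)) :
    (t < 0 → ε₀ < |neckS r ε₁ Φ (φ t y)|) ∧ (0 < t → |neckS r ε₁ Φ (φ t y)| < ε₀) := by
  obtain ⟨hy, hys, hyv, hyc⟩ := hN.mem_omegaPlus.1 hy
  have hχ0 := hχ.chi_pos
  have hε0 : 0 < ε₀ := by linarith [hχ.chi_le]
  have h00 : (0 : ℝ) ∈ Icc (-(4 * χ)) (4 * χ) := ⟨by linarith, by linarith⟩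
  have hd : ∀ u ∈ Icc (-(4 * χ)) (4 * χ), HasDerivAt
      (fun u => neckS r ε₁ Φ (φ u y) * neckS r ε₁ Φ y) _ u := fun u hu =>
    (hN.hasDerivAt_orbit hχ.four_le hφ (hN.near_omega hφ hχ hy hys hyc hu).1).1.mul_const _
  have hanti : StrictAntiOn (fun u => neckS r ε₁ Φ (φ u y) * neckS r ε₁ Φ y)
      (Icc (-(4 * χ)) (4 * χ)) := by
    refine strictAntiOn_of_deriv_neg (convex_Icc _ _)
      (fun u hu => (hd u hu).continuousAt.continuousWithinAt) fun u hu => ?_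
    have hu := interior_subset hu
    rw [(hd u hu).deriv, div_mul_eq_mul_div]
    refine div_neg_of_neg_of_pos ?_ (meridianSpeed_pos r _)
    have h1 := (hN.near_omega hφ hχ hy hys hyc hu).2.2.2.1
    by_contra! h2
    have h3 := mul_nonneg h2 h1.le
    have h4 : 0 < neckSin r ε₁ Φ (φ u y) ^ 2 := by
      have : neckSin r ε₁ Φ (φ u y) ≠ 0 := left_ne_zero_of_mul h1.ne'
      positivity
    nlinarith
  have habs : |neckS r ε₁ Φ (φ t y)| * ε₀ = neckS r ε₁ Φ (φ t y) * neckS r ε₁ Φ y := by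
    rw [← hys, ← abs_mul, abs_of_pos (hN.near_omega hφ hχ hy hys hyc ht).2.2.1]
  have h0 : neckS r ε₁ Φ (φ 0 y) * neckS r ε₁ Φ y = ε₀ * ε₀ := by
    rw [φ.map_zero_apply, ← hys, ← sq, ← sq, sq_abs]
  constructor
  · intro h
    have := hanti ht h00 h
    simp only [h0] at this
    nlinarith
  · intro h
    have := hanti h00 ht h
    simp only [h0] at this
    nlinarith

end Surface

theorem exists_transit_le {r : ℝ} (hr : 4 ≤ r) (ε₀ : ℝ) : ∃ C : ℝ, 0 < C ∧
    ∀ c T s v, IsNeckOrbit r ε₀ c T s v → 0 ≤ T → |c| ≠ 1 →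
      T ≤ C * |(|c| - 1)| ^ (-(1 / 2 - 1 / r)) := by
  obtain ⟨C₁, hC₁, h₁⟩ := exists_transit_le_of_lt_one hr ε₀
  obtain ⟨C₂, hC₂, h₂⟩ := exists_transit_le_of_one_lt hr ε₀
  refine ⟨max C₁ C₂, lt_max_of_lt_left hC₁, fun c T s v h hT hc => ?_⟩
  have hpos : 0 ≤ |(|c| - 1)| ^ (-(1 / 2 - 1 / r)) := Real.rpow_nonneg (abs_nonneg _) _
  rcases lt_or_gt_of_ne hc with hc | hc
  · refine le_trans ?_ (mul_le_mul_of_nonneg_right (le_max_left _ _) hpos)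
    rw [abs_of_neg (by linarith), neg_sub]
    exact h₁ c T s v h hT hc
  · refine le_trans ?_ (mul_le_mul_of_nonneg_right (le_max_right _ _) hpos)
    rw [abs_of_pos (by linarith)]
    exact h₂ c T s v h hT hc

section Surface

variable {S : Type*} [TopologicalSpace S] [ChartedSpace E2 S] [IsManifold (𝓡 2) 4 S]
variable {g : Metric S} {r ε₀ ε₁ χ : ℝ} {Φ : E2 → S} {φ : Flow ℝ (UnitTangent g)}

/-- Orbits that enter the neck with `|c| ≠ 1` leave it through `Ω₋`. -/
theorem IsNeck.exists_exit [T2Space S] (hN : IsNeck g r ε₁ Φ)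
    (hφ : IsGeodesicFlow g φ) (hχ : SmallScale r ε₀ ε₁ χ) {y : UnitTangent g}
    (hy : y ∈ OmegaPlus g r ε₁ Φ ε₀ χ) (hc1 : |neckC r ε₁ Φ y| ≠ 1) :
    ∃ T, 4 * χ < T ∧ φ T y ∈ OmegaMinus g r ε₁ Φ ε₀ χ ∧
      (∀ t ∈ Ioo 0 T, φ t y ∈ NeckLt r ε₁ Φ ε₀) ∧ ∀ t ∈ Icc 0 T, φ t y ∈ NeckLe r ε₁ Φ ε₀ := by
  have hy' := hy
  obtain ⟨hyn, hys, hyv, hyc⟩ := hN.mem_omegaPlus.1 hy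
  have hχ0 := hχ.chi_pos
  have hε0 : 0 < ε₀ := by linarith [hχ.chi_le]
  have hε1 : ε₀ < ε₁ := by linarith [hχ.chi_le']
  have hcont := continuous_orbit φ y
  have hf0 : φ 0 y = y := φ.map_zero_apply y
  have hclosed := hN.isClosed_neckLe hε1
  have hopen : IsOpen (NeckLt r ε₁ Φ ε₀ : Set (UnitTangent g)) := hN.isOpen_neckLt ε₀
  have hearly : ∀ t ∈ Ioc 0 (4 * χ), φ t y ∈ NeckLt r ε₁ Φ ε₀ := by
    intro t ht
    have ht' : t ∈ Icc (-(4 * χ)) (4 * χ) := ⟨by linarith [ht.1], ht.2⟩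
    exact hN.mem_neckLt.2 ⟨(hN.near_omega hφ hχ hyn hys hyc ht').1,
      (hN.near_omegaPlus hφ hχ hy ht').2 ht.1⟩
  have hle : ∀ T, (∀ t ∈ Ioo 0 T, φ t y ∈ NeckLt r ε₁ Φ ε₀) → 0 < T →
      ∀ t ∈ Icc 0 T, φ t y ∈ NeckLe r ε₁ Φ ε₀ := by
    intro T h hT t ht
    have : t ∈ closure (Ioo 0 T) := by rwa [closure_Ioo hT.ne]
    refine hclosed.closure_subset_iff.2 ?_
      (map_mem_closure (f := fun t => φ t y) hcont this h)
    exact fun x ⟨p, hp, hb⟩ => ⟨p, hp, hb.le⟩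
  obtain ⟨C, -, hC⟩ := exists_transit_le hχ.four_le ε₀
  set B : Set ℝ := Ici (4 * χ) ∩ (fun t => φ t y) ⁻¹' (NeckLt r ε₁ Φ ε₀)ᶜ with hB
  have hBcl : IsClosed B := isClosed_Ici.inter (hopen.isClosed_compl.preimage hcont)
  -- an orbit that stayed in the neck forever would violate the bound for the crossing time
  have hBne : B.Nonempty := by
    by_contra hemp
    rw [Set.not_nonempty_iff_eq_empty] at hemp
    have hall : ∀ t, 0 < t → φ t y ∈ NeckLt r ε₁ Φ ε₀ := by
      intro t ht
      rcases le_total t (4 * χ) with h | h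
      · exact hearly t ⟨ht, h⟩
      · by_contra hcon
        have : t ∈ B := ⟨h, hcon⟩
        rw [hemp] at this; exact this
    set T := |C * |(|neckC r ε₁ Φ y| - 1)| ^ (-(1 / 2 - 1 / r))| + 1 with hT
    have hT0 : 0 < T := by positivity
    have h1 := hC _ T _ _ (hN.isNeckOrbit hχ.four_le hφ hT0.le
      (hle T (fun t ht => hall t ht.1) hT0)) hT0.le hc1
    linarith [le_abs_self (C * |(|neckC r ε₁ Φ y| - 1)| ^ (-(1 / 2 - 1 / r)))]
  have hBbdd : BddBelow B := ⟨4 * χ, fun t ht => ht.1⟩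
  have hTB : sInf B ∈ B := hBcl.csInf_mem hBne hBbdd
  set T := sInf B with hTdef
  obtain ⟨hT1, hT2⟩ := hTB
  have hT4 : 4 * χ < T := by
    rcases (show 4 * χ ≤ T from hT1).eq_or_lt with h | h
    · exact absurd (hearly T ⟨by linarith, h.ge⟩) hT2
    · exact h
  have hT0 : 0 < T := by linarith
  have hin : ∀ t ∈ Ioo 0 T, φ t y ∈ NeckLt r ε₁ Φ ε₀ := by
    intro t ht
    rcases le_total t (4 * χ) with h | h
    · exact hearly t ⟨ht.1, h⟩
    · by_contra hcon
      exact absurd (csInf_le hBbdd (show t ∈ B from ⟨h, hcon⟩)) (not_le.2 ht.2)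
  have hinle := hle T hin hT0
  refine ⟨T, hT4, ?_, hin, hinle⟩
  have hTT : T ∈ Icc 0 T := right_mem_Icc.2 hT0.le
  obtain ⟨hTn, hTs⟩ := hN.mem_neckLe.1 (hinle T hTT)
  have hTs' : |neckS r ε₁ Φ (φ T y)| = ε₀ := by
    refine le_antisymm hTs ?_
    by_contra! h
    exact hT2 (hN.mem_neckLt.2 ⟨hTn, h⟩)
  have hTc : neckC r ε₁ Φ (φ T y) = neckC r ε₁ Φ y := by
    rw [hN.neckC_const hχ.four_le hφ (fun t ht => (hN.mem_neckLe.1 (hinle t ht)).1) hTT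
      (left_mem_Icc.2 hT0.le), hf0]
  have hyc' := hyc
  rw [← hTc] at hyc'
  refine hN.mem_omegaMinus.2 ⟨hTn, hTs', ?_, hyc'⟩
  have hvne : neckSin r ε₁ Φ (φ T y) ≠ 0 :=
    hχ.neckSin_ne_zero (by rw [hTs']; linarith) (by linarith [(abs_lt.1 hyc').2])
  have hsne : neckS r ε₁ Φ (φ T y) ≠ 0 := by
    intro h; rw [h, abs_zero] at hTs'; linarith
  by_contra! hneg
  -- otherwise the vector at time `T` would be in `Ω₊`, and the orbit outside just before
  have hplus : φ T y ∈ OmegaPlus g r ε₁ Φ ε₀ χ :=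
    hN.mem_omegaPlus.2 ⟨hTn, hTs', lt_of_le_of_ne hneg (mul_ne_zero hsne hvne), hyc'⟩
  have h1 := (hN.near_omegaPlus hφ hχ hplus (t := -χ) ⟨by linarith, by linarith⟩).1 (by linarith)
  rw [← φ.map_add] at h1
  have h2 := (hN.mem_neckLt.1 (hin (-χ + T) ⟨by linarith, by linarith⟩)).2
  linarith

end Surface

/-! ### Return times to the section -/

/-- Triples of Clairaut coordinates with `|s| ≤ b` and angles in one closed period. -/
def clairautBox (b : ℝ) : Set E3 :=
  {p | |p 0| ≤ b ∧ p 1 ∈ Icc 0 (2 * Real.pi) ∧ p 2 ∈ Icc 0 (2 * Real.pi)}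

theorem isCompact_clairautBox (b : ℝ) : IsCompact (clairautBox b) := by
  have : clairautBox b = (EuclideanSpace.equiv (Fin 3) ℝ) ⁻¹' (Set.univ.pi fun i =>
      if i = 0 then Icc (-b) b else Icc 0 (2 * Real.pi)) := by
    ext u
    simp [clairautBox, Set.mem_pi, Fin.forall_fin_succ, abs_le]
  rw [this]
  refine (EuclideanSpace.equiv (Fin 3) ℝ).toHomeomorph.isCompact_preimage.2
    (isCompact_univ_pi fun i => ?_)
  split_ifs <;> exact isCompact_Icc

theorem contDiff_clairaut {r : ℝ} (hr : 4 ≤ r) : ContDiff ℝ 1 (clairaut r) := by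
  have hc : ∀ i : Fin 3, ContDiff ℝ 1 (fun p : E3 => p i) := fun i =>
    (EuclideanSpace.proj i : E3 →L[ℝ] ℝ).contDiff
  exact ((contDiff_profile hr).comp (hc 0)).mul (Real.contDiff_cos.comp (hc 2))

section Surface

variable {S : Type*} [TopologicalSpace S] [ChartedSpace E2 S] [IsManifold (𝓡 2) 4 S]
variable {g : Metric S} {r ε₀ ε₁ χ : ℝ} {Φ : E2 → S} {φ : Flow ℝ (UnitTangent g)}
variable {Sec : Set (UnitTangent g)}

/-- If the hitting time of a closed set is positive, it is attained. -/
theorem flow_hitTime_mem {A : Set (UnitTangent g)} (hA : IsClosed A) {x : UnitTangent g}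
    (hne : ∃ t : ℝ, 0 < t ∧ φ t x ∈ A) : φ (hitTime φ A x) x ∈ A := by
  have hb : BddBelow {t : ℝ | 0 < t ∧ φ t x ∈ A} := ⟨0, fun t ht => ht.1.le⟩
  have h1 : hitTime φ A x ∈ closure {t : ℝ | 0 < t ∧ φ t x ∈ A} := csInf_mem_closure hne hb
  have h2 := map_mem_closure (f := fun t => φ t x) (t := A) (continuous_orbit φ x) h1
    (fun t ht => ht.2)
  rwa [hA.closure_eq] at h2

theorem hitTime_nonneg (A : Set (UnitTangent g)) (x : UnitTangent g) : 0 ≤ hitTime φ A x :=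
  Real.sInf_nonneg fun _ ht => ht.1.le

theorem hitTime_le {A : Set (UnitTangent g)} {x : UnitTangent g} {t : ℝ} (ht : 0 < t)
    (hx : φ t x ∈ A) : hitTime φ A x ≤ t :=
  csInf_le ⟨0, fun _ ht => ht.1.le⟩ ⟨ht, hx⟩

/-- No orbit is within flow time `χ` of both `Ω₊` and `Ω₋`. -/
theorem IsNeck.flowTube_disjoint [T2Space S] (hN : IsNeck g r ε₁ Φ)
    (hφ : IsGeodesicFlow g φ) (hχ : SmallScale r ε₀ ε₁ χ) {x : UnitTangent g}
    (h₁ : x ∈ flowTube φ χ (OmegaPlus g r ε₁ Φ ε₀ χ))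
    (h₂ : x ∈ flowTube φ χ (OmegaMinus g r ε₁ Φ ε₀ χ)) : False := by
  obtain ⟨a, ha, y, hy, rfl⟩ := h₁
  obtain ⟨u, hu, z, hz, hyz⟩ := h₂
  have hχ0 := hχ.chi_pos
  have hz' : φ (a - u) y = z := by
    have : φ (-u) (φ a y) = φ (-u) (φ u z) := by rw [hyz]
    rwa [← φ.map_add, ← φ.map_add, neg_add_cancel, φ.map_zero_apply, neg_add_eq_sub] at this
  have hau : a - u ∈ Icc (-(4 * χ)) (4 * χ) :=
    ⟨by linarith [ha.1, hu.2], by linarith [ha.2, hu.1]⟩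
  have h := hN.near_omegaPlus hφ hχ hy hau
  rw [hz'] at h
  obtain ⟨-, hzs, hzv, -⟩ := hN.mem_omegaMinus.1 hz
  rcases lt_trichotomy (a - u) 0 with h0 | h0 | h0
  · linarith [h.1 h0]
  · rw [h0, φ.map_zero_apply] at hz'
    rw [hz'] at hy
    linarith [(hN.mem_omegaPlus.1 hy).2.2.1]
  · linarith [h.2 h0]

theorem IsNeck.hitTime_pos [T2Space S] (hN : IsNeck g r ε₁ Φ)
    (hφ : IsGeodesicFlow g φ) (hχ : SmallScale r ε₀ ε₁ χ) {n₀ : ℕ} {x : UnitTangent g}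
    (hx : x ∈ SigmaPlus g r ε₁ Φ φ ε₀ χ Sec n₀) : 0 < hitTime φ Sec x := by
  obtain ⟨-, hx2, -, -, hx5⟩ := hx
  refine (hitTime_nonneg Sec x).lt_of_ne fun h => ?_
  unfold returnMap at hx5
  rw [← h, φ.map_zero_apply] at hx5
  exact hN.flowTube_disjoint hφ hχ hx2 hx5

/-- On `Σ₊`, the transition time is the return time to the section. -/
theorem IsNeck.transitionTime_eq [T2Space S] (hN : IsNeck g r ε₁ Φ)
    (hφ : IsGeodesicFlow g φ) (hχ : SmallScale r ε₀ ε₁ χ)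
    (hSec : IsClosed Sec) {n₀ : ℕ} {x : UnitTangent g}
    (hx : x ∈ SigmaPlus g r ε₁ Φ φ ε₀ χ Sec n₀) :
    transitionTime g r ε₁ Φ φ ε₀ χ Sec n₀ x = hitTime φ Sec x := by
  have hsub : SigmaMinus g r ε₁ Φ φ ε₀ χ Sec n₀ ⊆ Sec := by
    rintro _ ⟨y, hy, rfl⟩
    exact flow_hitTime_mem hSec hy.2.2.2.1
  have hpos := hN.hitTime_pos hφ hχ hx
  have hmem : φ (hitTime φ Sec x) x ∈ SigmaMinus g r ε₁ Φ φ ε₀ χ Sec n₀ := ⟨x, hx, rfl⟩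
  refine le_antisymm (hitTime_le hpos hmem) ?_
  refine le_csInf ⟨_, hpos, hmem⟩ fun t ht => hitTime_le ht.1 (hsub ht.2)

/-- Vectors near `Ω₊` are over the neck, off the waist, and have the Clairaut constant of the
corresponding vector of `Ω₊`. -/
theorem IsNeck.flowTube_omegaPlus [T2Space S] (hN : IsNeck g r ε₁ Φ)
    (hφ : IsGeodesicFlow g φ) (hχ : SmallScale r ε₀ ε₁ χ) {y : UnitTangent g}
    (hy : y ∈ OmegaPlus g r ε₁ Φ ε₀ χ) {a : ℝ} (ha : a ∈ Icc (-χ) χ) :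
    OverNeck r ε₁ Φ (φ a y) ∧ |(|neckS r ε₁ Φ (φ a y)| - ε₀)| ≤ χ ∧
      neckC r ε₁ Φ (φ a y) = neckC r ε₁ Φ y := by
  obtain ⟨hyn, hys, hyv, hyc⟩ := hN.mem_omegaPlus.1 hy
  have hχ0 := hχ.chi_pos
  obtain ⟨h1, h2, -, -, h3⟩ := hN.near_omega hφ hχ hyn hys hyc
    (t := a) ⟨by linarith [ha.1], by linarith [ha.2]⟩
  refine ⟨h1, ?_, h3⟩
  rw [← hys]
  exact (abs_abs_sub_abs_le _ _).trans (h2.trans (abs_le.2 ha))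

/-- An upper bound for the return time: the orbit leaves the neck after a time bounded in terms of
its Clairaut constant, and then soon meets the section. -/
theorem IsNeck.hitTime_le_of_mem [T2Space S] (hN : IsNeck g r ε₁ Φ)
    (hφ : IsGeodesicFlow g φ) (hχ : SmallScale r ε₀ ε₁ χ)
    (hSec : IsNeckSection g r ε₁ Φ φ ε₀ χ Sec) {C : ℝ}
    (hC : ∀ c T s v, IsNeckOrbit r ε₀ c T s v → 0 ≤ T → |c| ≠ 1 →
      T ≤ C * |(|c| - 1)| ^ (-(1 / 2 - 1 / r)))
    {x : UnitTangent g} (hx : x ∈ flowTube φ χ (OmegaPlus g r ε₁ Φ ε₀ χ))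
    (hc : |neckC r ε₁ Φ x| ≠ 1) :
    hitTime φ Sec x ≤ C * |(|neckC r ε₁ Φ x| - 1)| ^ (-(1 / 2 - 1 / r)) + 2 * χ := by
  obtain ⟨a, ha, y, hy, rfl⟩ := hx
  rw [(hN.flowTube_omegaPlus hφ hχ hy ha).2.2] at hc ⊢
  have hχ0 := hχ.chi_pos
  obtain ⟨T, hT, hTm, -, hTin⟩ := hN.exists_exit hφ hχ hy hc
  have hT0 : 0 ≤ T := by linarith
  have h1 := hC _ _ _ _ (hN.isNeckOrbit hχ.four_le hφ hT0 hTin) hT0 hc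
  obtain ⟨b, hb, hbS⟩ := hSec.covers _ (Or.inr hTm)
  have h2 : φ (b + T - a) (φ a y) = φ b (φ T y) := by
    rw [← φ.map_add, ← φ.map_add]; congr 1; ring
  rw [← h2] at hbS
  have h3 := hitTime_le (by linarith [hb.1, ha.2]) hbS
  linarith [hb.2, ha.1]

/-- All vectors of `Ω₊` with Clairaut constant close enough to `±1` lie in a given neighbourhood
of the asymptotic vectors. -/
theorem IsNeck.exists_asymptotic_nhd (hN : IsNeck g r ε₁ Φ)
    (hχ : SmallScale r ε₀ ε₁ χ) {N : Set (UnitTangent g)}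
    (hNn : ∀ x ∈ OmegaPlusAsymptotic g r ε₁ Φ ε₀ χ, N ∈ 𝓝[OmegaPlus g r ε₁ Φ ε₀ χ] x) :
    ∃ δ : ℝ, 0 < δ ∧ ∀ y ∈ OmegaPlus g r ε₁ Φ ε₀ χ, |(|neckC r ε₁ Φ y| - 1)| < δ → y ∈ N := by
  have hχ0 := hχ.chi_pos
  have hε0 : 0 < ε₀ := by linarith [hχ.chi_le]
  have hε1 : ε₀ < ε₁ := by linarith [hχ.chi_le']
  obtain ⟨V, hV, hVeq⟩ := isOpen_induced_iff.1
    (isOpen_interior (s := {y | y ∈ OmegaPlus g r ε₁ Φ ε₀ χ → y ∈ N}))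
  have hVsub : ∀ y : UnitTangent g, y.1 ∈ V → y ∈ OmegaPlus g r ε₁ Φ ε₀ χ → y ∈ N := by
    intro y hy
    have : y ∈ interior {y | y ∈ OmegaPlus g r ε₁ Φ ε₀ χ → y ∈ N} := by rw [← hVeq]; exact hy
    exact interior_subset this
  have hasV : ∀ y ∈ OmegaPlusAsymptotic g r ε₁ Φ ε₀ χ, y.1 ∈ V := by
    intro y hy
    have : y ∈ interior {y | y ∈ OmegaPlus g r ε₁ Φ ε₀ χ → y ∈ N} :=
      mem_interior_iff_mem_nhds.2 (mem_nhdsWithin_iff_eventually.1 (hNn y hy))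
    rw [← hVeq] at this; exact this
  have hcl : Continuous (clairaut r) := (contDiff_clairaut hχ.four_le).continuous
  -- vectors entering at `|s| = ε₀`, in coordinates; the strict conditions in `Ω₊` are relaxed to make
  -- this set compact, and `δ` is the minimum of `||c| - 1|` on its part outside the neighbourhood
  set R : Set E3 := clairautBox ε₀ ∩ {p | |p 0| = ε₀ ∧ p 0 * Real.sin (p 2) ≤ 0 ∧
    |(|clairaut r p| - 1)| ≤ χ / 2} with hR
  have hRc : IsCompact R := by
    refine (isCompact_clairautBox ε₀).inter_right ?_
    refine (isClosed_eq (f := fun p : E3 => |p 0|) (by fun_prop) continuous_const).inter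
      ((isClosed_le (f := fun p : E3 => p 0 * Real.sin (p 2)) (by fun_prop) continuous_const).inter
        (isClosed_le (f := fun p : E3 => |(|clairaut r p| - 1)|)
          ((hcl.abs).sub continuous_const).abs continuous_const))
  have hcv : ContinuousOn (clairautVec r Φ) R := fun p hp =>
    (hN.contMDiffAt_clairautVec hχ.four_le (hp.1.1.trans_lt hε1)).continuousAt.continuousWithinAt
  have hKc : IsCompact (R ∩ clairautVec r Φ ⁻¹' Vᶜ) :=
    hRc.of_isClosed_subset (hcv.preimage_isClosed_of_isClosed hRc.isClosed hV.isClosed_compl)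
      inter_subset_left
  have hpos : ∀ p ∈ R ∩ clairautVec r Φ ⁻¹' Vᶜ, 0 < |(|clairaut r p| - 1)| := by
    rintro p ⟨⟨hpb, hp0, hps, hpc⟩, hpV⟩
    refine (abs_nonneg _).lt_of_ne fun h => hpV ?_
    have h1 : |clairaut r p| = 1 := by
      have := abs_eq_zero.1 h.symm; linarith
    have hp1 : |p 0| < ε₁ := by rw [hp0]; exact hε1
    set x : UnitTangent g := ⟨clairautVec r Φ p, hN.inner_clairautVec hp1⟩ with hx
    have hxp : HasClairaut g r ε₁ Φ x p := ⟨hp1, rfl⟩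
    refine hasV x ⟨⟨p, hxp, hp0, lt_of_le_of_ne hps fun h0 => ?_, by rw [← h]; exact hχ0⟩, p, hxp, h1⟩
    have hsn := hχ.neckSin_ne_zero (x := x) (ε₁ := ε₁) (Φ := Φ)
      (by rw [hN.neckS_eq hxp, hp0]; linarith) (by rw [hN.neckC_eq hxp, h1]; linarith)
    rw [hN.neckSin_eq hxp] at hsn
    rcases mul_eq_zero.1 h0 with h2 | h2
    · rw [h2, abs_zero] at hp0; linarith
    · exact hsn h2
  obtain ⟨δ, hδ, hδK⟩ : ∃ δ : ℝ, 0 < δ ∧ ∀ p ∈ R ∩ clairautVec r Φ ⁻¹' Vᶜ,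
      δ ≤ |(|clairaut r p| - 1)| := by
    rcases (R ∩ clairautVec r Φ ⁻¹' Vᶜ).eq_empty_or_nonempty with he | hne
    · exact ⟨1, one_pos, by rw [he]; exact fun p hp => hp.elim⟩
    · obtain ⟨p, hp, hmin⟩ := hKc.exists_isMinOn hne
        (((hcl.abs).sub continuous_const).abs.continuousOn
          (f := fun p : E3 => |(|clairaut r p| - 1)|))
      exact ⟨_, hpos p hp, fun q hq => hmin hq⟩
  refine ⟨min δ (χ / 2), lt_min hδ (by linarith), fun y hy hyc => hVsub y ?_ hy⟩
  obtain ⟨hyn, hys, hyv, -⟩ := hN.mem_omegaPlus.1 hy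
  obtain ⟨p, hp⟩ := hyn
  obtain ⟨q, hq, hq1, hq2, -⟩ := hN.exists_normalized hp
  rw [hN.neckS_eq hq] at hys hyv
  rw [hN.neckSin_eq hq] at hyv
  rw [hN.neckC_eq hq] at hyc
  rw [hq.2]
  by_contra hcon
  have := hδK q ⟨⟨⟨hys.le, ⟨hq1.1, hq1.2.le⟩, ⟨hq2.1, hq2.2.le⟩⟩, hys, hyv.le,
    (hyc.le.trans (min_le_right _ _))⟩, hcon⟩
  linarith [min_le_left δ (χ / 2)]

/-- For a crossing of the neck with entrance `y` and crossing time `T`, the last visit to the section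
near the entrance is a point of the section whose return to it happens near the exit, not before
time `T - 2χ`. -/
theorem IsNeck.exists_last_hit [T2Space S] (hN : IsNeck g r ε₁ Φ)
    (hφ : IsGeodesicFlow g φ) (hχ : SmallScale r ε₀ ε₁ χ)
    (hSec : IsNeckSection g r ε₁ Φ φ ε₀ χ Sec) :
    ∃ δ : ℝ, 0 < δ ∧ ∀ y ∈ OmegaPlus g r ε₁ Φ ε₀ χ, |(|neckC r ε₁ Φ y| - 1)| < δ →
      |neckC r ε₁ Φ y| ≠ 1 → ∃ T, 0 < T ∧ φ T y ∈ OmegaMinus g r ε₁ Φ ε₀ χ ∧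
        (∀ t ∈ Icc 0 T, φ t y ∈ NeckLe r ε₁ Φ ε₀) ∧
        ∃ a ∈ Icc (-χ) χ, φ a y ∈ Sec ∧ (∃ t : ℝ, 0 < t ∧ φ t (φ a y) ∈ Sec) ∧
          returnMap φ Sec (φ a y) ∈ flowTube φ χ (OmegaMinus g r ε₁ Φ ε₀ χ) ∧
          T - 2 * χ ≤ hitTime φ Sec (φ a y) := by
  obtain ⟨N, -, hNsub, hNn, hNa⟩ := hSec.avoids
  obtain ⟨δ, hδ, hδN⟩ := hN.exists_asymptotic_nhd hχ hNn
  refine ⟨δ, hδ, fun y hy hyδ hy1 => ?_⟩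
  have hyN := hδN y hy hyδ
  obtain ⟨T, hT, hTm, hTlt, hTle⟩ := hN.exists_exit hφ hχ hy hy1
  have hχ0 := hχ.chi_pos
  refine ⟨T, by linarith, hTm, hTle, ?_⟩
  have hcont := continuous_orbit φ y
  have hclosed : IsClosed ((fun t => φ t y) ⁻¹' Sec) := hSec.compact.isClosed.preimage hcont
  obtain ⟨a, ⟨ha, haS⟩, hamax⟩ := (isCompact_Icc.inter_right hclosed).exists_isGreatest
    (s := Icc (-χ) χ ∩ (fun t => φ t y) ⁻¹' Sec) (by
      obtain ⟨t, ht, htS⟩ := hSec.covers y (Or.inl hy)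
      exact ⟨t, ht, htS⟩)
  obtain ⟨b, ⟨hb, hbS⟩, hbmin⟩ := (isCompact_Icc.inter_right hclosed).exists_isLeast
    (s := Icc (T - χ) (T + χ) ∩ (fun t => φ t y) ⁻¹' Sec) (by
      obtain ⟨t, ht, htS⟩ := hSec.covers _ (Or.inr hTm)
      rw [← φ.map_add] at htS
      exact ⟨t + T, ⟨by linarith [ht.1], by linarith [ht.2]⟩, htS⟩)
  have hnotΩ : ∀ u ∈ Ioo 0 T, ∀ z, z ∈ OmegaPlus g r ε₁ Φ ε₀ χ ∪ OmegaMinus g r ε₁ Φ ε₀ χ →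
      φ u y ≠ z := by
    rintro u hu z hz rfl
    have h1 := (hN.mem_neckLt.1 (hTlt u hu)).2
    rcases hz with hz | hz
    · linarith [(hN.mem_omegaPlus.1 hz).2.1]
    · linarith [(hN.mem_omegaMinus.1 hz).2.1]
  -- between `a` and `b` a visit to the section would have to be close to `Ω₊ ∪ Ω₋`, that is, to one of
  -- the ends of the crossing, where `a` and `b` are extremal
  have hgap : ∀ t, a < t → t < b → φ t y ∉ Sec := by
    intro t hat htb htS
    rcases le_or_gt t χ with h1 | h1
    · exact absurd (hamax ⟨⟨by linarith [ha.1], h1⟩, htS⟩) (not_le.2 hat)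
    rcases le_or_gt (T - χ) t with h2 | h2
    · exact absurd (hbmin ⟨⟨h2, by linarith [hb.2]⟩, htS⟩) (not_le.2 htb)
    obtain ⟨u, hu, z, hz, hzt⟩ := hNa y hyN t (by linarith)
      (fun u hu hm => hnotΩ u ⟨hu.1, by linarith [hu.2]⟩ _ (Or.inr hm) rfl) htS
    refine hnotΩ (t - u) ⟨by linarith [hu.2], by linarith [hu.1]⟩ z hz ?_
    have : φ (-u) (φ t y) = φ (-u) (φ u z) := by rw [hzt]
    rwa [← φ.map_add, ← φ.map_add, neg_add_cancel, φ.map_zero_apply, neg_add_eq_sub] at this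
  have hab : 0 < b - a := by linarith [ha.2, hb.1]
  have hflow : ∀ t, φ t (φ a y) = φ (t + a) y := fun t => by rw [← φ.map_add]
  have hbS' : φ (b - a) (φ a y) ∈ Sec := by rw [hflow, sub_add_cancel]; exact hbS
  have hhit : hitTime φ Sec (φ a y) = b - a := by
    refine le_antisymm (hitTime_le hab hbS') (le_csInf ⟨_, hab, hbS'⟩ fun t ht => ?_)
    by_contra! hlt
    refine hgap (t + a) (by linarith [ht.1]) (by linarith) ?_
    rw [← hflow]; exact ht.2
  refine ⟨a, ha, haS, ⟨b - a, hab, hbS'⟩, ?_, ?_⟩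
  · unfold returnMap
    rw [hhit, hflow, sub_add_cancel]
    refine ⟨b - T, ⟨by linarith [hb.1], by linarith [hb.2]⟩, φ T y, hTm, ?_⟩
    rw [← φ.map_add, sub_add_cancel]
  · rw [hhit]; linarith [ha.2, hb.1]

end Surface

/-! ### Upper bound for the measure of the section -/

/-- If a planar map is antilipschitz on a set, the two-dimensional measure of the set is controlled by
the area of the image. -/
theorem hausdorffMeasure_le_of_antilipschitz {f : E3 → ℝ × ℝ} {A : Set E3} {K : NNReal}
    (h : ∀ a ∈ A, ∀ b ∈ A, edist a b ≤ K * edist (f a) (f b)) :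
    μH[2] A ≤ (K : ℝ≥0∞) ^ (2 : ℝ) * volume (f '' A) := by
  rcases A.eq_empty_or_nonempty with rfl | hne
  · simp
  have : Nonempty E3 := ⟨0⟩
  have hinj : InjOn f A := fun a ha b hb hab => by
    have := h a ha b hb
    rw [hab, edist_self, mul_zero, nonpos_iff_eq_zero, edist_eq_zero] at this
    exact this
  have hL : LipschitzOnWith K (Function.invFunOn f A) (f '' A) := by
    rintro _ ⟨a, ha, rfl⟩ _ ⟨b, hb, rfl⟩
    rw [hinj.leftInvOn_invFunOn ha, hinj.leftInvOn_invFunOn hb]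
    exact h a ha b hb
  have h1 := hL.hausdorffMeasure_image_le (d := 2) (by norm_num)
  rwa [hinj.leftInvOn_invFunOn.image_image, hausdorffMeasure_prod_real] at h1

/-- Two linearly independent functionals on a three-dimensional space are completed to a coordinate
system by a third. Independence is expressed by a vector `V` on which only one of them vanishes. -/
theorem exists_third_functional {L ℓ : E3 →L[ℝ] ℝ} {V : E3} (hℓV : ℓ V = 0) (hLV : L V ≠ 0)
    (hℓ : ℓ ≠ 0) : ∃ m : E3 →L[ℝ] ℝ, ∃ e : E3 ≃L[ℝ] ℝ × ℝ × ℝ,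
      (e : E3 →L[ℝ] ℝ × ℝ × ℝ) = L.prod (ℓ.prod m) := by
  obtain ⟨W, hW⟩ : ∃ W, ℓ W ≠ 0 := by
    by_contra! h; exact hℓ (ContinuousLinearMap.ext h)
  set A : E3 →ₗ[ℝ] ℝ × ℝ := ((L.prod ℓ : E3 →L[ℝ] ℝ × ℝ) : E3 →ₗ[ℝ] ℝ × ℝ) with hA
  have hsurj : Function.Surjective A := by
    rintro ⟨x, y⟩
    refine ⟨(y / ℓ W) • W + ((x - y / ℓ W * L W) / L V) • V, ?_⟩
    simp [hA, hℓV]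
    constructor
    · field_simp
      ring
    · field_simp
  have hker : Module.finrank ℝ (LinearMap.ker A) = 1 := by
    have h1 := A.finrank_range_add_finrank_ker
    rw [LinearMap.range_eq_top.2 hsurj, finrank_top] at h1
    simp at h1
    omega
  obtain ⟨⟨k, hk⟩, hk0, hkspan⟩ := finrank_eq_one_iff'.1 hker
  set B : E3 →L[ℝ] ℝ × ℝ × ℝ := L.prod (ℓ.prod (innerSL ℝ k)) with hB
  have hinj : Function.Injective (B : E3 →ₗ[ℝ] ℝ × ℝ × ℝ) := by
    rw [← LinearMap.ker_eq_bot, LinearMap.ker_eq_bot']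
    intro z hz
    have hz1 : L z = 0 := congrArg Prod.fst hz
    have hz2 : ℓ z = 0 := congrArg (fun q : ℝ × ℝ × ℝ => q.2.1) hz
    have hz3 : inner ℝ k z = 0 := congrArg (fun q : ℝ × ℝ × ℝ => q.2.2) hz
    have hzk : z ∈ LinearMap.ker A := by
      rw [LinearMap.mem_ker]; exact Prod.ext hz1 hz2
    obtain ⟨c, hc⟩ := hkspan ⟨z, hzk⟩
    have hcz : c • k = z := congrArg Subtype.val hc
    have hkk : k ≠ 0 := fun h => hk0 (Subtype.ext h)
    rw [← hcz, inner_smul_right, real_inner_self_eq_norm_sq] at hz3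
    rcases mul_eq_zero.1 hz3 with h | h
    · rw [← hcz, h, zero_smul]
    · exact absurd (by simpa using h) hkk
  refine ⟨innerSL ℝ k, (LinearEquiv.ofInjectiveOfFinrankEq (B : E3 →ₗ[ℝ] ℝ × ℝ × ℝ) hinj
    (by simp)).toContinuousLinearEquiv, ?_⟩
  ext z <;> rfl

/-- If the differentials of `F` and `c` at `p₀` are independent, then near `p₀` the part of the surface
`F = 0` where `|c|` is `δ`-close to `1` has measure `O(δ)`. In coordinates `(F, c, m)` it lies in the
union of two rectangles in the plane `F = 0`, of width `2δ` in the direction of `c`. -/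
theorem exists_local_measure_le {F c : E3 → ℝ} {L ℓ : E3 →L[ℝ] ℝ} {p₀ V : E3}
    (hF : HasStrictFDerivAt F L p₀) (hc : HasStrictFDerivAt c ℓ p₀) (hℓV : ℓ V = 0)
    (hLV : L V ≠ 0) (hℓ : ℓ ≠ 0) : ∃ U ∈ 𝓝 p₀, ∃ K : ℝ, 0 ≤ K ∧ ∀ δ : ℝ, 0 ≤ δ →
      μH[2] {p | p ∈ U ∧ F p = 0 ∧ |(|c p| - 1)| ≤ δ} ≤ ENNReal.ofReal (K * δ) := by
  obtain ⟨m, e, he⟩ := exists_third_functional hℓV hLV hℓ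
  have hΨ : HasStrictFDerivAt (fun p => (F p, c p, m p)) (e : E3 →L[ℝ] ℝ × ℝ × ℝ) p₀ := by
    rw [he]; exact hF.prodMk (hc.prodMk m.hasStrictFDerivAt)
  set N : NNReal := ‖(e.symm : ℝ × ℝ × ℝ →L[ℝ] E3)‖₊ with hN
  have hN0 : 0 < N := by
    rcases e.subsingleton_or_nnnorm_symm_pos with h | h
    · exfalso
      have : (EuclideanSpace.single 0 1 : E3) = 0 := h.elim _ _
      simpa using congrArg (fun v : E3 => v 0) this
    · exact h
  have hhalf : N⁻¹ / 2 < N⁻¹ := NNReal.half_lt_self (inv_ne_zero hN0.ne')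
  obtain ⟨s, hs, happ⟩ := hΨ.approximates_deriv_on_nhds (c := N⁻¹ / 2)
    (Or.inr (half_pos (inv_pos.2 hN0)))
  have hanti := happ.antilipschitz (Or.inr hhalf)
  set K : NNReal := (N⁻¹ - N⁻¹ / 2)⁻¹ with hK
  set M : ℝ := ‖m‖ with hM
  refine ⟨s ∩ Metric.ball p₀ 1, inter_mem hs (Metric.ball_mem_nhds _ one_pos),
    (K : ℝ) ^ 2 * (8 * M), by positivity, fun δ hδ => ?_⟩
  set A : Set E3 := {p | p ∈ s ∩ Metric.ball p₀ 1 ∧ F p = 0 ∧ |(|c p| - 1)| ≤ δ} with hA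
  have h1 : μH[2] A ≤ (K : ℝ≥0∞) ^ (2 : ℝ) * volume ((fun p => (c p, m p)) '' A) := by
    refine hausdorffMeasure_le_of_antilipschitz fun a ha b hb => ?_
    have h2 := hanti ⟨a, ha.1.1⟩ ⟨b, hb.1.1⟩
    simp only [Set.domRestrict_apply, Subtype.edist_mk_mk] at h2
    refine h2.trans (le_of_eq ?_)
    rw [Prod.edist_eq, ha.2.1, hb.2.1, edist_self]
    simp
  have h3 : (fun p => (c p, m p)) '' A ⊆
      (Icc (1 - δ) (1 + δ) ∪ Icc (-1 - δ) (-1 + δ)) ×ˢ Icc (m p₀ - M) (m p₀ + M) := by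
    rintro _ ⟨p, hp, rfl⟩
    refine ⟨?_, ?_⟩
    · have := abs_le.1 hp.2.2
      rcases abs_choice (c p) with h | h <;> rw [h] at this
      · left; constructor <;> linarith [this.1, this.2]
      · right; constructor <;> linarith [this.1, this.2]
    · have h4 : |m p - m p₀| ≤ M := by
        rw [← map_sub, ← Real.norm_eq_abs]
        refine (m.le_opNorm _).trans ?_
        have : ‖p - p₀‖ ≤ 1 := by rw [← dist_eq_norm]; exact (Metric.mem_ball.1 hp.1.2).le
        nlinarith [norm_nonneg m]
      have := abs_le.1 h4
      constructor <;> linarith [this.1, this.2]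
  have h5 : volume ((fun p => (c p, m p)) '' A) ≤ ENNReal.ofReal (4 * δ) * ENNReal.ofReal (2 * M) := by
    refine (measure_mono h3).trans ?_
    rw [Measure.volume_eq_prod, Measure.prod_prod, Real.volume_Icc]
    refine mul_le_mul' ((measure_union_le _ _).trans ?_) (le_of_eq (by congr 1; ring))
    rw [Real.volume_Icc, Real.volume_Icc, ← ENNReal.ofReal_add (by linarith) (by linarith)]
    exact le_of_eq (by congr 1; ring)
  refine (h1.trans (mul_le_mul_right h5 _)).trans (le_of_eq ?_)
  rw [← ENNReal.ofReal_mul (by positivity), ← ENNReal.ofReal_coe_nnreal,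
    ENNReal.ofReal_rpow_of_nonneg (by positivity) (by norm_num), ← ENNReal.ofReal_mul (by positivity)]
  congr 1
  rw [show (2 : ℝ) = (2 : ℕ) by norm_num, Real.rpow_natCast]
  push_cast
  ring

section Surface

variable {S : Type*} [TopologicalSpace S] [ChartedSpace E2 S] [IsManifold (𝓡 2) 4 S]
variable {g : Metric S} {r ε₀ ε₁ χ : ℝ} {Φ : E2 → S} {φ : Flow ℝ (UnitTangent g)}
variable {Sec : Set (UnitTangent g)}

theorem fderiv_clairaut_ne_zero (hr : 4 ≤ r) {p : E3} (hp : p 0 ≠ 0) :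
    fderiv ℝ (clairaut r) p ≠ 0 := by
  intro h
  have hd : HasFDerivAt (clairaut r) (0 : E3 →L[ℝ] ℝ) p := by
    rw [← h]; exact ((contDiff_clairaut hr).differentiable (by norm_num) p).hasFDerivAt
  have hline : ∀ i : Fin 3, HasDerivAt (fun t : ℝ => p + t • (EuclideanSpace.single i (1 : ℝ) : E3))
      (EuclideanSpace.single i 1) 0 := fun i => by
    simpa using ((hasDerivAt_id (0 : ℝ)).smul_const (EuclideanSpace.single i (1 : ℝ) : E3)).const_add p
  have hz : ∀ i : Fin 3, HasDerivAt (fun t : ℝ =>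
      clairaut r (p + t • (EuclideanSpace.single i (1 : ℝ) : E3))) 0 0 := fun i => by
    have hd' : HasFDerivAt (clairaut r) (0 : E3 →L[ℝ] ℝ)
        (p + (0 : ℝ) • (EuclideanSpace.single i (1 : ℝ) : E3)) := by simpa using hd
    exact hd'.comp_hasDerivAt (0 : ℝ) (hline i)
  have e0 : HasDerivAt (fun t : ℝ => clairaut r (p + t • (EuclideanSpace.single 0 (1 : ℝ) : E3)))
      (deriv (profile r) (p 0) * Real.cos (p 2)) 0 := by
    have h1 : HasDerivAt (fun t : ℝ => p 0 + t) 1 0 := (hasDerivAt_id (0 : ℝ)).const_add _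
    have h2 : HasDerivAt (profile r) (deriv (profile r) (p 0)) (p 0 + 0) := by
      rw [add_zero, deriv_profile hr]; exact hasDerivAt_profile hr (p 0)
    refine ((h2.comp (0 : ℝ) h1).mul_const (Real.cos (p 2))).congr_of_eventuallyEq
      (Eventually.of_forall fun t => ?_) |>.congr_deriv (by ring)
    simp [clairaut]
  have e2 : HasDerivAt (fun t : ℝ => clairaut r (p + t • (EuclideanSpace.single 2 (1 : ℝ) : E3)))
      (profile r (p 0) * -Real.sin (p 2)) 0 := by
    have h1 : HasDerivAt (fun t : ℝ => p 2 + t) 1 0 := (hasDerivAt_id (0 : ℝ)).const_add _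
    have h2 := (h1.cos.const_mul (profile r (p 0)))
    refine (h2.congr_of_eventuallyEq (Eventually.of_forall fun t => ?_)).congr_deriv (by simp)
    simp [clairaut]
  have h0 := e0.unique (hz 0)
  have h2 := e2.unique (hz 2)
  have hsin : Real.sin (p 2) = 0 := by
    rcases mul_eq_zero.1 h2 with h | h
    · exact absurd h (profile_pos r _).ne'
    · linarith
  have hcos : Real.cos (p 2) ≠ 0 := fun h => by
    have := Real.sin_sq_add_cos_sq (p 2)
    rw [hsin, h] at this; norm_num at this
  rw [deriv_profile hr] at h0
  have h3 : 0 < |p 0| ^ (r - 2) := Real.rpow_pos_of_pos (abs_pos.2 hp) _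
  rcases mul_eq_zero.1 h0 with h | h
  · exact mul_ne_zero (mul_ne_zero (by linarith) h3.ne') hp h
  · exact hcos h

/-- Near a point off the waist, the section lies in a surface `F = 0` on which the Clairaut function
has no critical points: its differential does not vanish, but vanishes on the flow direction `V`,
on which the differential of `F` does not. -/
theorem IsNeck.exists_local_section_measure_le (hr : 4 ≤ r) (hN : IsNeck g r ε₁ Φ)
    (hφ : IsGeodesicFlow g φ) {x₀ : UnitTangent g}
    {F : TangentBundle (𝓡 2) S → ℝ} (hF : ContMDiffAt (𝓡 2).tangent 𝓘(ℝ, ℝ) 1 F x₀.1)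
    (hFS : ∀ᶠ y in 𝓝 x₀, y ∈ Sec → F y.1 = 0)
    (hFt : deriv (fun t : ℝ => F (φ t x₀).1) 0 ≠ 0) {p₀ : E3}
    (hp₀ : HasClairaut g r ε₁ Φ x₀ p₀) (hp00 : p₀ 0 ≠ 0) :
    ∃ U ∈ 𝓝 p₀, ∃ K : ℝ, 0 ≤ K ∧ ∀ δ : ℝ, 0 ≤ δ →
      μH[2] {p | p ∈ U ∧ clairautVec r Φ p ∈ Subtype.val '' Sec ∧ |(|clairaut r p| - 1)| ≤ δ} ≤
        ENNReal.ofReal (K * δ) := by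
  have hcv := hN.contMDiffAt_clairautVec hr hp₀.1
  set G : E3 → ℝ := fun p => F (clairautVec r Φ p) with hG
  have hGd : HasStrictFDerivAt G (fderiv ℝ G p₀) p₀ := by
    have h1 : ContMDiffAt (𝓡 3) 𝓘(ℝ, ℝ) 1 G p₀ := by
      rw [hp₀.2] at hF
      exact hF.comp p₀ hcv
    exact (contMDiffAt_iff_contDiffAt.1 h1).hasStrictFDerivAt (by norm_num)
  have hcd : HasStrictFDerivAt (clairaut r) (fderiv ℝ (clairaut r) p₀) p₀ :=
    (contDiff_clairaut hr).contDiffAt.hasStrictFDerivAt (by norm_num)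
  obtain ⟨P, hP0, hP⟩ := hN.exists_lift hr hφ hp₀
  obtain ⟨-, h0, h1, h2⟩ := hP.self_of_nhds
  obtain ⟨V, hV⟩ : ∃ V : E3, HasDerivAt P V 0 := by
    refine ⟨deriv P 0, DifferentiableAt.hasDerivAt ?_⟩
    rw [differentiableAt_euclidean]
    intro i; fin_cases i
    exacts [h0.differentiableAt, h1.differentiableAt, h2.differentiableAt]
  have hℓV : fderiv ℝ (clairaut r) p₀ V = 0 := by
    have h3 : HasDerivAt (fun t => clairaut r (P t)) (fderiv ℝ (clairaut r) p₀ V) 0 := by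
      have h4 : HasFDerivAt (clairaut r) (fderiv ℝ (clairaut r) p₀) (P 0) := by
        rw [hP0]; exact hcd.hasFDerivAt
      exact h4.comp_hasDerivAt 0 hV
    have h5 : HasDerivAt (fun t => clairaut r (P t)) 0 0 := by
      have h6 : OverNeck r ε₁ Φ (φ 0 x₀) := ⟨_, hP.self_of_nhds.1⟩
      refine (hN.hasDerivAt_orbit hr hφ h6).2.2.1.congr_of_eventuallyEq ?_
      exact hP.mono fun t ht => (hN.neckC_eq ht.1).symm
    exact h3.unique h5
  have hLV : fderiv ℝ G p₀ V ≠ 0 := by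
    have h3 : HasDerivAt (fun t => G (P t)) (fderiv ℝ G p₀ V) 0 := by
      have h4 : HasFDerivAt G (fderiv ℝ G p₀) (P 0) := by
        rw [hP0]; exact hGd.hasFDerivAt
      exact h4.comp_hasDerivAt 0 hV
    have h5 : (fun t : ℝ => F (φ t x₀).1) =ᶠ[𝓝 0] fun t => G (P t) :=
      hP.mono fun t ht => by rw [hG]; simp only [ht.1.2]
    rw [h5.deriv_eq, h3.deriv] at hFt
    exact hFt
  obtain ⟨U, hU, K, hK, hUK⟩ := exists_local_measure_le hGd hcd hℓV hLV
    (fderiv_clairaut_ne_zero hr hp00)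
  have hFS' : ∀ᶠ p in 𝓝 p₀, ∀ y : UnitTangent g, y.1 = clairautVec r Φ p → y ∈ Sec → F y.1 = 0 := by
    have hnh : 𝓝 x₀ = comap Subtype.val (𝓝 x₀.1) := nhds_induced _ _
    rw [hnh, eventually_comap, hp₀.2] at hFS
    exact hcv.continuousAt.eventually hFS
  refine ⟨_, inter_mem hU hFS', K, hK, fun δ hδ => (measure_mono ?_).trans (hUK δ hδ)⟩
  rintro p ⟨⟨hpU, hpF⟩, ⟨y, hy, hyp⟩, hpc⟩
  refine ⟨hpU, ?_, hpc⟩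
  rw [hG]; simp only [← hyp]
  exact hpF y hyp hy

/-- The part of the section near `Ω₊` with Clairaut constant `δ`-close to `±1` has measure
`O(δ)`. -/
theorem IsNeck.exists_section_measure_le [T2Space S] (hr : 4 ≤ r) (hN : IsNeck g r ε₁ Φ)
    (hφ : IsGeodesicFlow g φ) (hSec : IsNeckSection g r ε₁ Φ φ ε₀ χ Sec) {a b : ℝ} (ha : 0 < a)
    (hb : b < ε₁) : ∃ K : ℝ, 0 ≤ K ∧ ∀ δ : ℝ, 0 ≤ δ →
      μH[2] {p | p ∈ clairautBox b ∧ a ≤ |p 0| ∧ clairautVec r Φ p ∈ Subtype.val '' Sec ∧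
        |(|clairaut r p| - 1)| ≤ δ} ≤ ENNReal.ofReal (K * δ) := by
  set Q : Set E3 := (clairautBox b ∩ {p | a ≤ |p 0|}) ∩
    clairautVec r Φ ⁻¹' (Subtype.val '' Sec) with hQ
  have hbox : IsCompact (clairautBox b ∩ {p | a ≤ |p 0|}) :=
    (isCompact_clairautBox b).inter_right
      (isClosed_le (g := fun p : E3 => |p 0|) continuous_const (by fun_prop))
  have hQc : IsCompact Q := by
    refine hbox.of_isClosed_subset (ContinuousOn.preimage_isClosed_of_isClosed ?_ hbox.isClosed
      (hSec.compact.image continuous_subtype_val).isClosed) inter_subset_left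
    exact fun p hp => (hN.contMDiffAt_clairautVec hr
      (hp.1.1.trans_lt hb)).continuousAt.continuousWithinAt
  have key : ∃ K : ℝ, 0 ≤ K ∧ ∀ δ : ℝ, 0 ≤ δ → μH[2] {p | p ∈ Q ∧
      clairautVec r Φ p ∈ Subtype.val '' Sec ∧ |(|clairaut r p| - 1)| ≤ δ} ≤
        ENNReal.ofReal (K * δ) := by
    refine hQc.induction_on (p := fun s => ∃ K : ℝ, 0 ≤ K ∧ ∀ δ : ℝ, 0 ≤ δ → μH[2] {p | p ∈ s ∧
      clairautVec r Φ p ∈ Subtype.val '' Sec ∧ |(|clairaut r p| - 1)| ≤ δ} ≤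
        ENNReal.ofReal (K * δ)) ?_ ?_ ?_ ?_
    · exact ⟨0, le_rfl, fun δ _ => by simp⟩
    · rintro s t hst ⟨K, hK, h⟩
      refine ⟨K, hK, fun δ hδ => le_trans (measure_mono ?_) (h δ hδ)⟩
      exact fun p hp => ⟨hst hp.1, hp.2⟩
    · rintro s t ⟨K, hK, h⟩ ⟨K', hK', h'⟩
      refine ⟨K + K', by positivity, fun δ hδ => ?_⟩
      rw [add_mul, ENNReal.ofReal_add (by positivity) (by positivity)]
      refine le_trans (measure_mono ?_) ((measure_union_le _ _).trans (add_le_add (h δ hδ) (h' δ hδ)))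
      rintro p ⟨hp | hp, hp'⟩
      exacts [Or.inl ⟨hp, hp'⟩, Or.inr ⟨hp, hp'⟩]
    · rintro p ⟨⟨hpb, hpa⟩, x₀, hx₀, hxp⟩
      obtain ⟨F, hF, hFS, hFt⟩ := hSec.transverse x₀ hx₀
      have hp0 : p 0 ≠ 0 := by
        intro h
        have : a ≤ |p 0| := hpa
        rw [h, abs_zero] at this; linarith
      obtain ⟨U, hU, K, hK, h⟩ := hN.exists_local_section_measure_le hr hφ hF hFS hFt
        (p₀ := p) ⟨hpb.1.trans_lt hb, hxp⟩ hp0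
      exact ⟨U, mem_nhdsWithin_of_mem_nhds hU, K, hK, h⟩
  obtain ⟨K, hK, h⟩ := key
  refine ⟨K, hK, fun δ hδ => le_trans (measure_mono ?_) (h δ hδ)⟩
  exact fun p hp => ⟨⟨⟨hp.1, hp.2.1⟩, hp.2.2.1⟩, hp.2.2⟩

end Surface

/-! ### The angle of entrance and the lower bound for the measure of the section -/

/-- `|dθ/ds|` along an orbit of Clairaut constant `c ≥ 0`, from `sin ψ = ±√(1 - c²/ξ²)`. -/
def angleRate (r c s : ℝ) : ℝ :=
  c * meridianSpeed r s / (profile r s * √(profile r s ^ 2 - c ^ 2))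

/-- The signed angle by which `θ` changes from `s` to `ε₀` along an incoming orbit (`s > 0`,
`sin ψ < 0`) of Clairaut constant `c`. -/
def sweptAngle (r ε₀ c s : ℝ) : ℝ := ∫ u in ε₀..s, angleRate r c u

theorem continuous_angleRate {r c : ℝ} (hr : 4 ≤ r) (hc0 : 0 ≤ c) (hc : c < 1) :
    Continuous (angleRate r c) := by
  have h1 := (contDiff_profile hr).continuous
  refine (continuous_const.mul (contDiff_meridianSpeed hr).continuous).div
    (h1.mul ((h1.pow 2).sub continuous_const).sqrt) fun s => ?_
  have h2 := one_le_profile r s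
  have h3 : 0 < profile r s ^ 2 - c ^ 2 := by nlinarith
  exact (mul_pos (profile_pos r s) (Real.sqrt_pos.2 h3)).ne'

theorem hasDerivAt_sweptAngle {r ε₀ c : ℝ} (hr : 4 ≤ r) (hc0 : 0 ≤ c) (hc : c < 1) (s : ℝ) :
    HasDerivAt (sweptAngle r ε₀ c) (angleRate r c s) s :=
  ((continuous_angleRate hr hc0 hc).integral_hasStrictDerivAt ε₀ s).hasDerivAt

theorem exists_lipschitz_of_contDiffAt {E F : Type*} [NormedAddCommGroup E] [NormedSpace ℝ E]
    [NormedAddCommGroup F] [NormedSpace ℝ F] {f : E → F} {s : Set E} (hs : IsCompact s)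
    (hf : ∀ x ∈ s, ContDiffAt ℝ 1 f x) : ∃ K : NNReal, LipschitzOnWith K f s := by
  refine LocallyLipschitzOn.exists_lipschitzOnWith_of_compact hs fun x hx => ?_
  obtain ⟨K, t, ht, hK⟩ := (hf x hx).exists_lipschitzOnWith
  exact ⟨K, t, mem_nhdsWithin_of_mem_nhds ht, hK⟩

/-- The Lipschitz constant is uniform up to `c = 1` because `s` is bounded away from `0`, where
`ξ² - c²` would degenerate. -/
theorem exists_lipschitz_sweptAngle {r ε₀ : ℝ} (hr : 4 ≤ r) (hε : 0 < ε₀) :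
    ∃ K : ℝ, 0 ≤ K ∧ ∀ s ∈ Icc (ε₀ / 2) (2 * ε₀), ∀ s' ∈ Icc (ε₀ / 2) (2 * ε₀),
      ∀ c ∈ Ico (1 / 2 : ℝ) 1, ∀ c' ∈ Ico (1 / 2 : ℝ) 1,
        |sweptAngle r ε₀ c s - sweptAngle r ε₀ c' s'| ≤ K * |s - s'| + K * |c - c'| := by
  set R : Set (ℝ × ℝ) := Icc (1 / 2 : ℝ) 1 ×ˢ Icc (ε₀ / 2) (2 * ε₀) with hR
  have hRc : IsCompact R := isCompact_Icc.prod isCompact_Icc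
  have hcd : ∀ q ∈ R, ContDiffAt ℝ 1 (fun q : ℝ × ℝ => angleRate r q.1 q.2) q := by
    rintro ⟨c, s⟩ ⟨hc, hs⟩
    have h1 : ContDiff ℝ 1 fun q : ℝ × ℝ => profile r q.2 := (contDiff_profile hr).comp contDiff_snd
    have h2 : ContDiff ℝ 1 fun q : ℝ × ℝ => meridianSpeed r q.2 :=
      (contDiff_meridianSpeed hr).comp contDiff_snd
    have h3 : 1 < profile r s := by
      have : 0 < |s| ^ r := Real.rpow_pos_of_pos (abs_pos.2 (by
        have := hs.1; simp only at this; linarith)) r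
      unfold profile; linarith
    have h4 : 0 < profile r s ^ 2 - c ^ 2 := by
      have := hc.1; have := hc.2; simp only at *; nlinarith
    refine ContDiffAt.div (contDiffAt_fst.mul h2.contDiffAt) (h1.contDiffAt.mul
      (((h1.contDiffAt.pow 2).sub (contDiffAt_fst.pow 2)).sqrt h4.ne')) ?_
    exact (mul_pos (profile_pos r s) (Real.sqrt_pos.2 h4)).ne'
  obtain ⟨K₁, hK₁⟩ := exists_lipschitz_of_contDiffAt hRc hcd
  obtain ⟨K₂, hK₂⟩ := hRc.exists_bound_of_continuousOn fun q hq =>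
    (hcd q hq).continuousAt.continuousWithinAt
  have hK₂0 : 0 ≤ K₂ := (norm_nonneg _).trans
    (hK₂ (1, ε₀) ⟨⟨by norm_num, by norm_num⟩, ⟨by simp only; linarith, by simp only; linarith⟩⟩)
  refine ⟨K₂ + K₁ * ε₀, by positivity, fun s hs s' hs' c hc c' hc' => ?_⟩
  have hck := continuous_angleRate hr (by linarith [hc.1]) hc.2
  have hck' := continuous_angleRate hr (by linarith [hc'.1]) hc'.2
  have hsplit : sweptAngle r ε₀ c s - sweptAngle r ε₀ c' s' =
      (∫ u in s'..s, angleRate r c u) + ∫ u in ε₀..s', (angleRate r c u - angleRate r c' u) := by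
    unfold sweptAngle
    rw [intervalIntegral.integral_sub (hck.intervalIntegrable _ _) (hck'.intervalIntegrable _ _),
      ← intervalIntegral.integral_add_adjacent_intervals (hck.intervalIntegrable ε₀ s')
        (hck.intervalIntegrable s' s)]
    ring
  have hεmem : ε₀ ∈ Icc (ε₀ / 2) (2 * ε₀) := ⟨by linarith, by linarith⟩
  have hb1 : ‖∫ u in s'..s, angleRate r c u‖ ≤ K₂ * |s - s'| := by
    refine intervalIntegral.norm_integral_le_of_norm_le_const fun u hu => ?_
    exact hK₂ (c, u) ⟨⟨hc.1, hc.2.le⟩, uIcc_subset_Icc hs' hs (uIoc_subset_uIcc hu)⟩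
  have hb2 : ‖∫ u in ε₀..s', (angleRate r c u - angleRate r c' u)‖ ≤
      (K₁ * |c - c'|) * |s' - ε₀| := by
    refine intervalIntegral.norm_integral_le_of_norm_le_const fun u hu => ?_
    have hu' := uIcc_subset_Icc hεmem hs' (uIoc_subset_uIcc hu)
    have := hK₁.dist_le_mul (c, u) ⟨⟨hc.1, hc.2.le⟩, hu'⟩ (c', u) ⟨⟨hc'.1, hc'.2.le⟩, hu'⟩
    simpa [dist_eq_norm, Prod.norm_def] using this
  have h3 : |s' - ε₀| ≤ ε₀ := abs_le.2 ⟨by linarith [hs'.1], by linarith [hs'.2]⟩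
  rw [hsplit]
  rw [Real.norm_eq_abs] at hb1 hb2
  have h4 : K₁ * |c - c'| * |s' - ε₀| ≤ K₁ * |c - c'| * ε₀ := by gcongr
  calc _ ≤ |∫ u in s'..s, angleRate r c u| +
        |∫ u in ε₀..s', (angleRate r c u - angleRate r c' u)| := abs_add_le _ _
    _ ≤ K₂ * |s - s'| + K₁ * |c - c'| * ε₀ := by linarith
    _ ≤ (K₂ + K₁ * ε₀) * |s - s'| + (K₂ + K₁ * ε₀) * |c - c'| := by
      have h5 := mul_nonneg (mul_nonneg K₁.coe_nonneg hε.le) (abs_nonneg (s - s'))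
      have h6 := mul_nonneg hK₂0 (abs_nonneg (c - c'))
      nlinarith

/-- Clairaut constant and cosine of the angle `θ` at the entrance `s = ε₀`, as functions of the
Clairaut coordinates of an incoming vector near `s = ε₀`. -/
def entrance (r ε₀ : ℝ) (p : E3) : ℝ × ℝ :=
  (clairaut r p, Real.cos (p 1 + sweptAngle r ε₀ (clairaut r p) (p 0)))

/-- Vectors near the entrance `s = ε₀` with Clairaut constant in `[1/2, 1)`. -/
def entranceRegion (r ε₀ : ℝ) : Set E3 :=
  {p | p ∈ clairautBox (2 * ε₀) ∧ ε₀ / 2 ≤ p 0 ∧ clairaut r p ∈ Ico (1 / 2 : ℝ) 1}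

theorem exists_lipschitz_entrance {r ε₀ : ℝ} (hr : 4 ≤ r) (hε : 0 < ε₀) :
    ∃ K : NNReal, LipschitzOnWith K (entrance r ε₀) (entranceRegion r ε₀) := by
  obtain ⟨K₁, hK₁, h₁⟩ := exists_lipschitz_sweptAngle hr hε
  obtain ⟨K₂, h₂⟩ := exists_lipschitz_of_contDiffAt (isCompact_clairautBox (2 * ε₀))
    fun p _ => (contDiff_clairaut hr).contDiffAt (x := p)
  have hcoord : ∀ (p q : E3) (i : Fin 3), |p i - q i| ≤ dist p q := fun p q i => by
    have := PiLp.norm_apply_le (p - q) i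
    rwa [← dist_eq_norm] at this
  refine ⟨K₂ + 1 + ⟨K₁, hK₁⟩ + ⟨K₁, hK₁⟩ * K₂, LipschitzOnWith.of_dist_le_mul fun p hp q hq => ?_⟩
  have hc := h₂.dist_le_mul p hp.1 q hq.1
  rw [Real.dist_eq] at hc
  have hd := dist_nonneg (x := p) (y := q)
  have hp0 : p 0 ∈ Icc (ε₀ / 2) (2 * ε₀) := ⟨hp.2.1, (le_abs_self _).trans hp.1.1⟩
  have hq0 : q 0 ∈ Icc (ε₀ / 2) (2 * ε₀) := ⟨hq.2.1, (le_abs_self _).trans hq.1.1⟩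
  have hs := h₁ (p 0) hp0 (q 0) hq0 _ hp.2.2 _ hq.2.2
  have h3 := hcoord p q 0
  have h4 := hcoord p q 1
  have hK2 := K₂.coe_nonneg
  have h5 := mul_nonneg hK₁ hd
  have h6 := mul_nonneg hK2 hd
  have h7 : K₁ * |clairaut r p - clairaut r q| ≤ K₁ * (K₂ * dist p q) := by gcongr
  have h8 : K₁ * |p 0 - q 0| ≤ K₁ * dist p q := by gcongr
  have h9 : 0 ≤ K₁ * (K₂ * dist p q) := by positivity
  rw [Prod.dist_eq]
  push_cast
  refine max_le ?_ ?_
  · change dist (clairaut r p) (clairaut r q) ≤ _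
    rw [Real.dist_eq]
    change _ ≤ ((K₂ : ℝ) + 1 + K₁ + K₁ * K₂) * dist p q
    nlinarith
  · change dist (Real.cos _) (Real.cos _) ≤ ((K₂ : ℝ) + 1 + K₁ + K₁ * K₂) * dist p q
    rw [Real.dist_eq]
    refine (Real.abs_cos_sub_cos_le _ _).trans ?_
    have h10 := abs_add_le (p 1 - q 1) (sweptAngle r ε₀ (clairaut r p) (p 0) -
      sweptAngle r ε₀ (clairaut r q) (q 0))
    rw [show p 1 + sweptAngle r ε₀ (clairaut r p) (p 0) - (q 1 + sweptAngle r ε₀ (clairaut r q) (q 0))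
      = p 1 - q 1 + (sweptAngle r ε₀ (clairaut r p) (p 0) - sweptAngle r ε₀ (clairaut r q) (q 0)) by ring]
    nlinarith

/-- A set of incoming vectors in which all cosines of entrance angles occur for all Clairaut constants
in `(1 - δ, 1)` has measure at least of order `δ`. -/
theorem exists_le_measure {r ε₀ : ℝ} (hr : 4 ≤ r) (hε : 0 < ε₀) :
    ∃ κ : ℝ, 0 < κ ∧ ∀ δ : ℝ, 0 ≤ δ → ∀ B : Set E3,
      Ioo (1 - δ) 1 ×ˢ Icc (-1 : ℝ) 1 ⊆ entrance r ε₀ '' (B ∩ entranceRegion r ε₀) →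
        ENNReal.ofReal (κ * δ) ≤ μH[2] B := by
  obtain ⟨K, hK⟩ := exists_lipschitz_entrance hr hε
  -- `K + 1` instead of `K`, since `K` might be zero
  have hK1 : LipschitzOnWith (K + 1) (entrance r ε₀) (entranceRegion r ε₀) :=
    hK.weaken (by simp)
  refine ⟨2 / ((K : ℝ) + 1) ^ 2, by positivity, fun δ hδ B hB => ?_⟩
  have h1 := (hK1.mono (inter_subset_right (s := B))).hausdorffMeasure_image_le (d := 2) (by norm_num)
  rw [hausdorffMeasure_prod_real] at h1
  have h2 := (measure_mono (μ := volume) hB).trans h1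
  rw [Measure.volume_eq_prod, Measure.prod_prod, Real.volume_Ioo, Real.volume_Icc,
    ← ENNReal.ofReal_mul (by linarith)] at h2
  have h3 := h2.trans (mul_le_mul_right (measure_mono (μ := μH[2]) (inter_subset_left
    (s := B) (t := entranceRegion r ε₀))) _)
  have hcoe : ((K + 1 : NNReal) : ℝ≥0∞) ^ (2 : ℝ) = ENNReal.ofReal (((K : ℝ) + 1) ^ 2) := by
    rw [← ENNReal.ofReal_coe_nnreal, ENNReal.ofReal_rpow_of_nonneg (by positivity) (by norm_num)]
    congr 1
    rw [show (2 : ℝ) = (2 : ℕ) by norm_num, Real.rpow_natCast]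
    push_cast; ring
  rw [hcoe] at h3
  have hpos : (0 : ℝ) < ((K : ℝ) + 1) ^ 2 := by positivity
  rw [show 2 / ((K : ℝ) + 1) ^ 2 * δ = (1 - (1 - δ)) * (1 - -1) * (((K : ℝ) + 1) ^ 2)⁻¹ by
    field_simp; ring, ENNReal.ofReal_mul (by linarith), ENNReal.ofReal_inv_of_pos hpos,
    ← div_eq_mul_inv]
  exact ENNReal.div_le_of_le_mul (h3.trans (le_of_eq (mul_comm _ _)))

section Surface

variable {S : Type*} [TopologicalSpace S] [ChartedSpace E2 S] [IsManifold (𝓡 2) 4 S]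
variable {g : Metric S} {r ε₀ ε₁ χ : ℝ} {Φ : E2 → S} {φ : Flow ℝ (UnitTangent g)}

/-- The angle of entrance is constant along incoming orbits. -/
theorem IsNeck.entranceAngle_const [T2Space S] (hN : IsNeck g r ε₁ Φ)
    (hφ : IsGeodesicFlow g φ) (hχ : SmallScale r ε₀ ε₁ χ) {y : UnitTangent g}
    (hy : y ∈ OmegaPlus g r ε₁ Φ ε₀ χ) (hys : neckS r ε₁ Φ y = ε₀)
    (hyc : neckC r ε₁ Φ y ∈ Ico (1 / 2 : ℝ) 1) {t : ℝ} (ht : t ∈ Icc (-χ) χ) :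
    neckAngle r ε₁ Φ (φ t y) *
      Complex.exp (sweptAngle r ε₀ (neckC r ε₁ Φ y) (neckS r ε₁ Φ (φ t y)) * Complex.I) =
    neckAngle r ε₁ Φ y := by
  obtain ⟨hyn, hys', hyv, hyc'⟩ := hN.mem_omegaPlus.1 hy
  have hχ0 := hχ.chi_pos
  have hr := hχ.four_le
  have hε0 : 0 < ε₀ := by linarith [hχ.chi_le]
  set c := neckC r ε₁ Φ y with hc
  have hnear : ∀ u ∈ Icc (-χ) χ, _ := fun u hu =>
    hN.near_omega hφ hχ hyn hys' hyc' (t := u) ⟨by linarith [hu.1], by linarith [hu.2]⟩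
  have hd : ∀ u ∈ Icc (-χ) χ, HasDerivAt (fun u => neckAngle r ε₁ Φ (φ u y) *
      Complex.exp (sweptAngle r ε₀ c (neckS r ε₁ Φ (φ u y)) * Complex.I)) 0 u := by
    intro u hu
    obtain ⟨h1, -, -, h4, h5⟩ := hnear u hu
    obtain ⟨ds, -, -, dθ⟩ := hN.hasDerivAt_orbit hr hφ h1
    have hv : neckSin r ε₁ Φ (φ u y) < 0 := by
      rw [hys] at hyv
      have : neckSin r ε₁ Φ y < 0 := by nlinarith
      nlinarith
    set σ := neckS r ε₁ Φ (φ u y) with hσ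
    set ν := neckSin r ε₁ Φ (φ u y) with hν
    replace h5 : neckC r ε₁ Φ (φ u y) = c := h5
    have hξ := profile_pos r σ
    have hρ := meridianSpeed_pos r σ
    have hω : neckCos r ε₁ Φ (φ u y) = c / profile r σ := by
      rw [eq_div_iff hξ.ne', mul_comm]; exact h5
    have hsq : √(profile r σ ^ 2 - c ^ 2) = -(profile r σ * ν) := by
      have h6 := neckC_sq (r := r) (ε₁ := ε₁) (Φ := Φ) (φ u y)
      rw [h5, ← hσ, ← hν] at h6
      rw [show profile r σ ^ 2 - c ^ 2 = (-(profile r σ * ν)) ^ 2 by linarith]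
      exact Real.sqrt_sq (by nlinarith)
    have dH := (hasDerivAt_sweptAngle (ε₀ := ε₀) hr (by linarith [hyc.1]) hyc.2 σ).comp u ds
    have hrate : angleRate r c σ * (ν / meridianSpeed r σ) = -(c / profile r σ / profile r σ) := by
      unfold angleRate
      rw [hsq]
      have := hv.ne
      field_simp
    rw [hrate] at dH
    refine (dθ.mul (dH.ofReal_comp.mul_const Complex.I).cexp).congr_deriv ?_
    rw [hω]
    simp only [Function.comp_apply]
    push_cast
    ring
  have h00 : (0 : ℝ) ∈ Icc (-χ) χ := ⟨by linarith, by linarith⟩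
  have h1 := (convex_Icc (-χ) χ).norm_image_sub_le_of_norm_hasDerivWithin_le (C := 0)
    (fun u hu => (hd u hu).hasDerivWithinAt) (by simp) h00 ht
  rw [zero_mul, norm_le_zero_iff, sub_eq_zero, φ.map_zero_apply, hys] at h1
  rw [h1]
  simp [sweptAngle]

end Surface

/-! ### Tails of the return time -/

theorem exists_smallScale {r ε₀ ε₁ : ℝ} (hr : 4 ≤ r) (hε₀ : 0 < ε₀) (hε₁ : ε₀ < ε₁) :
    ∃ χ₀ : ℝ, 0 < χ₀ ∧ ∀ χ : ℝ, 0 < χ → χ < χ₀ → SmallScale r ε₀ ε₁ χ := by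
  have h1 : 0 < |ε₀ / 2| ^ r := Real.rpow_pos_of_pos (abs_pos.2 (by positivity)) r
  refine ⟨min (min (1 / 2) (ε₀ / 8)) (min ((ε₁ - ε₀) / 8) (|ε₀ / 2| ^ r)),
    lt_min (lt_min (by norm_num) (by positivity)) (lt_min (by linarith) h1), fun χ hχ h => ?_⟩
  obtain ⟨h2, h3⟩ := lt_min_iff.1 h
  obtain ⟨h4, h5⟩ := lt_min_iff.1 h2
  obtain ⟨h6, h7⟩ := lt_min_iff.1 h3
  exact ⟨hr, hχ, h4.le, by linarith, by linarith, by unfold profile; linarith⟩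

section Surface

variable {S : Type*} [TopologicalSpace S] [ChartedSpace E2 S] [IsManifold (𝓡 2) 4 S]
variable {g : Metric S} {r ε₀ ε₁ χ : ℝ} {Φ : E2 → S} {φ : Flow ℝ (UnitTangent g)}
variable {Sec : Set (UnitTangent g)}

/-- There are vectors of `Ω₊` at `s = ε₀` with prescribed Clairaut constant and cosine of `θ`. -/
theorem IsNeck.exists_mem_omegaPlus (hN : IsNeck g r ε₁ Φ) (hχ : SmallScale r ε₀ ε₁ χ)
    {c α : ℝ} (hc0 : 0 < c) (hc1 : c < 1) (hcχ : 1 - c < χ) (hα : α ∈ Icc (-1 : ℝ) 1) :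
    ∃ y ∈ OmegaPlus g r ε₁ Φ ε₀ χ, neckS r ε₁ Φ y = ε₀ ∧ neckSin r ε₁ Φ y < 0 ∧
      neckC r ε₁ Φ y = c ∧ (neckAngle r ε₁ Φ y).re = α := by
  have hχ0 := hχ.chi_pos
  have hε0 : 0 < ε₀ := by linarith [hχ.chi_le]
  have hε1 : ε₀ < ε₁ := by linarith [hχ.chi_le']
  have hξ := one_le_profile r ε₀
  set ψ := Real.arccos (c / profile r ε₀) with hψ
  have hq0 : 0 < c / profile r ε₀ := div_pos hc0 (profile_pos r ε₀)
  have hq1 : c / profile r ε₀ < 1 := by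
    rw [div_lt_one (profile_pos r ε₀)]; linarith
  have hcos : Real.cos ψ = c / profile r ε₀ := Real.cos_arccos (by linarith) hq1.le
  have hsin : 0 < Real.sin ψ := by
    rw [hψ, Real.sin_arccos]; exact Real.sqrt_pos.2 (by nlinarith)
  set p : E3 := !₂[ε₀, Real.arccos α, -ψ] with hp
  have hpε : |p 0| < ε₁ := by simpa [hp, abs_of_pos hε0] using hε1
  set y : UnitTangent g := ⟨clairautVec r Φ p, hN.inner_clairautVec hpε⟩
  have hy : HasClairaut g r ε₁ Φ y p := ⟨hpε, rfl⟩
  have hs : neckS r ε₁ Φ y = ε₀ := by rw [hN.neckS_eq hy]; simp [hp]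
  have hv : neckSin r ε₁ Φ y < 0 := by rw [hN.neckSin_eq hy]; simpa [hp] using hsin
  have hc : neckC r ε₁ Φ y = c := by
    rw [hN.neckC_eq hy]
    simp only [clairaut, hp, Matrix.cons_val, Real.cos_neg, hcos]
    exact mul_div_cancel₀ _ (profile_pos r ε₀).ne'
  refine ⟨y, hN.mem_omegaPlus.2 ⟨⟨p, hy⟩, by rw [hs, abs_of_pos hε0], ?_, ?_⟩, hs, hv, hc, ?_⟩
  · rw [hs]; exact mul_neg_of_pos_of_neg hε0 hv
  · rw [hc, abs_of_pos hc0, abs_of_neg (by linarith)]; linarith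
  · rw [hN.neckAngle_eq hy, Complex.exp_ofReal_mul_I_re]
    simp only [hp, Matrix.cons_val]
    exact Real.cos_arccos hα.1 hα.2

/-- Upper bound for the tails: return times larger than `n` require a Clairaut constant within
`O(n^(-2r/(r-2)))` of `±1`. -/
theorem IsNeck.exists_tail_le [T2Space S] (hN : IsNeck g r ε₁ Φ)
    (hφ : IsGeodesicFlow g φ) (hχ : SmallScale r ε₀ ε₁ χ)
    (hSec : IsNeckSection g r ε₁ Φ φ ε₀ χ Sec) (n₀ : ℕ) :
    ∃ K : ℝ, 0 ≤ K ∧ ∀ᶠ n : ℕ in atTop, clairautLeb g r ε₁ Φ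
      {x | x ∈ SigmaPlus g r ε₁ Φ φ ε₀ χ Sec n₀ ∧ (n : ℝ) < hitTime φ Sec x} ≤
        ENNReal.ofReal (K * (n : ℝ) ^ (-(2 * r / (r - 2)))) := by
  have hr := hχ.four_le
  have hχ0 := hχ.chi_pos
  have hε0 : 0 < ε₀ := by linarith [hχ.chi_le]
  obtain ⟨C, hC0, hC⟩ := exists_transit_le hr ε₀
  obtain ⟨K, hK, hmeas⟩ := hN.exists_section_measure_le hr hφ hSec (a := ε₀ / 2) (b := ε₀ + χ)
    (by linarith) (by linarith [hχ.chi_le'])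
  set γ := 2 * r / (r - 2) with hγ
  have hβ : (0 : ℝ) < 1 / 2 - 1 / r := by
    have : 1 / r ≤ 1 / 4 := one_div_le_one_div_of_le (by norm_num) hr
    linarith
  have hβγ : (1 / 2 - 1 / r) * γ = 1 := by
    have : r - 2 ≠ 0 := by linarith
    have : r ≠ 0 := by linarith
    rw [hγ]; field_simp
  have hγ0 : 0 < γ := div_pos (by linarith) (by linarith)
  refine ⟨K * (2 * C) ^ γ, by positivity, ?_⟩
  filter_upwards [eventually_ge_atTop 2] with n hn
  have hn2 : (2 : ℝ) ≤ n := by exact_mod_cast hn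
  rw [mul_assoc]
  refine le_trans (measure_mono ?_) (hmeas _ (by positivity))
  rintro p ⟨hp1, hp2, x, ⟨hx, hxn⟩, hxp⟩
  have hxT := hx.2.1
  have hx' := hxT
  obtain ⟨a, ha, y, hy, hay⟩ := hx'
  obtain ⟨-, h2, -⟩ := hN.flowTube_omegaPlus hφ hχ hy ha
  rw [← hay, hN.neckS_eq hxp] at h2
  obtain ⟨h3, h4⟩ := abs_le.1 h2
  refine ⟨⟨by linarith, ⟨hp1.1, hp1.2.le⟩, ⟨hp2.1, hp2.2.le⟩⟩, by linarith [hχ.chi_le],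
    ⟨x, hx.1, hxp.2⟩, ?_⟩
  rw [← hN.neckC_eq hxp]
  -- asymptotic vectors satisfy any bound on `||c| - 1|`, so nothing is needed about their return times
  rcases eq_or_ne |neckC r ε₁ Φ x| 1 with h1 | h1
  · rw [h1, sub_self, abs_zero]; positivity
  have h5 := hN.hitTime_le_of_mem hφ hχ hSec hC hxT h1
  set d := |(|neckC r ε₁ Φ x| - 1)| with hd
  have hd0 : 0 < d := abs_pos.2 (sub_ne_zero.2 h1)
  have h6 : (n : ℝ) / 2 < C * d ^ (-(1 / 2 - 1 / r)) := by linarith [hχ.chi_le_half]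
  rw [Real.rpow_neg hd0.le] at h6
  have hdβ : 0 < d ^ (1 / 2 - 1 / r) := Real.rpow_pos_of_pos hd0 _
  have h7 : d ^ (1 / 2 - 1 / r) ≤ 2 * C / n := by
    rw [le_div_iff₀ (by linarith)]
    rw [← div_eq_mul_inv, lt_div_iff₀ hdβ] at h6
    nlinarith
  have h8 := Real.rpow_le_rpow hdβ.le h7 hγ0.le
  rw [← Real.rpow_mul hd0.le, hβγ, Real.rpow_one, Real.div_rpow (by positivity) (by positivity)] at h8
  rwa [Real.rpow_neg (by positivity), ← div_eq_mul_inv]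

/-- Lower bound for the tails: all incoming vectors at `s = ε₀` with Clairaut constant within a
multiple of `n^(-2r/(r-2))` below `1` give points of the section with return time larger
than `n`. -/
theorem IsNeck.exists_le_tail [T2Space S] (hN : IsNeck g r ε₁ Φ)
    (hφ : IsGeodesicFlow g φ) (hχ : SmallScale r ε₀ ε₁ χ)
    (hSec : IsNeckSection g r ε₁ Φ φ ε₀ χ Sec) {n₀ : ℕ} (hn₀ : 0 < n₀) :
    ∃ κ : ℝ, 0 < κ ∧ ∀ᶠ n : ℕ in atTop, ENNReal.ofReal (κ * (n : ℝ) ^ (-(2 * r / (r - 2)))) ≤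
      clairautLeb g r ε₁ Φ
        {x | x ∈ SigmaPlus g r ε₁ Φ φ ε₀ χ Sec n₀ ∧ (n : ℝ) < hitTime φ Sec x} := by
  have hr := hχ.four_le
  have hχ0 := hχ.chi_pos
  have hε0 : 0 < ε₀ := by linarith [hχ.chi_le]
  obtain ⟨δ₁, hδ₁, hhit⟩ := hN.exists_last_hit hφ hχ hSec
  obtain ⟨κ, hκ, hmeas⟩ := exists_le_measure hr hε0
  set γ := 2 * r / (r - 2) with hγ
  have hβ : (0 : ℝ) < 1 / 2 - 1 / r := by
    have : 1 / r ≤ 1 / 4 := one_div_le_one_div_of_le (by norm_num) hr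
    linarith
  have hβγ : γ * (1 / 2 - 1 / r) = 1 := by
    have : r - 2 ≠ 0 := by linarith
    have : r ≠ 0 := by linarith
    rw [hγ]; field_simp
  have hγ0 : 0 < γ := div_pos (by linarith) (by linarith)
  -- constants `c > 1 - (2n)^(-γ)` give crossing times above `2n`, hence return times above
  -- `2n - 2χ ≥ n`
  refine ⟨κ * 2 ^ (-γ), by positivity, ?_⟩
  have hlim : Tendsto (fun n : ℕ => (2 * (n : ℝ)) ^ (-γ)) atTop (𝓝 0) :=
    (tendsto_rpow_neg_atTop hγ0).comp
      (tendsto_natCast_atTop_atTop.const_mul_atTop (by norm_num : (0 : ℝ) < 2))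
  have hsmall : 0 < min (min δ₁ χ) (min (1 / (n₀ : ℝ) ^ 2) (ε₀ ^ r)) := by
    have : (0 : ℝ) < n₀ := by exact_mod_cast hn₀
    exact lt_min (lt_min hδ₁ hχ0) (lt_min (by positivity) (by positivity))
  filter_upwards [hlim.eventually (gt_mem_nhds hsmall), eventually_ge_atTop 1] with n hn hn1
  obtain ⟨hna, hnb⟩ := lt_min_iff.1 hn
  obtain ⟨hnδ, hnχ⟩ := lt_min_iff.1 hna
  obtain ⟨hnn, hnε⟩ := lt_min_iff.1 hnb
  have hn1' : (1 : ℝ) ≤ n := by exact_mod_cast hn1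
  set δ : ℝ := (2 * (n : ℝ)) ^ (-γ) with hδ
  have hδ0 : 0 < δ := by positivity
  rw [mul_assoc, ← Real.mul_rpow (by norm_num) (by positivity)]
  refine hmeas δ hδ0.le _ ?_
  rintro ⟨c, α⟩ ⟨hc, hα⟩
  have hcl : 1 - δ < c := hc.1
  have hcr : c < 1 := hc.2
  have hχh := hχ.chi_le_half
  obtain ⟨y, hy, hys, hyv, hyc, hyα⟩ := hN.exists_mem_omegaPlus hχ (c := c) (α := α) (by linarith)
    hcr (by linarith) hα
  have hcabs : |c| = c := abs_of_pos (by linarith)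
  have hd : |(|c| - 1)| = 1 - c := by rw [hcabs, abs_of_neg (by linarith)]; ring
  obtain ⟨T, hT0, hTm, hTle, a, ha, haS, hret, hmem, hTh⟩ := hhit y hy
    (by rw [hyc, hd]; linarith) (by rw [hyc, hcabs]; exact hcr.ne)
  have hTlow : (1 - c) ^ (-(1 / 2 - 1 / r)) ≤ T := by
    have hor := hN.isNeckOrbit hr hφ hT0.le hTle
    rw [hyc] at hor
    have h1 := le_transit_of_lt_one hr hor hT0 (by rw [hcabs]; exact hcr) ?_
      (by simp only [φ.map_zero_apply, hys]) (by simp only [φ.map_zero_apply]; exact hyv)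
      (hN.mem_omegaMinus.1 hTm).2.1
    · rwa [hcabs] at h1
    · rw [hcabs]
      calc (1 - c) ^ (1 / r) ≤ (ε₀ ^ r) ^ (1 / r) :=
            Real.rpow_le_rpow (by linarith) (by linarith) (by positivity)
        _ = ε₀ := by
            rw [← Real.rpow_mul hε0.le, mul_one_div_cancel (by linarith), Real.rpow_one]
  have hTn : 2 * (n : ℝ) < T := by
    refine lt_of_lt_of_le ?_ hTlow
    have h1 : δ ^ (-(1 / 2 - 1 / r)) = 2 * n := by
      rw [hδ, ← Real.rpow_mul (by positivity), neg_mul_neg, hβγ, Real.rpow_one]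
    rw [← h1]
    exact Real.rpow_lt_rpow_of_neg (by linarith) (by linarith) (by linarith)
  obtain ⟨hxn, hxs, hxc⟩ := hN.flowTube_omegaPlus hφ hχ hy ha
  obtain ⟨-, hxs', -⟩ := hN.near_omega hφ hχ (hN.mem_omegaPlus.1 hy).1
    (hN.mem_omegaPlus.1 hy).2.1 (hN.mem_omegaPlus.1 hy).2.2.2 (t := a)
    ⟨by linarith [ha.1], by linarith [ha.2]⟩
  have hangle := hN.entranceAngle_const hφ hχ hy hys (by rw [hyc]; exact ⟨by linarith, hcr⟩) ha
  obtain ⟨p, hp⟩ := hxn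
  obtain ⟨q, hq, hq1, hq2, -⟩ := hN.exists_normalized hp
  rw [hN.neckS_eq hq] at hxs' hangle
  rw [hN.neckC_eq hq, hyc] at hxc
  rw [hN.neckAngle_eq hq, hyc, ← Complex.exp_add, ← add_mul, ← Complex.ofReal_add] at hangle
  have hq0 := abs_le.1 (hxs'.trans (abs_le.2 ha))
  rw [hys] at hq0
  have hχε := hχ.chi_le
  refine ⟨q, ⟨⟨hq1, hq2, φ a y, ⟨⟨haS, ⟨a, ha, y, hy, rfl⟩, ⟨q, hq, ?_⟩, hret, hmem⟩, ?_⟩, hq⟩,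
    ⟨?_, ⟨hq1.1, hq1.2.le⟩, ⟨hq2.1, hq2.2.le⟩⟩, ?_, ?_⟩, ?_⟩
  · rw [hxc, hd]; linarith
  · linarith
  · rw [abs_of_pos (by linarith [hq0.1])]; linarith [hq0.2]
  · linarith [hq0.1]
  · rw [hxc]; exact ⟨by linarith, hcr⟩
  · unfold entrance
    rw [hxc, ← hyα, ← hangle, Complex.exp_ofReal_mul_I_re]

end Surface

theorem comparable_of_bounds {a : ℕ → ℝ≥0∞} {b : ℕ → ℝ} (hb : ∀ n, 0 ≤ b n) {κ K : ℝ} (hκ : 0 < κ)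
    (hK : 0 ≤ K) (hl : ∀ᶠ n in atTop, ENNReal.ofReal (κ * b n) ≤ a n)
    (hu : ∀ᶠ n in atTop, a n ≤ ENNReal.ofReal (K * b n)) : Comparable a b := by
  refine ⟨κ⁻¹ + K, by positivity, ?_⟩
  filter_upwards [hl, hu] with n h1 h2
  refine ⟨le_trans (ENNReal.ofReal_le_ofReal ?_) h1, h2.trans (ENNReal.ofReal_le_ofReal ?_)⟩
  · refine mul_le_mul_of_nonneg_right ?_ (hb n)
    rw [inv_le_comm₀ (by positivity) hκ]; linarith
  · refine mul_le_mul_of_nonneg_right ?_ (hb n)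
    have := inv_pos.2 hκ
    linarith

end NeckFlow

end

open NeckFlow in
theorem lemma5p3 (r ε₀ ε₁ : ℝ) (hr : 4 ≤ r) (hε₀ : 0 < ε₀) (hε₁ : ε₀ < ε₁) :
    ∃ χ₀ : ℝ, 0 < χ₀ ∧ ∀ χ : ℝ, 0 < χ → χ < χ₀ →
      ∀ (S : Type*) [TopologicalSpace S] [T2Space S] [CompactSpace S] [ConnectedSpace S]
        [ChartedSpace E2 S] [IsManifold (𝓡 2) 4 S]
        (g : NeckFlow.Metric S) (Φ : E2 → S) (φ : Flow ℝ (UnitTangent g))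
        (Sec : Set (UnitTangent g)),
        IsDegenerateSurface g r ε₁ Φ →
        IsGeodesicFlow g φ →
        IsNeckSection g r ε₁ Φ φ ε₀ χ Sec →
        ∃ N₀ : ℕ, ∀ n₀ : ℕ, N₀ ≤ n₀ →
          Comparable
            (fun n : ℕ => clairautLeb g r ε₁ Φ
              {x | x ∈ SigmaPlus g r ε₁ Φ φ ε₀ χ Sec n₀ ∧
                (n : ℝ) < transitionTime g r ε₁ Φ φ ε₀ χ Sec n₀ x})
            (fun n : ℕ => (n : ℝ) ^ (-(2 * r / (r - 2)))) ∧
          Comparable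
            (fun n : ℕ => clairautLeb g r ε₁ Φ
              {x | x ∈ SigmaPlus g r ε₁ Φ φ ε₀ χ Sec n₀ ∧
                (n : ℝ) < hitTime φ Sec x})
            (fun n : ℕ => (n : ℝ) ^ (-((r + 2) / (r - 2) + 1))) := by
  obtain ⟨χ₀, hχ₀, hsmall⟩ := exists_smallScale hr hε₀ hε₁
  refine ⟨χ₀, hχ₀, fun χ hχ0 hχ1 S _ _ _ _ _ _ g Φ φ Sec hS hφ hSec => ⟨1, fun n₀ hn₀ => ?_⟩⟩
  have hχ := hsmall χ hχ0 hχ1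
  have hN := hS.neck
  obtain ⟨K, hK, hu⟩ := hN.exists_tail_le hφ hχ hSec n₀
  obtain ⟨κ, hκ, hl⟩ := hN.exists_le_tail hφ hχ hSec hn₀
  have hcomp := comparable_of_bounds
    (fun n => Real.rpow_nonneg (Nat.cast_nonneg n) (-(2 * r / (r - 2)))) hκ hK hl hu
  have hset : ∀ n : ℕ, {x | x ∈ SigmaPlus g r ε₁ Φ φ ε₀ χ Sec n₀ ∧
      (n : ℝ) < transitionTime g r ε₁ Φ φ ε₀ χ Sec n₀ x} =
      {x | x ∈ SigmaPlus g r ε₁ Φ φ ε₀ χ Sec n₀ ∧ (n : ℝ) < hitTime φ Sec x} := fun n => by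
    ext x
    exact and_congr_right fun hx => by
      rw [hN.transitionTime_eq hφ hχ hSec.compact.isClosed hx]
  have hexp : (r + 2) / (r - 2) + 1 = 2 * r / (r - 2) := by
    have : r - 2 ≠ 0 := by linarith
    field_simp
    ring
  simp only [hset, hexp]
  exact ⟨hcomp, hcomp⟩
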